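/- Let $d\ge 2$ be an integer and $\alpha<-(d+2)/2$. Write $d\mu_\beta=(1+|x|^2)^{\beta}\,dx$ on $\mathbb R^d$, and let $\mathcal L_{\alpha,d}f=-(1+|x|^2)^{1-\alpha}\,\mathrm{div}\big((1+|x|^2)^{\alpha}\nabla f\big)$ be the self-adjoint operator on $L^2(d\mu_{\alpha-1})$ associated with the quadratic form $\int_{\mathbb R^d}|\nabla f|^2\,d\mu_\alpha$. Consider the inequality $$\Lambda\int_{\mathbb R^d}|f|^2\,d\mu_{\alpha-1}\le\int_{\mathbb R^d}|\nabla f|^2\,d\mu_\alpha\qquad(*)$$ for all real-valued $f\in L^2(d\mu_{\alpha-1})$ such that $$\int_{\mathbb R^d}f\,d\mu_{\alpha-1}=0,\qquad\int_{\mathbb R^d}x\,f\,d\mu_{\alpha-1}=0,\qquad\int_{\mathbb R^d}|x|^2f\,d\mu_{\alpha-1}=0,$$ where $\nabla f$ is the weak gradient and the right-hand side is $+\infty$ if $f$ has no locally integrable weak gradient or if the integral diverges. Then $(*)$ holds with the constant $\Lambda=\Lambda_{\alpha,d}$ given below, and $\Lambda_{\alpha,d}$ is sharp: no larger constant is possible.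 For $d\ge 3$, $$\Lambda_{\alpha,d}=\begin{cases}\frac14(d-2+2\alpha)^2&\text{if }\alpha\in\big[-\frac{d+6}2,-\frac{d+2}2\big),\\ -8\alpha-4(d+2)&\text{if }\alpha\in\big[-(d+2),-\frac{d+6}2\big],\\ -4\alpha&\text{if }\alpha\in(-\infty,-(d+2)],\end{cases}$$ and for $d=2$, $\Lambda_{\alpha,2}=\alpha^2$ if $\alpha\in[-4,-2)$ and $\Lambda_{\alpha,2}=-4\alpha$ if $\alpha\in(-\infty,-4)$. Moreover, for every $d\ge2$: if $\alpha\in[-\frac{d+6}2,-\frac{d+2}2)$, then $\frac14(d-2+2\alpha)^2$ is the bottom (infimum) of the continuous, i.e. essential, spectrum of $\mathcal L_{\alpha,d}$; if $\alpha\in[-(d+2),-\frac{d+6}2)$, then $-8\alpha-4(d+2)$ is an eigenvalue of $\mathcal L_{\alpha,d}$ with an eigenfunction satisfying the three orthogonality conditions; and if $\alpha\le-(d+2)$, then so is $-4\alpha$. -/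

import Mathlib

open MeasureTheory Set Filter Topology
open scoped ENNReal RealInnerProductSpace

noncomputable section

namespace HardyPoincare

/-- The measure `(1 + |x|²)^β dx` on the Euclidean space `ℝ^d`. -/
def weightMeasure (d : ℕ) (β : ℝ) : Measure (EuclideanSpace ℝ (Fin d)) :=
  volume.withDensity fun x => ENNReal.ofReal ((1 + ‖x‖ ^ 2) ^ β)

/-- `G` is the weak (distributional) gradient of `f` on `ℝ^d`:
`∫ f ∇φ dx = - ∫ φ G dx` for every real test function `φ`. -/
structure IsWeakGradient {d : ℕ} (f : EuclideanSpace ℝ (Fin d) → ℝ)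
    (G : EuclideanSpace ℝ (Fin d) → EuclideanSpace ℝ (Fin d)) : Prop where
  locallyIntegrable_fun : LocallyIntegrable f volume
  locallyIntegrable_grad : LocallyIntegrable G volume
  integral_eq : ∀ φ : EuclideanSpace ℝ (Fin d) → ℝ,
    ContDiff ℝ (⊤ : ℕ∞) φ → HasCompactSupport φ →
      ∫ x, f x • gradient φ x = - ∫ x, φ x • G x

/-- The weighted Dirichlet integral `∫ |∇f|² (1 + |x|²)^α dx ∈ [0, ∞]`. The weak gradient is
unique almost everywhere, so the infimum is over at most one value; it is `∞` when `f` has no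
weak gradient. -/
def dirichletEnergy {d : ℕ} (α : ℝ) (f : EuclideanSpace ℝ (Fin d) → ℝ) : ℝ≥0∞ :=
  ⨅ (G : EuclideanSpace ℝ (Fin d) → EuclideanSpace ℝ (Fin d)) (_ : IsWeakGradient f G),
    ∫⁻ x, ‖G x‖ₑ ^ 2 ∂(weightMeasure d α)

/-- `f` lies in `L²((1 + |x|²)^(α-1) dx)` and is orthogonal there to `1`, to the coordinates
and to `|x|²`. -/
structure IsAdmissible {d : ℕ} (α : ℝ) (f : EuclideanSpace ℝ (Fin d) → ℝ) : Prop where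
  memLp : MemLp f 2 (weightMeasure d (α - 1))
  integral_eq_zero : ∫ x, f x ∂(weightMeasure d (α - 1)) = 0
  integral_smul_eq_zero : ∫ x, f x • x ∂(weightMeasure d (α - 1)) = 0
  integral_sq_mul_eq_zero : ∫ x, ‖x‖ ^ 2 * f x ∂(weightMeasure d (α - 1)) = 0

/-- The inequality `Λ ∫ |f|² (1 + |x|²)^(α-1) dx ≤ ∫ |∇f|² (1 + |x|²)^α dx` for all `f` in
`L²((1 + |x|²)^(α-1) dx)` orthogonal to `1`, `x` and `|x|²`. -/
def HardyPoincareInequality (d : ℕ) (α Λ : ℝ) : Prop :=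
  ∀ f : EuclideanSpace ℝ (Fin d) → ℝ, IsAdmissible α f →
    ENNReal.ofReal Λ * ∫⁻ x, ‖f x‖ₑ ^ 2 ∂(weightMeasure d (α - 1)) ≤ dirichletEnergy α f

/-- The inequality holds with constant `Λ`, and with no larger constant. -/
def IsSharpConstant (d : ℕ) (α Λ : ℝ) : Prop :=
  IsGreatest {c : ℝ | HardyPoincareInequality d α c} Λ

/-- `f` belongs to the form domain, and `G` is its weak gradient. -/
structure IsFormElement {d : ℕ} (α : ℝ) (f : EuclideanSpace ℝ (Fin d) → ℝ)
    (G : EuclideanSpace ℝ (Fin d) → EuclideanSpace ℝ (Fin d)) : Prop where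
  memLp_fun : MemLp f 2 (weightMeasure d (α - 1))
  memLp_grad : MemLp G 2 (weightMeasure d α)
  isWeakGradient : IsWeakGradient f G

/-- The graph of the self-adjoint operator `L f = -(1 + |x|²)^(1-α) div ((1 + |x|²)^α ∇f)` on
`L²((1 + |x|²)^(α-1) dx)`, the operator of the closed form `∫ |∇f|² (1 + |x|²)^α dx`: `f` is
in its domain and `L f = h`. -/
def IsInGraph {d : ℕ} (α : ℝ) (f h : EuclideanSpace ℝ (Fin d) → ℝ) : Prop :=
  MemLp h 2 (weightMeasure d (α - 1)) ∧ ∃ G, IsFormElement α f G ∧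
    ∀ φ Φ, IsFormElement α φ Φ →
      ∫ x, ⟪G x, Φ x⟫ ∂(weightMeasure d α) = ∫ x, h x * φ x ∂(weightMeasure d (α - 1))

/-- `f` is an eigenfunction of `L` for the eigenvalue `lam`. -/
def IsEigenfunction {d : ℕ} (α lam : ℝ) (f : EuclideanSpace ℝ (Fin d) → ℝ) : Prop :=
  ¬ f =ᵐ[volume] 0 ∧ IsInGraph α f (fun x => lam * f x)

/-- The continuous (i.e. essential) spectrum of `L`, the part of the spectrum which is not
discrete, by Weyl's criterion: `lam` belongs to it when there are unit vectors `f n` in the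
domain of `L` that tend weakly to `0` with `‖L (f n) - lam * f n‖ → 0`. -/
def continuousSpectrum (d : ℕ) (α : ℝ) : Set ℝ :=
  {lam | ∃ f h : ℕ → EuclideanSpace ℝ (Fin d) → ℝ,
    (∀ n, IsInGraph α (f n) (h n)) ∧
    (∀ n, ∫ x, f n x ^ 2 ∂(weightMeasure d (α - 1)) = 1) ∧
    (∀ φ : EuclideanSpace ℝ (Fin d) → ℝ, MemLp φ 2 (weightMeasure d (α - 1)) →
      Tendsto (fun n => ∫ x, f n x * φ x ∂(weightMeasure d (α - 1))) atTop (𝓝 0)) ∧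
    Tendsto (fun n => ∫ x, (h n x - lam * f n x) ^ 2 ∂(weightMeasure d (α - 1))) atTop (𝓝 0)}

end HardyPoincare

end

open HardyPoincare

open scoped ContDiff

noncomputable section

namespace HardyPoincare

/-! Write s = |x|². Both quadratic forms split along three sectors: radial functions p(s),
combinations ∑ xⱼ qⱼ(s), and functions whose integrals against every φ(s) and every xⱼ φ(s) vanish.
For smooth functions supported away from the origin a spectral gap is proved in each sector, and the
constant in the theorem is the smallest of the three.

The first two sectors are one-dimensional problems with weight s^(A-1) (1+s)^(B-1) in the norm and
s^A (1+s)^B in the energy. A function of weighted mean zero has the form D*w, where D* is the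
adjoint of D = d/ds. Passing from D*D to DD* gives the same problem with A and B raised by one, plus
the constant -(A+B). Each vanishing moment pays for one such step: two steps in the radial sector
(`radial_gap_two`), one in the linear sector (`radial_gap_one`). The chain ends with a Hardy
inequality for unrestricted functions, with constant γ² (`radialHardy_sq`) or with the trivial
constant 0.

The third sector needs no spherical harmonics. The weight (1+s)^(-b), with b = -α, is a mixture of
the Gaussians exp(-ts). For each of them a function orthogonal to constants and coordinates has gap
4t (`gauss_euclidean`), and averaging over t turns the factor t into Γ(b+1)/Γ(b) = b, which gives
the constant -4α (`gap_of_orthogonal_gaussians`). The Gaussian inequality comes from the same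
commutation trick on the line (`gauss_line`) and from tensorisation (`gauss_pi`).

To reach the whole form domain, one shows in the Hilbert space of pairs (function, gradient) that
whatever is orthogonal to test functions supported away from the origin is orthogonal to the form
domain (`IsFormElement.integral_eq_zero`); this uses that a point has zero capacity for d ≥ 2. The
moment conditions are restored by a finite-rank correction with values in the test functions.

Sharpness comes from three kinds of trial functions: xᵢxⱼ with i ≠ j, with eigenvalue -4α; a
quadratic polynomial in s, with eigenvalue -8α - 4(d+2); and slowly modulated powers s^κ escaping to
infinity, which put (d-2+2α)²/4 in the essential spectrum. Any valid constant lies below all of the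
essential spectrum (`le_of_mem_continuousSpectrum`), since weak convergence to zero makes the moment
conditions negligible. -/

/-- Smooth real functions with compact support inside `Ω`. -/
structure IsTest {E : Type*} [NormedAddCommGroup E] [NormedSpace ℝ E] (Ω : Set E) (f : E → ℝ) :
    Prop where
  contDiff : ContDiff ℝ ∞ f
  hasCompactSupport : HasCompactSupport f
  tsupport_subset : tsupport f ⊆ Ω

/-! ### Calculus of test functions -/

namespace IsTest

section General

variable {E : Type*} [NormedAddCommGroup E] [NormedSpace ℝ E] {Ω : Set E} {f g : E → ℝ}

theorem continuous (hf : IsTest Ω f) : Continuous f := hf.contDiff.continuous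

theorem differentiable (hf : IsTest Ω f) : Differentiable ℝ f :=
  hf.contDiff.differentiable (by simp)

theorem eq_zero (hf : IsTest Ω f) {x : E} (hx : x ∉ Ω) : f x = 0 :=
  image_eq_zero_of_notMem_tsupport fun h => hx (hf.tsupport_subset h)

theorem mono {Ω' : Set E} (hf : IsTest Ω f) (h : Ω ⊆ Ω') : IsTest Ω' f :=
  ⟨hf.contDiff, hf.hasCompactSupport, hf.tsupport_subset.trans h⟩

theorem of_tsupport_subset {K : Set E} (hK : IsCompact K) (hKΩ : K ⊆ Ω)
    (hf : ContDiff ℝ ∞ f) (h : tsupport f ⊆ K) : IsTest Ω f :=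
  ⟨hf, hK.of_isClosed_subset (isClosed_tsupport f) h, h.trans hKΩ⟩

theorem smooth_mul (hf : IsTest Ω f) (hg : ∀ x ∈ Ω, ContDiffAt ℝ ∞ g x) :
    IsTest Ω fun x => g x * f x := by
  have hs : tsupport (fun x => g x * f x) ⊆ tsupport f := tsupport_mul_subset_right
  refine ⟨contDiff_iff_contDiffAt.2 fun x => ?_, hf.hasCompactSupport.mul_left,
    hs.trans hf.tsupport_subset⟩
  by_cases hx : x ∈ tsupport f
  · exact (hg x (hf.tsupport_subset hx)).mul hf.contDiff.contDiffAt
  · have : (fun x => g x * f x) =ᶠ[𝓝 x] fun _ => 0 := by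
      filter_upwards [notMem_tsupport_iff_eventuallyEq.1 hx] with y hy
      simp [hy]
    exact contDiffAt_const.congr_of_eventuallyEq this

theorem mul (hf : IsTest Ω f) (hg : IsTest Ω g) : IsTest Ω fun x => f x * g x :=
  hg.smooth_mul fun _ _ => hf.contDiff.contDiffAt

theorem sq (hf : IsTest Ω f) : IsTest Ω fun x => f x ^ 2 := by
  simpa only [pow_two] using hf.mul hf

theorem const_mul (hf : IsTest Ω f) (c : ℝ) : IsTest Ω fun x => c * f x :=
  hf.smooth_mul fun _ _ => contDiffAt_const

theorem add (hf : IsTest Ω f) (hg : IsTest Ω g) : IsTest Ω fun x => f x + g x :=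
  ⟨hf.contDiff.add hg.contDiff, hf.hasCompactSupport.add hg.hasCompactSupport,
    (tsupport_add f g).trans (union_subset hf.tsupport_subset hg.tsupport_subset)⟩

theorem neg (hf : IsTest Ω f) : IsTest Ω fun x => -f x := by
  simpa using hf.const_mul (-1)

theorem sub (hf : IsTest Ω f) (hg : IsTest Ω g) : IsTest Ω fun x => f x - g x := by
  simpa [sub_eq_add_neg] using hf.add hg.neg

theorem zero : IsTest Ω (fun _ : E => (0 : ℝ)) := by
  refine ⟨contDiff_const, HasCompactSupport.zero, ?_⟩
  have : (fun _ : E => (0 : ℝ)) = 0 := rfl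
  simp [this]

theorem sum {ι : Type*} (s : Finset ι) {F : ι → E → ℝ} (hF : ∀ i ∈ s, IsTest Ω (F i)) :
    IsTest Ω fun x => ∑ i ∈ s, F i x := by
  classical
  induction s using Finset.induction_on with
  | empty => simpa using zero
  | insert i s his ih =>
    simp only [Finset.sum_insert his]
    exact (hF i (by simp)).add (ih fun j hj => hF j (by simp [hj]))

theorem fderiv_apply (hf : IsTest Ω f) (v : E) : IsTest Ω fun x => fderiv ℝ f x v :=
  ⟨(hf.contDiff.fderiv_right (m := ∞) (by simp)).clm_apply contDiff_const,
    hf.hasCompactSupport.fderiv_apply ℝ v,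
    (tsupport_fderiv_apply_subset ℝ v).trans hf.tsupport_subset⟩

theorem integrable [MeasurableSpace E] [BorelSpace E] {μ : Measure E}
    [IsFiniteMeasureOnCompacts μ] (hf : IsTest Ω f) : Integrable f μ :=
  hf.continuous.integrable_of_hasCompactSupport hf.hasCompactSupport

end General

section Line

variable {Ω : Set ℝ} {f : ℝ → ℝ}

theorem deriv (hf : IsTest Ω f) : IsTest Ω (deriv f) := by
  simpa using hf.fderiv_apply 1

theorem hasDerivAt (hf : IsTest Ω f) (x : ℝ) : HasDerivAt f (_root_.deriv f x) x :=
  (hf.differentiable x).hasDerivAt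

/-- The form in which integration by parts is used below: f is a product containing real powers, so
a formula for its derivative is available only on `Ω`, and outside both sides vanish. -/
theorem integral_eq_zero_of_hasDerivAt {f' : ℝ → ℝ} (hf : IsTest Ω f)
    (h : ∀ x ∈ Ω, HasDerivAt f (f' x) x) (h0 : ∀ x ∉ Ω, f' x = 0) : ∫ x, f' x = 0 := by
  have hd : f' = _root_.deriv f := by
    ext x
    by_cases hx : x ∈ Ω
    · exact (h x hx).deriv.symm
    · rw [h0 x hx, hf.deriv.eq_zero hx]
  rw [hd]
  exact integral_eq_zero_of_hasDerivAt_of_integrable hf.hasDerivAt hf.deriv.integrable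
    hf.integrable

theorem exists_subset_Icc (hf : IsTest (Ioi 0) f) :
    ∃ a b, 0 < a ∧ a < b ∧ ∀ x, x ∉ Icc a b → f x = 0 := by
  obtain ⟨b, hb⟩ := hf.hasCompactSupport.isCompact.bddAbove
  have : ∃ a > 0, ∀ x ∈ tsupport f, a ≤ x := by
    by_cases hne : (tsupport f).Nonempty
    · obtain ⟨a, ha, hmin⟩ := hf.hasCompactSupport.isCompact.exists_isLeast hne
      exact ⟨a, hf.tsupport_subset ha, fun x hx => hmin hx⟩
    · exact ⟨1, one_pos, fun x hx => (hne ⟨x, hx⟩).elim⟩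
  obtain ⟨a, ha, hmin⟩ := this
  refine ⟨a, max b (a + 1), ha, by simp, fun x hx => image_eq_zero_of_notMem_tsupport fun h => ?_⟩
  exact hx ⟨hmin x h, (hb h).trans (le_max_left _ _)⟩

/-- A test function on an interval with integral zero is the derivative of a test function. -/
theorem exists_primitive_of_Icc {a b : ℝ} (hf : IsTest Ω f) (hab : a < b) (hΩ : Icc a b ⊆ Ω)
    (hz : ∀ x, x ∉ Icc a b → f x = 0) (h0 : ∫ x, f x = 0) :
    ∃ F, IsTest Ω F ∧ ∀ x, HasDerivAt F (f x) x := by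
  have hder : ∀ x, HasDerivAt (fun y => ∫ t in a..y, f t) (f x) x := fun x =>
    intervalIntegral.integral_hasDerivAt_right (hf.continuous.intervalIntegrable _ _)
      (hf.continuous.stronglyMeasurableAtFilter _ _) hf.continuous.continuousAt
  refine ⟨fun y => ∫ t in a..y, f t, ?_, hder⟩
  have hsm : ContDiff ℝ ∞ fun y => ∫ t in a..y, f t := by
    rw [contDiff_infty_iff_deriv]
    refine ⟨fun x => (hder x).differentiableAt, ?_⟩
    rw [show _root_.deriv (fun y => ∫ t in a..y, f t) = f from funext fun x => (hder x).deriv]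
    exact hf.contDiff
  refine of_tsupport_subset (K := Icc a b) isCompact_Icc hΩ hsm
    (closure_minimal ?_ isClosed_Icc)
  intro y hy
  by_contra hyK
  apply hy
  have hlt : y < a ∨ b < y := by
    by_contra! hcon
    exact hyK ⟨hcon.1, hcon.2⟩
  rcases hlt with hlt | hlt
  · change ∫ t in a..y, f t = 0
    rw [intervalIntegral.integral_symm, intervalIntegral.integral_of_le hlt.le, neg_eq_zero,
      integral_Ioc_eq_integral_Ioo]
    exact setIntegral_eq_zero_of_forall_eq_zero fun x hx => hz x fun h => by
      linarith [h.1, hx.2]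
  · change ∫ t in a..y, f t = 0
    rw [intervalIntegral.integral_of_le (hab.trans hlt).le, ← h0, ← integral_Icc_eq_integral_Ioc]
    exact setIntegral_eq_integral_of_forall_compl_eq_zero fun x hx => hz x fun h =>
      hx ⟨h.1, h.2.trans hlt.le⟩

theorem exists_primitive (hf : IsTest (Ioi 0) f) (h0 : ∫ x, f x = 0) :
    ∃ F, IsTest (Ioi 0) F ∧ ∀ x, HasDerivAt F (f x) x := by
  obtain ⟨a, b, ha, hab, hz⟩ := hf.exists_subset_Icc
  exact hf.exists_primitive_of_Icc hab (fun x hx => lt_of_lt_of_le ha hx.1) hz h0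

theorem exists_primitive_univ (hf : IsTest univ f) (h0 : ∫ x, f x = 0) :
    ∃ F, IsTest univ F ∧ ∀ x, HasDerivAt F (f x) x := by
  obtain ⟨r, hr⟩ := hf.hasCompactSupport.isCompact.isBounded.subset_closedBall 0
  rw [Real.closedBall_eq_Icc] at hr
  refine hf.exists_primitive_of_Icc (a := 0 - max r 1) (b := 0 + max r 1) ?_ (subset_univ _)
    (fun x hx => image_eq_zero_of_notMem_tsupport fun h => ?_) h0
  · linarith [le_max_right r 1]
  · exact hx ⟨by linarith [(hr h).1, le_max_left r 1], by linarith [(hr h).2, le_max_left r 1]⟩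

end Line

end IsTest

theorem integral_linear_three {X : Type*} [MeasurableSpace X] {μ : Measure X} {f g h : X → ℝ}
    (hf : Integrable f μ) (hg : Integrable g μ) (hh : Integrable h μ) (a b c : ℝ) :
    ∫ x, (a * f x + b * g x + c * h x) ∂μ =
      a * ∫ x, f x ∂μ + b * ∫ x, g x ∂μ + c * ∫ x, h x ∂μ := by
  rw [integral_add _ (hh.const_mul c), integral_add (hf.const_mul a) (hg.const_mul b),
    integral_const_mul, integral_const_mul, integral_const_mul]
  exact (hf.const_mul a).add (hg.const_mul b)

/-! ### Hardy inequalities and commutation on the half-line -/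

/-- The weight `s ^ A * (1 + s) ^ B` on the half-line. -/
def radialWeight (A B s : ℝ) : ℝ := s ^ A * (1 + s) ^ B

theorem contDiffAt_radialWeight (A B : ℝ) {s : ℝ} (hs : s ∈ Ioi (0 : ℝ)) :
    ContDiffAt ℝ ∞ (radialWeight A B) s := by
  have hs' : (0 : ℝ) < s := hs
  exact (contDiffAt_id.rpow_const_of_ne hs'.ne').mul
    ((contDiffAt_const.add contDiffAt_id).rpow_const_of_ne (by change (1 : ℝ) + s ≠ 0; positivity))

theorem radialWeight_nonneg (A B : ℝ) {s : ℝ} (hs : 0 < s) : 0 ≤ radialWeight A B s := by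
  unfold radialWeight; positivity

theorem radialWeight_mul_self {A B s : ℝ} (hs : 0 < s) :
    radialWeight (A - 1) (B - 1) s * s = radialWeight A (B - 1) s := by
  simp only [radialWeight]
  rw [Real.rpow_sub_one hs.ne']
  field_simp

theorem radialWeight_eq_mul {A B s : ℝ} (hs : 0 < s) :
    radialWeight A B s = radialWeight (A - 1) (B - 1) s * (s * (1 + s)) := by
  simp only [radialWeight]
  rw [Real.rpow_sub_one hs.ne', Real.rpow_sub_one (by positivity : (1 + s) ≠ 0)]
  field_simp

theorem hasDerivAt_radialWeight (A B : ℝ) {s : ℝ} (hs : 0 < s) :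
    HasDerivAt (radialWeight A B)
      (radialWeight (A - 1) (B - 1) s * (A + (A + B) * s)) s := by
  have h1 : HasDerivAt (fun x : ℝ => x ^ A) (A * s ^ (A - 1)) s :=
    Real.hasDerivAt_rpow_const (Or.inl hs.ne')
  have h2 : HasDerivAt (fun x : ℝ => (1 + x) ^ B) (1 * B * (1 + s) ^ (B - 1)) s :=
    ((hasDerivAt_id s).const_add 1).rpow_const
      (Or.inl (by change (1 : ℝ) + s ≠ 0; positivity))
  refine (h1.fun_mul h2).congr_deriv ?_
  simp only [radialWeight]
  rw [Real.rpow_sub_one hs.ne', Real.rpow_sub_one (by positivity : (1 + s) ≠ 0)]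
  field_simp
  ring

theorem IsTest.radialWeight_mul {f : ℝ → ℝ} (hf : IsTest (Ioi 0) f) (A B : ℝ) :
    IsTest (Ioi 0) fun s => radialWeight A B s * f s :=
  hf.smooth_mul fun _ hs => contDiffAt_radialWeight A B hs

/-- The weighted Hardy inequality on the half-line with constant `δ`. -/
def RadialHardy (A B δ : ℝ) : Prop :=
  ∀ v : ℝ → ℝ, IsTest (Ioi 0) v →
    δ * ∫ s, radialWeight (A - 1) (B - 1) s * v s ^ 2 ≤
      ∫ s, radialWeight A B s * deriv v s ^ 2

theorem IsTest.integral_radialWeight_sq_nonneg {v : ℝ → ℝ} (hv : IsTest (Ioi 0) v) (A B : ℝ) :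
    0 ≤ ∫ s, radialWeight A B s * v s ^ 2 := by
  refine integral_nonneg fun s => ?_
  by_cases hs : s ∈ Ioi (0 : ℝ)
  · exact mul_nonneg (radialWeight_nonneg A B hs) (sq_nonneg _)
  · simp [hv.eq_zero hs]

theorem radialHardy_zero (A B : ℝ) : RadialHardy A B 0 := fun v hv => by
  rw [zero_mul]
  exact hv.deriv.integral_radialWeight_sq_nonneg A B

/-- Completing the square. Adding γ times the derivative of s^A (1+s)^(B-1) v², whose integral is
zero, turns the difference of the two sides into the integral of s ((1+s) v' + γ v)² + γ (A-γ) v²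
against a positive weight. This γ is the exponent for which s^(-γ) just fails to be square
integrable at infinity. -/
theorem radialHardy_sq {A B γ : ℝ} (h0 : 0 ≤ γ) (hγ : 2 * γ = A + B - 1) (hA : γ ≤ A) :
    RadialHardy A B (γ ^ 2) := by
  intro v hv
  have hI1 := (hv.sq.radialWeight_mul (A - 1) (B - 1)).integrable (μ := volume)
  have hI2 := (hv.deriv.sq.radialWeight_mul A B).integrable (μ := volume)
  have hT : IsTest (Ioi 0) fun s => radialWeight A (B - 1) s * v s ^ 2 :=
    hv.sq.radialWeight_mul _ _
  have hz : ∫ s, (radialWeight A (B - 1) s * (2 * v s * deriv v s) +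
      radialWeight (A - 1) (B - 1 - 1) s * (A + (A + (B - 1)) * s) * v s ^ 2) = 0 := by
    refine hT.integral_eq_zero_of_hasDerivAt (fun s hs => ?_) fun s hs => ?_
    · refine ((hasDerivAt_radialWeight A (B - 1) hs).fun_mul
        ((hv.hasDerivAt s).fun_pow 2)).congr_deriv ?_
      push_cast
      ring
    · simp [hv.eq_zero hs]
  have hI3 : Integrable fun s => (radialWeight A (B - 1) s * (2 * v s * deriv v s) +
      radialWeight (A - 1) (B - 1 - 1) s * (A + (A + (B - 1)) * s) * v s ^ 2) := by
    refine IsTest.integrable (Ω := Ioi 0) (IsTest.add ?_ ?_)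
    · exact ((hv.const_mul 2).mul hv.deriv).radialWeight_mul _ _
    · exact hv.sq.smooth_mul fun s hs => (contDiffAt_radialWeight _ _ hs).mul (by fun_prop)
  have key : 0 ≤ ∫ s, ((radialWeight A B s * deriv v s ^ 2 -
      γ ^ 2 * (radialWeight (A - 1) (B - 1) s * v s ^ 2)) +
      γ * (radialWeight A (B - 1) s * (2 * v s * deriv v s) +
      radialWeight (A - 1) (B - 1 - 1) s * (A + (A + (B - 1)) * s) * v s ^ 2)) := by
    refine integral_nonneg fun s => ?_
    by_cases hs : s ∈ Ioi (0 : ℝ)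
    · have hs' : 0 < s := hs
      have e1 : radialWeight A B s = radialWeight (A - 1) (B - 1 - 1) s * (s * (1 + s) ^ 2) := by
        rw [radialWeight_eq_mul hs']
        simp only [radialWeight]
        rw [Real.rpow_sub_one (by positivity : (1 + s) ≠ 0) (B - 1)]
        field_simp
      have e2 : radialWeight (A - 1) (B - 1) s =
          radialWeight (A - 1) (B - 1 - 1) s * (1 + s) := by
        simp only [radialWeight]
        rw [Real.rpow_sub_one (by positivity : (1 + s) ≠ 0) (B - 1)]
        field_simp
      have e3 : radialWeight A (B - 1) s =
          radialWeight (A - 1) (B - 1 - 1) s * (s * (1 + s)) := radialWeight_eq_mul hs'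
      have hw := radialWeight_nonneg (A - 1) (B - 1 - 1) hs'
      have hB : B = 2 * γ + 1 - A := by linarith
      have : (radialWeight A B s * deriv v s ^ 2 -
          γ ^ 2 * (radialWeight (A - 1) (B - 1) s * v s ^ 2)) +
          γ * (radialWeight A (B - 1) s * (2 * v s * deriv v s) +
          radialWeight (A - 1) (B - 1 - 1) s * (A + (A + (B - 1)) * s) * v s ^ 2) =
          radialWeight (A - 1) (B - 1 - 1) s *
            (s * ((1 + s) * deriv v s + γ * v s) ^ 2 + γ * (A - γ) * v s ^ 2) := by
        rw [e1, e2, e3]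
        generalize radialWeight (A - 1) (B - 1 - 1) s = w
        rw [hB]; ring
      simp only [Pi.zero_apply]
      rw [this]
      have : 0 ≤ γ * (A - γ) := mul_nonneg h0 (by linarith)
      positivity
    · simp [hv.eq_zero hs, hv.deriv.eq_zero hs]
  have hl := integral_linear_three hI2 hI1 hI3 1 (-γ ^ 2) γ
  rw [hz] at hl
  simp only [one_mul, neg_mul, ← sub_eq_add_neg] at hl
  linarith

/-- A test function of weighted mean zero is in the range of the adjoint of the derivative. -/
theorem IsTest.exists_adjoint {p : ℝ → ℝ} (hp : IsTest (Ioi 0) p) (A B : ℝ)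
    (h0 : ∫ s, radialWeight (A - 1) (B - 1) s * p s = 0) :
    ∃ w, IsTest (Ioi 0) w ∧
      (∀ s, p s = -(s * (1 + s) * _root_.deriv w s + (A + (A + B) * s) * w s)) := by
  -- The equation p = D*w says that (s^A (1+s)^B w)' = -s^(A-1) (1+s)^(B-1) p, so w is minus the
  -- primitive of the weighted p, divided by s^A (1+s)^B. The mean-zero condition is what makes this
  -- primitive compactly supported.
  obtain ⟨F, hF, hFd⟩ := (hp.radialWeight_mul (A - 1) (B - 1)).exists_primitive h0
  have hw : IsTest (Ioi 0) fun s => radialWeight (-A) (-B) s * (-F s) := hF.neg.radialWeight_mul _ _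
  refine ⟨_, hw, fun s => ?_⟩
  by_cases hs : s ∈ Ioi (0 : ℝ)
  · have hs' : 0 < s := hs
    have hd := (hasDerivAt_radialWeight (-A) (-B) hs').fun_mul (hFd s).fun_neg
    rw [show _root_.deriv (fun s => radialWeight (-A) (-B) s * (-F s)) s = _ from hd.deriv]
    have e1 : radialWeight (-A) (-B) s = radialWeight (-A - 1) (-B - 1) s * (s * (1 + s)) :=
      radialWeight_eq_mul hs'
    have e2 : radialWeight (-A - 1) (-B - 1) s * radialWeight (A - 1) (B - 1) s *
        (s * (1 + s)) ^ 2 = 1 := by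
      simp only [radialWeight]
      rw [Real.rpow_sub_one hs'.ne', Real.rpow_sub_one hs'.ne',
        Real.rpow_sub_one (by positivity : (1 + s) ≠ 0),
        Real.rpow_sub_one (by positivity : (1 + s) ≠ 0), Real.rpow_neg hs'.le,
        Real.rpow_neg (by positivity)]
      have h1 : s ^ A ≠ 0 := by positivity
      have h2 : (1 + s) ^ B ≠ 0 := by positivity
      field_simp
    rw [e1]
    linear_combination (-p s) * e2
  · rw [hp.eq_zero hs, hw.eq_zero hs, hw.deriv.eq_zero hs]
    ring

section Adjoint

variable {A B : ℝ} {p w : ℝ → ℝ}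

/-- Pairing p = D*w with the function s, whose derivative is 1. The first moment of p thus becomes
the mean of w for the raised weight, which is the condition for a second step. -/
theorem integral_radialWeight_adjoint (hp : IsTest (Ioi 0) p) (hw : IsTest (Ioi 0) w)
    (h : ∀ s, p s = -(s * (1 + s) * _root_.deriv w s + (A + (A + B) * s) * w s)) :
    ∫ s, radialWeight A B s * w s = ∫ s, radialWeight (A - 1) (B - 1) s * (s * p s) := by
  have hI1 := (hw.radialWeight_mul A B).integrable (μ := volume)
  have hsp : IsTest (Ioi 0) fun s => s * p s := hp.smooth_mul fun _ _ => contDiffAt_id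
  have hI2 := (hsp.radialWeight_mul (A - 1) (B - 1)).integrable (μ := volume)
  have hT : IsTest (Ioi 0) fun s => s * (radialWeight A B s * w s) :=
    (hw.radialWeight_mul A B).smooth_mul fun _ _ => contDiffAt_id
  rw [← sub_eq_zero, ← integral_sub hI1 hI2]
  refine hT.integral_eq_zero_of_hasDerivAt (fun s hs => ?_) fun s hs => ?_
  · refine ((hasDerivAt_id' s).fun_mul
      ((hasDerivAt_radialWeight A B hs).fun_mul (hw.hasDerivAt s))).congr_deriv ?_
    rw [h s, radialWeight_eq_mul hs]
    ring
  · simp [hp.eq_zero hs, hw.eq_zero hs]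

/-- The commutation identity. Squaring D*w and integrating the cross term by parts cancels the
square of the drift A + (A+B)s and leaves its derivative. The drift is affine, so what remains is
the constant A+B. -/
theorem integral_radialWeight_sq_adjoint (hp : IsTest (Ioi 0) p) (hw : IsTest (Ioi 0) w)
    (h : ∀ s, p s = -(s * (1 + s) * _root_.deriv w s + (A + (A + B) * s) * w s)) :
    ∫ s, radialWeight (A - 1) (B - 1) s * p s ^ 2 =
      (∫ s, radialWeight (A + 1) (B + 1) s * deriv w s ^ 2) -
        (A + B) * ∫ s, radialWeight A B s * w s ^ 2 := by
  have hI1 := (hp.sq.radialWeight_mul (A - 1) (B - 1)).integrable (μ := volume)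
  have hI2 := (hw.deriv.sq.radialWeight_mul (A + 1) (B + 1)).integrable (μ := volume)
  have hI3 := (hw.sq.radialWeight_mul A B).integrable (μ := volume)
  have hT : IsTest (Ioi 0) fun s => radialWeight A B s * ((A + (A + B) * s) * w s ^ 2) :=
    (hw.sq.smooth_mul fun _ _ => by fun_prop).radialWeight_mul A B
  have hl := integral_linear_three hI1 hI2 hI3 1 (-1) (A + B)
  suffices hz : ∫ s, (1 * (radialWeight (A - 1) (B - 1) s * p s ^ 2) +
      -1 * (radialWeight (A + 1) (B + 1) s * deriv w s ^ 2) +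
      (A + B) * (radialWeight A B s * w s ^ 2)) = 0 by
    rw [hz] at hl
    linarith
  refine hT.integral_eq_zero_of_hasDerivAt (fun s hs => ?_) fun s hs => ?_
  · have hl : HasDerivAt (fun s : ℝ => A + (A + B) * s) (A + B) s := by
      simpa using ((hasDerivAt_id s).const_mul (A + B)).const_add A
    refine ((hasDerivAt_radialWeight A B hs).fun_mul
      (hl.fun_mul ((hw.hasDerivAt s).fun_pow 2))).congr_deriv ?_
    have e : radialWeight (A + 1) (B + 1) s =
        radialWeight (A - 1) (B - 1) s * (s * (1 + s)) ^ 2 := by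
      rw [radialWeight_eq_mul hs, add_sub_cancel_right, add_sub_cancel_right,
        radialWeight_eq_mul hs]
      ring
    rw [h s, e, radialWeight_eq_mul (A := A) (B := B) hs]
    push_cast
    ring
  · simp [hp.eq_zero hs, hw.eq_zero hs, hw.deriv.eq_zero hs]

/-- The adjoint relation ⟨D*w, p⟩ = ⟨w, p'⟩, read with p = D*w. -/
theorem integral_radialWeight_sq_adjoint_eq (hp : IsTest (Ioi 0) p) (hw : IsTest (Ioi 0) w)
    (h : ∀ s, p s = -(s * (1 + s) * _root_.deriv w s + (A + (A + B) * s) * w s)) :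
    ∫ s, radialWeight (A - 1) (B - 1) s * p s ^ 2 =
      ∫ s, radialWeight A B s * (w s * deriv p s) := by
  have hI1 := (hp.sq.radialWeight_mul (A - 1) (B - 1)).integrable (μ := volume)
  have hI2 := ((hw.mul hp.deriv).radialWeight_mul A B).integrable (μ := volume)
  have hT : IsTest (Ioi 0) fun s => radialWeight A B s * (-w s * p s) :=
    (hw.neg.mul hp).radialWeight_mul A B
  rw [← sub_eq_zero, ← integral_sub hI1 hI2]
  refine hT.integral_eq_zero_of_hasDerivAt (fun s hs => ?_) fun s hs => ?_
  · refine ((hasDerivAt_radialWeight A B hs).fun_mul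
      ((hw.hasDerivAt s).fun_neg.fun_mul (hp.hasDerivAt s))).congr_deriv ?_
    rw [radialWeight_eq_mul (A := A) (B := B) hs]
    linear_combination -(radialWeight (A - 1) (B - 1) s * p s) * (h s)
  · simp [hp.eq_zero hs, hw.eq_zero hs]

/-- The gap of the form on the range of the adjoint, by duality. -/
theorem radial_gap_of_adjoint {δ : ℝ} (hp : IsTest (Ioi 0) p) (hw : IsTest (Ioi 0) w)
    (h : ∀ s, p s = -(s * (1 + s) * _root_.deriv w s + (A + (A + B) * s) * w s))
    (hδ : δ * ∫ s, radialWeight A B s * w s ^ 2 ≤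
      ∫ s, radialWeight (A + 1) (B + 1) s * deriv w s ^ 2) (hpos : 0 ≤ δ - (A + B)) :
    (δ - (A + B)) * ∫ s, radialWeight (A - 1) (B - 1) s * p s ^ 2 ≤
      ∫ s, radialWeight A B s * deriv p s ^ 2 := by
  have h1 := integral_radialWeight_sq_adjoint hp hw h
  have h2 := integral_radialWeight_sq_adjoint_eq hp hw h
  have hI2 := ((hw.mul hp.deriv).radialWeight_mul A B).integrable (μ := volume)
  have hI3 := (hw.sq.radialWeight_mul A B).integrable (μ := volume)
  have hI4 := (hp.deriv.sq.radialWeight_mul A B).integrable (μ := volume)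
  set l := δ - (A + B) with hl
  -- Duality: 0 ≤ ‖p' - l w‖² = ‖p'‖² - 2l‖p‖² + l²‖w‖², while the commutation identity and the
  -- hypothesis on w give l‖w‖² ≤ ‖p‖². Together they yield ‖p'‖² ≥ l‖p‖².
  have hsq := (hp.deriv.sub (hw.const_mul l)).integral_radialWeight_sq_nonneg A B
  have he : ∫ s, radialWeight A B s * (deriv p s - l * w s) ^ 2 =
      (∫ s, radialWeight A B s * deriv p s ^ 2) -
        2 * l * (∫ s, radialWeight A B s * (w s * deriv p s)) +
        l ^ 2 * ∫ s, radialWeight A B s * w s ^ 2 := by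
    have hl := integral_linear_three hI4 hI2 hI3 1 (-(2 * l)) (l ^ 2)
    rw [show (∫ s, radialWeight A B s * (deriv p s - l * w s) ^ 2) = _ from
      integral_congr_ae (Eventually.of_forall fun s => by ring) |>.trans hl]
    ring
  rw [he, ← h2] at hsq
  have h3 : l * ∫ s, radialWeight A B s * w s ^ 2 ≤
      ∫ s, radialWeight (A - 1) (B - 1) s * p s ^ 2 := by rw [h1, hl]; linarith
  nlinarith [mul_le_mul_of_nonneg_left h3 hpos]

end Adjoint

/-- One commutation step uses up the mean-zero condition. The function w so obtained is
unrestricted, and the Hardy inequality for the raised weights applies to it. -/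
theorem radial_gap_one {A B δ : ℝ} (hH : RadialHardy (A + 1) (B + 1) δ) (hpos : 0 ≤ δ - (A + B))
    {p : ℝ → ℝ} (hp : IsTest (Ioi 0) p)
    (h0 : ∫ s, radialWeight (A - 1) (B - 1) s * p s = 0) :
    (δ - (A + B)) * ∫ s, radialWeight (A - 1) (B - 1) s * p s ^ 2 ≤
      ∫ s, radialWeight A B s * deriv p s ^ 2 := by
  obtain ⟨w, hw, h⟩ := hp.exists_adjoint A B h0
  refine radial_gap_of_adjoint hp hw h ?_ hpos
  simpa using hH w hw

/-- Two steps: the second moment condition says that w again has mean zero, so `radial_gap_one`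
applies to w. The two shifts -(A+B+2) and -(A+B) add up. -/
theorem radial_gap_two {A B δ : ℝ} (hH : RadialHardy (A + 2) (B + 2) δ)
    (hpos : 0 ≤ δ - (A + B + 2)) (hpos' : 0 ≤ δ - 2 * (A + B + 1))
    {p : ℝ → ℝ} (hp : IsTest (Ioi 0) p)
    (h0 : ∫ s, radialWeight (A - 1) (B - 1) s * p s = 0)
    (h1 : ∫ s, radialWeight (A - 1) (B - 1) s * (s * p s) = 0) :
    (δ - 2 * (A + B + 1)) * ∫ s, radialWeight (A - 1) (B - 1) s * p s ^ 2 ≤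
      ∫ s, radialWeight A B s * deriv p s ^ 2 := by
  obtain ⟨w, hw, h⟩ := hp.exists_adjoint A B h0
  have hw0 : ∫ s, radialWeight (A + 1 - 1) (B + 1 - 1) s * w s = 0 := by
    simpa [h1] using integral_radialWeight_adjoint hp hw h
  have hgap := radial_gap_one (A := A + 1) (B := B + 1) (δ := δ)
    (by simpa [add_assoc, one_add_one_eq_two] using hH) (by linarith) hw hw0
  simp only [add_sub_cancel_right] at hgap
  have := radial_gap_of_adjoint hp hw h hgap (by linarith)
  convert this using 2
  ring

/-! ### The second Gaussian Poincaré inequality on the line -/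

section GaussianLine

/-- The unnormalised centred Gaussian density of variance `v`. -/
def gaussWeight (v x : ℝ) : ℝ := Real.exp (-x ^ 2 / (2 * v))

theorem gaussWeight_pos (v x : ℝ) : 0 < gaussWeight v x := Real.exp_pos _

theorem contDiff_gaussWeight (v : ℝ) : ContDiff ℝ ∞ (gaussWeight v) := by
  unfold gaussWeight; fun_prop

theorem hasDerivAt_gaussWeight {v : ℝ} (hv : v ≠ 0) (x : ℝ) :
    HasDerivAt (gaussWeight v) (-(x / v) * gaussWeight v x) x := by
  have h1 : HasDerivAt (fun x : ℝ => -x ^ 2 / (2 * v)) (-(x / v)) x := by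
    refine (((hasDerivAt_pow 2 x).fun_neg).div_const (2 * v)).congr_deriv ?_
    field_simp
    ring
  exact h1.exp.congr_deriv (by simp only [gaussWeight]; ring)

variable {v : ℝ} {p w : ℝ → ℝ}

theorem IsTest.gaussWeight_mul {f : ℝ → ℝ} (hf : IsTest univ f) (v : ℝ) :
    IsTest univ fun x => gaussWeight v x * f x :=
  hf.smooth_mul fun _ _ => (contDiff_gaussWeight v).contDiffAt

/-- The half-line scheme again. For the Gaussian of variance v the adjoint of d/dx is w ↦ xw/v - w',
and commuting the two operators adds v⁻¹ without changing the weight. -/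
theorem IsTest.exists_gauss_adjoint (hv : v ≠ 0) (hp : IsTest univ p)
    (h0 : ∫ x, gaussWeight v x * p x = 0) :
    ∃ w, IsTest univ w ∧ ∀ x, p x = x / v * w x - _root_.deriv w x := by
  obtain ⟨F, hF, hFd⟩ := (hp.gaussWeight_mul v).exists_primitive_univ h0
  have hc : ContDiff ℝ ∞ fun x => (gaussWeight v x)⁻¹ :=
    (contDiff_gaussWeight v).inv fun x => (gaussWeight_pos v x).ne'
  have hw : IsTest univ fun x => (gaussWeight v x)⁻¹ * -F x :=
    hF.neg.smooth_mul fun _ _ => hc.contDiffAt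
  refine ⟨_, hw, fun x => ?_⟩
  have hd := ((hasDerivAt_gaussWeight hv x).inv (gaussWeight_pos v x).ne').fun_mul (hFd x).fun_neg
  rw [show _root_.deriv (fun x => (gaussWeight v x)⁻¹ * -F x) x = _ from hd.deriv]
  have := (gaussWeight_pos v x).ne'
  simp only [Pi.inv_apply]
  field_simp
  ring

theorem integral_gauss_adjoint (hv : v ≠ 0) (hp : IsTest univ p) (hw : IsTest univ w)
    (h : ∀ x, p x = x / v * w x - deriv w x) :
    ∫ x, gaussWeight v x * w x = ∫ x, gaussWeight v x * (x * p x) := by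
  have hxp : IsTest univ fun x => x * p x := hp.smooth_mul fun _ _ => contDiffAt_id
  rw [← sub_eq_zero, ← integral_sub (hw.gaussWeight_mul v).integrable
    (hxp.gaussWeight_mul v).integrable]
  have hT : IsTest univ fun x => x * (gaussWeight v x * w x) :=
    (hw.gaussWeight_mul v).smooth_mul fun _ _ => contDiffAt_id
  refine hT.integral_eq_zero_of_hasDerivAt (fun x _ => ?_) fun x hx => (hx (mem_univ x)).elim
  refine ((hasDerivAt_id' x).fun_mul
    ((hasDerivAt_gaussWeight hv x).fun_mul (hw.hasDerivAt x))).congr_deriv ?_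
  rw [h x]; ring

theorem integral_gauss_sq_adjoint (hv : v ≠ 0) (hp : IsTest univ p) (hw : IsTest univ w)
    (h : ∀ x, p x = x / v * w x - deriv w x) :
    ∫ x, gaussWeight v x * p x ^ 2 =
      (∫ x, gaussWeight v x * deriv w x ^ 2) + v⁻¹ * ∫ x, gaussWeight v x * w x ^ 2 := by
  have hT : IsTest univ fun x => -gaussWeight v x * (x / v * w x ^ 2) := by
    simpa using ((hw.sq.smooth_mul (g := fun x => x / v) fun _ _ => by fun_prop).gaussWeight_mul
      v).neg
  have hl := integral_linear_three (hp.sq.gaussWeight_mul v).integrable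
    (hw.deriv.sq.gaussWeight_mul v).integrable (hw.sq.gaussWeight_mul v).integrable
    1 (-1) (-v⁻¹) (μ := volume)
  suffices hz : ∫ x, (1 * (gaussWeight v x * p x ^ 2) + -1 * (gaussWeight v x * deriv w x ^ 2) +
      -v⁻¹ * (gaussWeight v x * w x ^ 2)) = 0 by
    rw [hz] at hl
    linarith
  refine hT.integral_eq_zero_of_hasDerivAt (fun x _ => ?_) fun x hx => (hx (mem_univ x)).elim
  refine ((hasDerivAt_gaussWeight hv x).fun_neg.fun_mul
    (((hasDerivAt_id' x).div_const v).fun_mul ((hw.hasDerivAt x).fun_pow 2))).congr_deriv ?_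
  rw [h x]; push_cast; field_simp; ring

theorem integral_gauss_sq_adjoint_eq (hv : v ≠ 0) (hp : IsTest univ p) (hw : IsTest univ w)
    (h : ∀ x, p x = x / v * w x - deriv w x) :
    ∫ x, gaussWeight v x * p x ^ 2 = ∫ x, gaussWeight v x * (w x * deriv p x) := by
  rw [← sub_eq_zero, ← integral_sub (hp.sq.gaussWeight_mul v).integrable
    ((hw.mul hp.deriv).gaussWeight_mul v).integrable]
  have hT : IsTest univ fun x => gaussWeight v x * (-w x * p x) :=
    (hw.neg.mul hp).gaussWeight_mul v
  refine hT.integral_eq_zero_of_hasDerivAt (fun x _ => ?_) fun x hx => (hx (mem_univ x)).elim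
  refine ((hasDerivAt_gaussWeight hv x).fun_mul
    ((hw.hasDerivAt x).fun_neg.fun_mul (hp.hasDerivAt x))).congr_deriv ?_
  linear_combination -(gaussWeight v x * p x) * h x

theorem gauss_gap_of_adjoint {δ : ℝ} (hv : 0 < v) (hp : IsTest univ p) (hw : IsTest univ w)
    (h : ∀ x, p x = x / v * w x - deriv w x) (hδ0 : 0 ≤ δ)
    (hδ : δ * ∫ x, gaussWeight v x * w x ^ 2 ≤ ∫ x, gaussWeight v x * deriv w x ^ 2) :
    (δ + v⁻¹) * ∫ x, gaussWeight v x * p x ^ 2 ≤ ∫ x, gaussWeight v x * deriv p x ^ 2 := by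
  have h1 := integral_gauss_sq_adjoint hv.ne' hp hw h
  have h2 := integral_gauss_sq_adjoint_eq hv.ne' hp hw h
  set l := δ + v⁻¹ with hl
  have hpos : 0 ≤ l := by positivity
  have hsq : 0 ≤ ∫ x, gaussWeight v x * (deriv p x - l * w x) ^ 2 :=
    integral_nonneg fun x => mul_nonneg (gaussWeight_pos v x).le (sq_nonneg _)
  have he : ∫ x, gaussWeight v x * (deriv p x - l * w x) ^ 2 =
      (∫ x, gaussWeight v x * deriv p x ^ 2) -
        2 * l * (∫ x, gaussWeight v x * (w x * deriv p x)) +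
        l ^ 2 * ∫ x, gaussWeight v x * w x ^ 2 := by
    have hl := integral_linear_three (hp.deriv.sq.gaussWeight_mul v).integrable
      ((hw.mul hp.deriv).gaussWeight_mul v).integrable (hw.sq.gaussWeight_mul v).integrable
      1 (-(2 * l)) (l ^ 2) (μ := volume)
    rw [show (∫ x, gaussWeight v x * (deriv p x - l * w x) ^ 2) = _ from
      integral_congr_ae (Eventually.of_forall fun s => by ring) |>.trans hl]
    ring
  rw [he, ← h2] at hsq
  have h3 : l * ∫ x, gaussWeight v x * w x ^ 2 ≤ ∫ x, gaussWeight v x * p x ^ 2 := by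
    rw [h1, hl]; linarith
  nlinarith [mul_le_mul_of_nonneg_left h3 hpos]

/-- Starting from the trivial bound ∫ w'² ≥ 0, two commutations add v⁻¹ each. This gives 2/v, the
second nonzero eigenvalue of the Ornstein–Uhlenbeck operator. -/
theorem gauss_gap_two (hv : 0 < v) (hp : IsTest univ p)
    (h0 : ∫ x, gaussWeight v x * p x = 0) (h1 : ∫ x, gaussWeight v x * (x * p x) = 0) :
    2 * ∫ x, gaussWeight v x * p x ^ 2 ≤ v * ∫ x, gaussWeight v x * deriv p x ^ 2 := by
  obtain ⟨w, hw, h⟩ := hp.exists_gauss_adjoint hv.ne' h0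
  obtain ⟨z, hz, hz'⟩ := hw.exists_gauss_adjoint hv.ne'
    ((integral_gauss_adjoint hv.ne' hp hw h).trans h1)
  have hg : v⁻¹ * ∫ x, gaussWeight v x * w x ^ 2 ≤ ∫ x, gaussWeight v x * deriv w x ^ 2 := by
    have := gauss_gap_of_adjoint (δ := 0) hv hw hz hz' le_rfl (by
      rw [zero_mul]
      exact integral_nonneg fun x => mul_nonneg (gaussWeight_pos v x).le (sq_nonneg _))
    simpa using this
  have := gauss_gap_of_adjoint hv hp hw h (by positivity) hg
  have h2 := mul_le_mul_of_nonneg_left this hv.le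
  rw [← mul_assoc, mul_add, mul_inv_cancel₀ hv.ne', one_add_one_eq_two] at h2
  exact h2

end GaussianLine

open ProbabilityTheory in
theorem exists_integral_gaussianReal_eq {v : NNReal} (hv : v ≠ 0) :
    ∃ c : ℝ, 0 < c ∧ ∀ g : ℝ → ℝ, ∫ x, g x ∂(gaussianReal 0 v) = c * ∫ x, gaussWeight v x * g x := by
  have hv' : (0 : ℝ) < v := by positivity
  refine ⟨(√(2 * Real.pi * v))⁻¹, by positivity, fun g => ?_⟩
  rw [integral_gaussianReal_eq_integral_smul hv, ← integral_const_mul]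
  congr 1
  ext x
  simp only [gaussianPDFReal, gaussWeight, sub_zero, smul_eq_mul]
  ring

/-- A fixed even smooth cutoff on the line, equal to one on `[-1, 1]`. -/
def lineBump : ContDiffBump (0 : ℝ) := ⟨1, 2, by norm_num, by norm_num⟩

/-- The rescaled cutoff, equal to one on `[-(n + 1), n + 1]`. -/
def lineCutoff (n : ℕ) (x : ℝ) : ℝ := lineBump (x / (n + 1))

theorem isTest_lineBump : IsTest univ (lineBump : ℝ → ℝ) :=
  ⟨lineBump.contDiff, lineBump.hasCompactSupport, subset_univ _⟩

theorem contDiff_lineCutoff (n : ℕ) : ContDiff ℝ ∞ (lineCutoff n) :=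
  lineBump.contDiff.comp (by fun_prop)

theorem isTest_lineCutoff (n : ℕ) : IsTest univ (lineCutoff n) := by
  refine ⟨contDiff_lineCutoff n, ?_, subset_univ _⟩
  have hne : ((n : ℝ) + 1) ≠ 0 := by positivity
  refine HasCompactSupport.of_support_subset_isCompact
    (isCompact_Icc (a := -(2 * ((n : ℝ) + 1))) (b := 2 * (n + 1))) fun x hx => ?_
  have h1 : x / (n + 1) ∈ Function.support (lineBump : ℝ → ℝ) := hx
  rw [lineBump.support_eq, Metric.mem_ball, dist_zero_right, Real.norm_eq_abs, abs_div,
    abs_of_pos (by positivity : (0 : ℝ) < (n : ℝ) + 1), div_lt_iff₀ (by positivity)] at h1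
  have h2 : |x| < 2 * ((n : ℝ) + 1) := h1
  exact ⟨by linarith [neg_abs_le x], by linarith [le_abs_self x]⟩

theorem lineCutoff_nonneg (n : ℕ) (x : ℝ) : 0 ≤ lineCutoff n x := lineBump.nonneg

theorem lineCutoff_le_one (n : ℕ) (x : ℝ) : lineCutoff n x ≤ 1 := lineBump.le_one

theorem abs_lineCutoff_le_one (n : ℕ) (x : ℝ) : |lineCutoff n x| ≤ 1 := by
  rw [abs_of_nonneg (lineCutoff_nonneg n x)]; exact lineCutoff_le_one n x

theorem lineCutoff_neg (n : ℕ) (x : ℝ) : lineCutoff n (-x) = lineCutoff n x := by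
  simp [lineCutoff, neg_div, lineBump.neg]

theorem eventually_lineCutoff_eq_one (x : ℝ) : ∀ᶠ n : ℕ in atTop, lineCutoff n =ᶠ[𝓝 x] 1 := by
  obtain ⟨N, hN⟩ := exists_nat_gt (|x|)
  filter_upwards [eventually_ge_atTop N] with n hn
  have hn' : |x| < (n : ℝ) + 1 := by
    have : (N : ℝ) ≤ n := by exact_mod_cast hn
    linarith
  have : ∀ᶠ y in 𝓝 x, |y| < (n : ℝ) + 1 := (continuous_abs.continuousAt).eventually_lt_const hn'
  filter_upwards [this] with y hy
  refine lineBump.one_of_mem_closedBall ?_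
  rw [Metric.mem_closedBall, dist_zero_right, Real.norm_eq_abs, abs_div,
    abs_of_pos (by positivity : (0 : ℝ) < (n : ℝ) + 1), div_le_iff₀ (by positivity)]
  change |y| ≤ 1 * _
  linarith

/-- The second bound is uniform because x d/dx is invariant under scaling. It is needed since the
truncated coordinate xχ has derivative χ + xχ'. -/
theorem exists_bound_deriv_lineCutoff :
    ∃ C, 0 ≤ C ∧ ∀ n x, |deriv (lineCutoff n) x| ≤ C ∧ |x * deriv (lineCutoff n) x| ≤ C := by
  have h1 : IsTest univ fun y : ℝ => y * deriv lineBump y :=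
    isTest_lineBump.deriv.smooth_mul fun _ _ => contDiffAt_id
  obtain ⟨C1, hC1⟩ := isTest_lineBump.deriv.hasCompactSupport.exists_bound_of_continuous
    isTest_lineBump.deriv.continuous
  obtain ⟨C2, hC2⟩ := h1.hasCompactSupport.exists_bound_of_continuous h1.continuous
  have hC0 : 0 ≤ C1 := (norm_nonneg _).trans (hC1 0)
  refine ⟨max C1 C2, hC0.trans (le_max_left _ _), fun n x => ?_⟩
  have hpos : (0 : ℝ) < (n : ℝ) + 1 := by positivity
  have hd : deriv (lineCutoff n) x = deriv lineBump (x / (n + 1)) / (n + 1) := by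
    have := (isTest_lineBump.hasDerivAt (x / (n + 1))).comp x
      ((hasDerivAt_id' x).div_const ((n : ℝ) + 1))
    rw [show deriv (lineCutoff n) x = _ from this.deriv]
    ring
  rw [hd]
  constructor
  · rw [abs_div, abs_of_pos hpos]
    refine (div_le_self (abs_nonneg _) (by linarith [n.cast_nonneg (α := ℝ)])).trans ?_
    exact (hC1 _).trans (le_max_left _ _)
  · rw [show x * (deriv lineBump (x / (n + 1)) / (n + 1)) =
      x / (n + 1) * deriv lineBump (x / (n + 1)) by ring]
    exact (hC2 _).trans (le_max_right _ _)

open ProbabilityTheory in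
-- Pythagoras: the functions 1 and x/√v are orthonormal for the Gaussian of variance v.
theorem integral_gauss_sub_proj {v : NNReal} (hv : v ≠ 0) {f : ℝ → ℝ} (hf : IsTest univ f) :
    ∫ x, (f x - (∫ y, f y ∂(gaussianReal 0 v)) -
      (∫ y, y * f y ∂(gaussianReal 0 v)) / v * x) ^ 2 ∂(gaussianReal 0 v) =
      (∫ x, f x ^ 2 ∂(gaussianReal 0 v)) - (∫ y, f y ∂(gaussianReal 0 v)) ^ 2 -
        (∫ y, y * f y ∂(gaussianReal 0 v)) ^ 2 / v := by
  have hv' : (0 : ℝ) < v := by positivity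
  set γ := gaussianReal 0 v with hγ
  set m := ∫ x, f x ∂γ with hm
  set b := ∫ x, x * f x ∂γ with hb
  have hid : MemLp (fun x : ℝ => x) 2 γ := memLp_id_gaussianReal' 2 (by norm_num)
  have hid1 : Integrable (fun x : ℝ => x) γ := hid.integrable (by norm_num)
  have hx2 : ∫ x, x ^ 2 ∂γ = v := by
    have := variance_fun_id_gaussianReal (μ := 0) (v := v)
    rw [variance_eq_integral (by fun_prop)] at this
    simpa [integral_id_gaussianReal] using this
  have hx1 : ∫ x, x ∂γ = 0 := integral_id_gaussianReal
  have hxf : IsTest univ fun x => x * f x := hf.smooth_mul fun _ _ => contDiffAt_id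
  have hl := integral_linear_three (hf.sq.integrable (μ := γ)) (hf.integrable (μ := γ))
    (hxf.integrable (μ := γ)) 1 (-2 * m) (-2 * (b / v))
  have hl2 := integral_linear_three hid.integrable_sq hid1
    (integrable_const (μ := γ) (1 : ℝ)) ((b / v) ^ 2) (2 * m * (b / v)) (m ^ 2)
  have hI1 : Integrable (fun x => 1 * f x ^ 2 + -2 * m * f x + -2 * (b / v) * (x * f x)) γ :=
    (((hf.sq.const_mul 1).add (hf.const_mul (-2 * m))).add
      (hxf.const_mul (-2 * (b / v)))).integrable
  have hI2 : Integrable (fun x => (b / v) ^ 2 * x ^ 2 + 2 * m * (b / v) * x + m ^ 2 * 1) γ :=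
    ((hid.integrable_sq.const_mul _).add (hid1.const_mul _)).add (integrable_const _)
  have hl3 := integral_add hI1 hI2
  rw [hl, hl2, hx2, hx1] at hl3
  rw [show (∫ x, (f x - m - b / v * x) ^ 2 ∂γ) = _ from
    integral_congr_ae (Eventually.of_forall fun s => by ring) |>.trans hl3]
  simp only [integral_const, probReal_univ, ← hm, ← hb]
  simp
  field_simp
  ring

open ProbabilityTheory in
theorem gauss_line_bessel {v : NNReal} (hv : v ≠ 0) {f : ℝ → ℝ} (hf : IsTest univ f) :
    (∫ x, f x ∂(gaussianReal 0 v)) ^ 2 + (v : ℝ)⁻¹ * (∫ x, x * f x ∂(gaussianReal 0 v)) ^ 2 ≤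
      ∫ x, f x ^ 2 ∂(gaussianReal 0 v) := by
  have h := integral_gauss_sub_proj hv hf
  have h0 : 0 ≤ ∫ x, (f x - (∫ y, f y ∂(gaussianReal 0 v)) -
      (∫ y, y * f y ∂(gaussianReal 0 v)) / v * x) ^ 2 ∂(gaussianReal 0 v) :=
    integral_nonneg fun x => sq_nonneg _
  rw [inv_mul_eq_div]
  linarith

open ProbabilityTheory in
/-- The second Gaussian Poincaré inequality on the line. -/
theorem gauss_line {v : NNReal} (hv : v ≠ 0) {f : ℝ → ℝ} (hf : IsTest univ f) :
    2 * ∫ x, f x ^ 2 ∂(gaussianReal 0 v) ≤ v * (∫ x, deriv f x ^ 2 ∂(gaussianReal 0 v)) +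
      2 * (∫ x, f x ∂(gaussianReal 0 v)) ^ 2 +
      (v : ℝ)⁻¹ * (∫ x, x * f x ∂(gaussianReal 0 v)) ^ 2 := by
  have hv' : (0 : ℝ) < v := by positivity
  set γ := gaussianReal 0 v with hγ
  set m := ∫ x, f x ∂γ with hm
  set b := ∫ x, x * f x ∂γ with hb
  obtain ⟨c, hc, hcγ⟩ := exists_integral_gaussianReal_eq hv
  have hid : MemLp (fun x : ℝ => x) 2 γ := memLp_id_gaussianReal' 2 (by norm_num)
  have hid1 : Integrable (fun x : ℝ => x) γ := hid.integrable (by norm_num)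
  have hx2 : ∫ x, x ^ 2 ∂γ = v := by
    have := variance_fun_id_gaussianReal (μ := 0) (v := v)
    rw [variance_eq_integral (by fun_prop)] at this
    simpa [integral_id_gaussianReal] using this
  have hx1 : ∫ x, x ∂γ = 0 := integral_id_gaussianReal
  -- moments of the cutoffs
  have hA : Tendsto (fun n => ∫ x, lineCutoff n x ∂γ) atTop (𝓝 1) := by
    have : Tendsto (fun n => ∫ x, lineCutoff n x ∂γ) atTop (𝓝 (∫ x, (1 : ℝ) ∂γ)) := by
      refine tendsto_integral_of_dominated_convergence (fun _ => 1)
        (fun n => (contDiff_lineCutoff n).continuous.aestronglyMeasurable) (integrable_const _)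
        (fun n => Eventually.of_forall fun x => abs_lineCutoff_le_one n x)
        (Eventually.of_forall fun x => ?_)
      exact tendsto_const_nhds.congr' ((eventually_lineCutoff_eq_one x).mono fun n hn =>
        hn.eq_of_nhds.symm)
    simpa using this
  have hB : Tendsto (fun n => ∫ x, x ^ 2 * lineCutoff n x ∂γ) atTop (𝓝 v) := by
    rw [← hx2]
    refine tendsto_integral_of_dominated_convergence (fun x => x ^ 2)
      (fun n => ((continuous_pow 2).mul
        (contDiff_lineCutoff n).continuous).aestronglyMeasurable) hid.integrable_sq
      (fun n => Eventually.of_forall fun x => ?_) (Eventually.of_forall fun x => ?_)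
    · rw [norm_mul, Real.norm_eq_abs, abs_of_nonneg (sq_nonneg x)]
      exact mul_le_of_le_one_right (sq_nonneg x) (abs_lineCutoff_le_one n x)
    · refine tendsto_const_nhds.congr' ((eventually_lineCutoff_eq_one x).mono fun n hn => ?_)
      simp [hn.eq_of_nhds]
  have hodd : ∀ n, ∫ x, x * lineCutoff n x ∂γ = 0 := fun n => by
    rw [hcγ]
    have h1 := integral_neg_eq_self (fun x => gaussWeight v x * (x * lineCutoff n x)) volume
    have h2 : (fun x => gaussWeight v (-x) * (-x * lineCutoff n (-x))) =
        fun x => -(gaussWeight v x * (x * lineCutoff n x)) := by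
      ext x; rw [lineCutoff_neg]; simp [gaussWeight]
    rw [h2, integral_neg] at h1
    rw [show (∫ x, gaussWeight v x * (x * lineCutoff n x)) = 0 by linarith, mul_zero]
  -- Subtracting the projections of f on 1 and x would destroy compact support, so multiples of χ
  -- and xχ are subtracted instead. The coefficients make both moments of g n vanish exactly; they
  -- decouple because xχ is odd.
  set α : ℕ → ℝ := fun n => m / ∫ x, lineCutoff n x ∂γ with hα
  set β : ℕ → ℝ := fun n => b / ∫ x, x ^ 2 * lineCutoff n x ∂γ with hβ
  have hαt : Tendsto α atTop (𝓝 m) := by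
    have := (tendsto_const_nhds (x := m)).div hA one_ne_zero
    rwa [div_one] at this
  have hβt : Tendsto β atTop (𝓝 (b / v)) := tendsto_const_nhds.div hB hv'.ne'
  set g : ℕ → ℝ → ℝ := fun n x => f x - α n * lineCutoff n x - β n * (x * lineCutoff n x) with hg
  have hxχ : ∀ n, IsTest univ fun x => x * lineCutoff n x := fun n =>
    (isTest_lineCutoff n).smooth_mul fun _ _ => contDiffAt_id
  have hgt : ∀ n, IsTest univ (g n) := fun n =>
    (hf.sub ((isTest_lineCutoff n).const_mul _)).sub ((hxχ n).const_mul _)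
  have hgd : ∀ n x, deriv (g n) x = deriv f x - α n * deriv (lineCutoff n) x -
      β n * (lineCutoff n x + x * deriv (lineCutoff n) x) := fun n x => by
    have h1 := (isTest_lineCutoff n).hasDerivAt x
    have := ((hf.hasDerivAt x).fun_sub (h1.const_mul (α n))).fun_sub
      (((hasDerivAt_id' x).fun_mul h1).const_mul (β n))
    rw [show deriv (g n) x = _ from this.deriv]
    ring
  have hxf : IsTest univ fun x => x * f x := hf.smooth_mul fun _ _ => contDiffAt_id
  have hineq : ∀ᶠ n in atTop, 2 * ∫ x, g n x ^ 2 ∂γ ≤ v * ∫ x, deriv (g n) x ^ 2 ∂γ := by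
    filter_upwards [hA.eventually_ne one_ne_zero, hB.eventually_ne hv'.ne'] with n hn1 hn2
    have h0 : ∫ x, g n x ∂γ = 0 := by
      have hl := integral_linear_three (hf.integrable (μ := γ))
        ((isTest_lineCutoff n).integrable (μ := γ)) ((hxχ n).integrable (μ := γ)) 1 (-α n) (-β n)
      have e : ∀ x, g n x = 1 * f x + -α n * lineCutoff n x + -β n * (x * lineCutoff n x) :=
        fun x => by simp only [hg]; ring
      simp only [e]
      rw [hl, hodd]
      simp only [hα]; field_simp; simp [hm]
    have h1 : ∫ x, x * g n x ∂γ = 0 := by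
      have e : ∀ x, x * g n x = 1 * (x * f x) + -α n * (x * lineCutoff n x) +
          -β n * (x ^ 2 * lineCutoff n x) := fun x => by simp only [hg]; ring
      have hx2χ : IsTest univ fun x => x ^ 2 * lineCutoff n x :=
        (isTest_lineCutoff n).smooth_mul fun _ _ => by fun_prop
      have hl := integral_linear_three (hxf.integrable (μ := γ))
        ((hxχ n).integrable (μ := γ)) (hx2χ.integrable (μ := γ)) 1 (-α n) (-β n)
      simp only [e]
      rw [hl, hodd]
      simp only [hβ]; field_simp; simp [hb]
    rw [hcγ] at h0 h1
    have h0' := (mul_eq_zero.1 h0).resolve_left hc.ne'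
    have h1' := (mul_eq_zero.1 h1).resolve_left hc.ne'
    have := mul_le_mul_of_nonneg_left (gauss_gap_two hv' (hgt n) h0' h1') hc.le
    rw [hcγ, hcγ]
    linarith
  obtain ⟨C, hC0, hC⟩ := exists_bound_deriv_lineCutoff
  have hαb : ∀ᶠ n in atTop, |α n| ≤ |m| + 1 :=
    (hαt.abs.eventually_lt_const (by linarith : |m| < |m| + 1)).mono fun n h => h.le
  have hβb : ∀ᶠ n in atTop, |β n| ≤ |b / v| + 1 :=
    (hβt.abs.eventually_lt_const (by linarith : |b / v| < |b / v| + 1)).mono fun n h => h.le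
  have hfm : ∀ {u : ℝ → ℝ}, IsTest univ u → MemLp u 2 γ := fun hu =>
    hu.continuous.memLp_of_hasCompactSupport hu.hasCompactSupport
  have hL : Tendsto (fun n => ∫ x, g n x ^ 2 ∂γ) atTop
      (𝓝 (∫ x, (f x - m - b / v * x) ^ 2 ∂γ)) := by
    have hbd : MemLp (fun x => |f x| + (|m| + 1) + (|b / v| + 1) * |x|) 2 γ :=
      ((hfm hf).abs.add (memLp_const _)).add (hid.abs.const_mul _)
    refine tendsto_integral_filter_of_dominated_convergence _
      (Eventually.of_forall fun n => (hgt n).sq.continuous.aestronglyMeasurable) ?_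
      hbd.integrable_sq (Eventually.of_forall fun x => ?_)
    · filter_upwards [hαb, hβb] with n h1 h2
      refine Eventually.of_forall fun x => ?_
      rw [norm_pow, Real.norm_eq_abs]
      refine pow_le_pow_left₀ (abs_nonneg _) ?_ 2
      refine (abs_sub _ _).trans (add_le_add ((abs_sub _ _).trans (add_le_add le_rfl ?_)) ?_)
      · rw [abs_mul]
        exact (mul_le_of_le_one_right (abs_nonneg _) (abs_lineCutoff_le_one n x)).trans h1
      · rw [abs_mul, abs_mul]
        exact mul_le_mul h2 (mul_le_of_le_one_right (abs_nonneg _) (abs_lineCutoff_le_one n x))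
          (by positivity) (by positivity)
    · have e1 : Tendsto (fun n => lineCutoff n x) atTop (𝓝 1) :=
        tendsto_const_nhds.congr' ((eventually_lineCutoff_eq_one x).mono fun n hn =>
          hn.eq_of_nhds.symm)
      have := ((tendsto_const_nhds (x := f x)).sub (hαt.mul e1)).sub (hβt.mul (e1.const_mul x))
      simpa using this.pow 2
  have hR : Tendsto (fun n => ∫ x, deriv (g n) x ^ 2 ∂γ) atTop
      (𝓝 (∫ x, (deriv f x - b / v) ^ 2 ∂γ)) := by
    have hbd : MemLp (fun x => |deriv f x| + ((|m| + 1) * C + (|b / v| + 1) * (1 + C))) 2 γ :=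
      (hfm hf.deriv).abs.add (memLp_const _)
    refine tendsto_integral_filter_of_dominated_convergence _
      (Eventually.of_forall fun n => (hgt n).deriv.sq.continuous.aestronglyMeasurable) ?_
      hbd.integrable_sq (Eventually.of_forall fun x => ?_)
    · filter_upwards [hαb, hβb] with n h1 h2
      refine Eventually.of_forall fun x => ?_
      rw [norm_pow, Real.norm_eq_abs, hgd]
      refine pow_le_pow_left₀ (abs_nonneg _) ?_ 2
      rw [← add_assoc]
      refine (abs_sub _ _).trans (add_le_add ((abs_sub _ _).trans (add_le_add le_rfl ?_)) ?_)
      · rw [abs_mul]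
        exact mul_le_mul h1 (hC n x).1 (abs_nonneg _) (by positivity)
      · rw [abs_mul]
        refine mul_le_mul h2 ((abs_add_le _ _).trans (add_le_add (abs_lineCutoff_le_one n x)
          (hC n x).2)) (abs_nonneg _) (by positivity)
    · have e1 : Tendsto (fun n => deriv (g n) x) atTop (𝓝 (deriv f x - m * 0 -
          b / v * (1 + x * 0))) := by
        have h1 : Tendsto (fun n => lineCutoff n x) atTop (𝓝 1) :=
          tendsto_const_nhds.congr' ((eventually_lineCutoff_eq_one x).mono fun n hn =>
            hn.eq_of_nhds.symm)
        have h2 : Tendsto (fun n => deriv (lineCutoff n) x) atTop (𝓝 0) :=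
          tendsto_const_nhds.congr' ((eventually_lineCutoff_eq_one x).mono fun n hn => by
            simp only
            rw [hn.deriv_eq]; simp)
        simp only [hgd]
        exact ((tendsto_const_nhds).sub (hαt.mul h2)).sub (hβt.mul (h1.add (h2.const_mul x)))
      simpa using e1.pow 2
  have hlim := le_of_tendsto_of_tendsto (hL.const_mul 2) (hR.const_mul (v : ℝ)) hineq
  -- expand the squares
  have hdm : ∫ x, deriv f x ∂γ = b / v := by
    have hT := hf.gaussWeight_mul v
    have hz : ∫ x, (-(x / v) * gaussWeight v x * f x + gaussWeight v x * deriv f x) = 0 :=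
      hT.integral_eq_zero_of_hasDerivAt (fun x _ => (hasDerivAt_gaussWeight hv'.ne' x).fun_mul
        (hf.hasDerivAt x)) fun x hx => (hx (mem_univ x)).elim
    have e : ∀ x, -(x / v) * gaussWeight v x * f x + gaussWeight v x * deriv f x =
        -(v : ℝ)⁻¹ * (gaussWeight v x * (x * f x)) + gaussWeight v x * deriv f x := fun x => by
      ring
    simp only [e] at hz
    rw [integral_add ((hxf.gaussWeight_mul v).integrable.const_mul _)
      (hf.deriv.gaussWeight_mul v).integrable, integral_const_mul] at hz
    rw [hb, hcγ, hcγ, eq_neg_of_add_eq_zero_right hz]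
    ring
  -- By `hdm` the number b/v is the mean of f', so this is the variance formula for f'.
  have e1 : ∫ x, (deriv f x - b / v) ^ 2 ∂γ = (∫ x, deriv f x ^ 2 ∂γ) - (b / v) ^ 2 := by
    have hl := integral_linear_three (hf.deriv.sq.integrable (μ := γ)) (hf.deriv.integrable (μ := γ))
      (integrable_const (1 : ℝ)) 1 (-(2 * (b / v))) ((b / v) ^ 2)
    rw [show (∫ x, (deriv f x - b / v) ^ 2 ∂γ) = _ from
      integral_congr_ae (Eventually.of_forall fun s => by ring) |>.trans hl, hdm]
    simp
    ring
  have e2 := integral_gauss_sub_proj hv hf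
  rw [← hγ, ← hm, ← hb] at e2
  rw [e1, e2] at hlim
  have : (v : ℝ) * (b / v) ^ 2 = b ^ 2 / v := by field_simp
  rw [inv_mul_eq_div]
  nlinarith

/-! ### Smooth dependence of integrals on a parameter -/

section Parametric

variable {X : Type*} [TopologicalSpace X] [SecondCountableTopology X] [MeasurableSpace X]
  [OpensMeasurableSpace X] {μ : Measure X} [IsFiniteMeasureOnCompacts μ]
  {H G E' : Type} [NormedAddCommGroup H] [NormedSpace ℝ H] [FiniteDimensional ℝ H]
  [NormedAddCommGroup G] [NormedSpace ℝ G] [NormedAddCommGroup E'] [NormedSpace ℝ E']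
  {K : Set X} {j : X → E'} {Φ : H × E' → G}

theorem hasFDerivAt_setIntegral_of_contDiff (hK : IsCompact K) (hKm : MeasurableSet K)
    (hj : Continuous j) (hΦ : ContDiff ℝ 1 Φ) (h : H) :
    HasFDerivAt (fun h => ∫ x in K, Φ (h, j x) ∂μ)
      (∫ x in K, (fderiv ℝ Φ (h, j x)).comp (ContinuousLinearMap.inl ℝ H E') ∂μ) h := by
  have : IsFiniteMeasure (μ.restrict K) := ⟨by simpa using hK.measure_lt_top⟩
  have hcont : Continuous fun p : H × E' =>
      (fderiv ℝ Φ p).comp (ContinuousLinearMap.inl ℝ H E') :=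
    (hΦ.continuous_fderiv (by simp)).clm_comp continuous_const
  obtain ⟨C, hC⟩ := ((isCompact_closedBall h 1).prod (hK.image hj)).exists_bound_of_continuousOn
    hcont.continuousOn
  have hsec : ∀ h', Continuous fun x => Φ (h', j x) := fun h' =>
    hΦ.continuous.comp (continuous_const.prodMk hj)
  refine hasFDerivAt_integral_of_dominated_of_fderiv_le (bound := fun _ => C)
    (F' := fun h' x => (fderiv ℝ Φ (h', j x)).comp (ContinuousLinearMap.inl ℝ H E'))
    (Metric.closedBall_mem_nhds h one_pos)
    (Eventually.of_forall fun h' => (hsec h').aestronglyMeasurable) ?_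
    (hcont.comp (continuous_const.prodMk hj)).aestronglyMeasurable ?_ (integrable_const C) ?_
  · exact (hsec h).continuousOn.integrableOn_compact' hK hKm
  · filter_upwards [ae_restrict_mem hKm] with x hx h' hh'
    exact hC (h', j x) ⟨hh', mem_image_of_mem j hx⟩
  · refine Eventually.of_forall fun x h' _ => ?_
    have h1 : HasFDerivAt Φ (fderiv ℝ Φ (h', j x)) (h', j x) :=
      (hΦ.differentiable (by simp) _).hasFDerivAt
    exact h1.comp h' (hasFDerivAt_prodMk_left h' (j x))

/-- Differentiating under the integral reproduces an integral of the same kind. Only continuity of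
`j` is required, so the integration variable may run over a sphere as well as over an interval. -/
theorem contDiff_setIntegral (hK : IsCompact K) (hKm : MeasurableSet K)
    (hj : Continuous j) (hΦ : ContDiff ℝ ∞ Φ) :
    ContDiff ℝ ∞ fun h => ∫ x in K, Φ (h, j x) ∂μ := by
  -- The target space must vary in the induction: each derivative replaces G by the continuous
  -- linear maps from H to G.
  have key : ∀ n : ℕ, ∀ (G : Type) [NormedAddCommGroup G] [NormedSpace ℝ G] (Φ : H × E' → G),
      ContDiff ℝ ∞ Φ → ContDiff ℝ n fun h => ∫ x in K, Φ (h, j x) ∂μ := by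
    intro n
    induction n with
    | zero =>
      intro G _ _ Φ hΦ
      refine contDiff_zero.2 (continuous_iff_continuousAt.2 fun h => ?_)
      exact (hasFDerivAt_setIntegral_of_contDiff hK hKm hj (hΦ.of_le (by simp)) h).continuousAt
    | succ n ih =>
      intro G _ _ Φ hΦ
      have hd := fun h => hasFDerivAt_setIntegral_of_contDiff (μ := μ) hK hKm hj
        (hΦ.of_le (by simp)) h
      push_cast
      rw [contDiff_succ_iff_fderiv]
      refine ⟨fun h => (hd h).differentiableAt, by simp, ?_⟩
      rw [funext fun h => (hd h).fderiv]
      exact ih (H →L[ℝ] G) (fun p => (fderiv ℝ Φ p).comp (ContinuousLinearMap.inl ℝ H E'))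
        ((hΦ.fderiv_right (by simp)).clm_comp contDiff_const)
  exact contDiff_infty.2 fun n => key n G Φ hΦ

end Parametric

/-! ### Tensorisation of the Gaussian inequalities -/

section Tensor

open ProbabilityTheory

variable {n : ℕ} {v : NNReal}

/-- The centred Gaussian product measure of variance `v` on `ℝ^n`. -/
def gaussPi (n : ℕ) (v : NNReal) : Measure (Fin n → ℝ) := Measure.pi fun _ => gaussianReal 0 v

instance : IsProbabilityMeasure (gaussPi n v) := by unfold gaussPi; infer_instance

/-- Partial derivative in the direction of a coordinate of `ℝ^n`. -/
def partialDeriv (i : Fin n) (f : (Fin n → ℝ) → ℝ) (x : Fin n → ℝ) : ℝ :=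
  fderiv ℝ f x (Pi.single i 1)

theorem IsTest.partialDeriv {f : (Fin n → ℝ) → ℝ} (hf : IsTest univ f) (i : Fin n) :
    IsTest univ (partialDeriv i f) := hf.fderiv_apply _

/-- Prepending a coordinate, as a continuous linear map. -/
def consCLM (n : ℕ) : (Fin n → ℝ) × ℝ →L[ℝ] (Fin (n + 1) → ℝ) :=
  LinearMap.toContinuousLinearMap
    { toFun := fun p => Fin.cons p.2 p.1
      map_add' := fun p q => by
        ext i; refine Fin.cases ?_ (fun i => ?_) i <;> simp
      map_smul' := fun c p => by
        ext i; refine Fin.cases ?_ (fun i => ?_) i <;> simp }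

@[simp] theorem consCLM_apply (p : (Fin n → ℝ) × ℝ) :
    consCLM n p = (Fin.cons p.2 p.1 : Fin (n + 1) → ℝ) := rfl

theorem consCLM_single (i : Fin n) : consCLM n (Pi.single i 1, 0) = Pi.single i.succ 1 := by
  ext k
  refine Fin.cases ?_ (fun k => ?_) k
  · simp [(Fin.succ_ne_zero i).symm]
  · simp [Pi.single_apply]

theorem consCLM_zero_one : consCLM n (0, 1) = Pi.single 0 1 := by
  ext k
  refine Fin.cases ?_ (fun k => ?_) k <;> simp [Fin.succ_ne_zero]

/-- Integration of the first coordinate against the Gaussian. -/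
def gaussAverage (v : NNReal) (f : (Fin (n + 1) → ℝ) → ℝ) (x : Fin n → ℝ) : ℝ :=
  ∫ t, f (Fin.cons t x) ∂(gaussianReal 0 v)

variable {f : (Fin (n + 1) → ℝ) → ℝ}

theorem IsTest.exists_bound (hf : IsTest univ f) :
    ∃ r, ∀ t x, f (Fin.cons t x) ≠ 0 → t ∈ Icc (-r) r ∧ x ∈ Metric.closedBall (0 : Fin n → ℝ) r := by
  obtain ⟨r, hr⟩ := hf.hasCompactSupport.isCompact.isBounded.subset_closedBall 0
  refine ⟨r, fun t x h => ?_⟩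
  have hm := hr (subset_tsupport f h)
  rw [mem_closedBall_zero_iff] at hm
  have h0 := (norm_le_pi_norm (Fin.cons t x : Fin (n + 1) → ℝ) 0).trans hm
  refine ⟨abs_le.1 (by simpa using h0), ?_⟩
  rw [mem_closedBall_zero_iff, pi_norm_le_iff_of_nonneg ((norm_nonneg _).trans hm)]
  intro i
  simpa using (norm_le_pi_norm (Fin.cons t x : Fin (n + 1) → ℝ) i.succ).trans hm

theorem gaussAverage_eq_setIntegral {r : ℝ} (hr : ∀ t x, f (Fin.cons t x) ≠ 0 →
    t ∈ Icc (-r) r ∧ x ∈ Metric.closedBall (0 : Fin n → ℝ) r) :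
    gaussAverage v f = fun x => ∫ t in Icc (-r) r, (f ∘ consCLM n) (x, t) ∂(gaussianReal 0 v) := by
  ext x
  refine (setIntegral_eq_integral_of_forall_compl_eq_zero fun t ht => ?_).symm
  by_contra hne
  exact ht (hr t x hne).1

theorem IsTest.gaussAverage (hf : IsTest univ f) : IsTest univ (gaussAverage v f) := by
  obtain ⟨r, hr⟩ := hf.exists_bound
  refine ⟨?_, ?_, subset_univ _⟩
  · rw [gaussAverage_eq_setIntegral hr]
    exact contDiff_setIntegral isCompact_Icc measurableSet_Icc continuous_id
      (hf.contDiff.comp (consCLM n).contDiff)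
  · refine HasCompactSupport.of_support_subset_isCompact
      (isCompact_closedBall (0 : Fin n → ℝ) r) fun x hx => ?_
    by_contra hne
    refine hx ?_
    have : ∀ t, f (Fin.cons t x) = 0 := fun t => by
      by_contra h
      exact hne (hr t x h).2
    simp [HardyPoincare.gaussAverage, this]

theorem partialDeriv_gaussAverage (hf : IsTest univ f) (i : Fin n) :
    partialDeriv i (gaussAverage v f) = gaussAverage v (partialDeriv i.succ f) := by
  obtain ⟨r, hr⟩ := hf.exists_bound
  obtain ⟨r', hr'⟩ := (hf.partialDeriv i.succ).exists_bound
  have hr2 : ∀ t x, f (Fin.cons t x) ≠ 0 →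
      t ∈ Icc (-(max r r')) (max r r') ∧ x ∈ Metric.closedBall (0 : Fin n → ℝ) (max r r') :=
    fun t x h => ⟨Icc_subset_Icc (by simp) (by simp) (hr t x h).1,
      Metric.closedBall_subset_closedBall (by simp) (hr t x h).2⟩
  have hr2' : ∀ t x, partialDeriv i.succ f (Fin.cons t x) ≠ 0 →
      t ∈ Icc (-(max r r')) (max r r') ∧ x ∈ Metric.closedBall (0 : Fin n → ℝ) (max r r') :=
    fun t x h => ⟨Icc_subset_Icc (by simp) (by simp) (hr' t x h).1,
      Metric.closedBall_subset_closedBall (by simp) (hr' t x h).2⟩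
  have hsm : ContDiff ℝ ∞ (f ∘ consCLM n) := hf.contDiff.comp (consCLM n).contDiff
  ext x
  have hd := hasFDerivAt_setIntegral_of_contDiff (μ := gaussianReal 0 v)
    (K := Icc (-(max r r')) (max r r')) isCompact_Icc measurableSet_Icc continuous_id
    (hsm.of_le (by simp)) x
  rw [gaussAverage_eq_setIntegral hr2', partialDeriv, gaussAverage_eq_setIntegral hr2]
  rw [show fderiv ℝ (fun x => ∫ t in Icc (-(max r r')) (max r r'),
    (f ∘ consCLM n) (x, t) ∂(gaussianReal 0 v)) x = _ from hd.fderiv]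
  rw [ContinuousLinearMap.integral_apply]
  · refine integral_congr_ae (Eventually.of_forall fun t => ?_)
    simp only [ContinuousLinearMap.comp_apply, ContinuousLinearMap.inl_apply, Function.comp_apply,
      id, partialDeriv]
    rw [fderiv_comp _ (hf.differentiable _) (consCLM n).differentiableAt]
    simp only [ContinuousLinearMap.fderiv, ContinuousLinearMap.comp_apply, consCLM_single]
  · refine ContinuousOn.integrableOn_compact isCompact_Icc (Continuous.continuousOn ?_)
    exact ((hsm.continuous_fderiv (by simp)).comp
      (continuous_const.prodMk continuous_id)).clm_comp continuous_const

theorem integral_gaussAverage (hf : IsTest univ f) :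
    ∫ x, gaussAverage v f x ∂(gaussPi n v) = ∫ x, f x ∂(gaussPi (n + 1) v) := by
  have hmp := (measurePreserving_piFinSuccAbove (fun _ : Fin (n + 1) => gaussianReal 0 v) 0).symm
  have h1 := hmp.integral_comp' (g := f)
  have hI : Integrable (fun p : ℝ × (Fin n → ℝ) =>
      f ((MeasurableEquiv.piFinSuccAbove (fun _ : Fin (n + 1) => ℝ) 0).symm p))
      ((gaussianReal 0 v).prod (gaussPi n v)) :=
    (hmp.integrable_comp_emb (MeasurableEquiv.measurableEmbedding _)).2
      (hf.integrable (μ := Measure.pi fun _ => gaussianReal 0 v))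
  rw [gaussPi, gaussPi, ← h1]
  refine Eq.trans ?_ (integral_prod_symm _ hI).symm
  refine integral_congr_ae (Eventually.of_forall fun x => ?_)
  simp only [gaussAverage]
  refine integral_congr_ae (Eventually.of_forall fun t => ?_)
  simp [MeasurableEquiv.piFinSuccAbove]
  rfl

/-- The first two Gaussian Poincaré inequalities on `ℝ^n`. -/
theorem gauss_pi (hv : v ≠ 0) : ∀ (n : ℕ) (f : (Fin n → ℝ) → ℝ), IsTest univ f →
    (∫ x, f x ^ 2 ∂(gaussPi n v) ≤ v * (∑ i, ∫ x, partialDeriv i f x ^ 2 ∂(gaussPi n v)) +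
      (∫ x, f x ∂(gaussPi n v)) ^ 2) ∧
    (2 * ∫ x, f x ^ 2 ∂(gaussPi n v) ≤ v * (∑ i, ∫ x, partialDeriv i f x ^ 2 ∂(gaussPi n v)) +
      2 * (∫ x, f x ∂(gaussPi n v)) ^ 2 +
      (v : ℝ)⁻¹ * ∑ i, (∫ x, x i * f x ∂(gaussPi n v)) ^ 2) := by
  have hv' : (0 : ℝ) < v := by positivity
  intro n
  induction n with
  | zero =>
    intro f hf
    have hc : ∀ g : (Fin 0 → ℝ) → ℝ, ∫ x, g x ∂(gaussPi 0 v) = g 0 := fun g => by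
      rw [show g = fun _ => g 0 from funext fun x => by rw [Subsingleton.elim x 0]]
      simp
    simp [hc]
  | succ n ih =>
    intro f hf
    have hx : ∀ i, IsTest univ fun x : Fin (n + 1) → ℝ => x i * f x := fun i =>
      hf.smooth_mul fun _ _ => (contDiff_apply ℝ ℝ i).contDiffAt
    -- The functions a and b are the unnormalised coefficients of 1 and of the first coordinate in
    -- the expansion of f in that variable, and they depend on the remaining n variables.
    set a := gaussAverage v f with ha
    set b := gaussAverage v (fun x => x 0 * f x) with hb
    have hat : IsTest univ a := hf.gaussAverage
    have hbt : IsTest univ b := (hx 0).gaussAverage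
    obtain ⟨iha1, iha2⟩ := ih a hat
    obtain ⟨ihb1, -⟩ := ih b hbt
    -- slices
    have hslice : ∀ {g : (Fin (n + 1) → ℝ) → ℝ}, IsTest univ g → ∀ x : Fin n → ℝ,
        IsTest univ fun t => g (Fin.cons t x) := by
      intro g hg x
      obtain ⟨r, hr⟩ := hg.exists_bound
      refine ⟨?_, HasCompactSupport.of_support_subset_isCompact isCompact_Icc
        (fun t ht => (hr t x ht).1), subset_univ _⟩
      exact (hg.contDiff.comp (consCLM n).contDiff).comp (contDiff_prodMk_right x)
    have hslice_deriv : ∀ (x : Fin n → ℝ) t,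
        deriv (fun t => f (Fin.cons t x)) t = partialDeriv 0 f (Fin.cons t x) := by
      intro x t
      have h1 : HasFDerivAt f (fderiv ℝ f (Fin.cons t x)) (consCLM n (x, t)) :=
        (hf.differentiable _).hasFDerivAt
      have h2 := (h1.comp (x, t) (consCLM n).hasFDerivAt).comp t (hasFDerivAt_prodMk_right x t)
      have h3 := h2.hasDerivAt
      rw [show deriv (fun t => f (Fin.cons t x)) t = _ from h3.deriv]
      simp only [ContinuousLinearMap.comp_apply, ContinuousLinearMap.inr_apply, consCLM_zero_one,
        partialDeriv]
    have hd0 := hf.partialDeriv 0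
    have hline : ∀ x, 2 * gaussAverage v (fun y => f y ^ 2) x ≤
        v * gaussAverage v (fun y => partialDeriv 0 f y ^ 2) x + 2 * a x ^ 2 +
          (v : ℝ)⁻¹ * b x ^ 2 := fun x => by
      have := gauss_line hv (hslice hf x)
      simp only [hslice_deriv] at this
      exact this
    have hbes : ∀ {g : (Fin (n + 1) → ℝ) → ℝ}, IsTest univ g → ∀ x : Fin n → ℝ,
        gaussAverage v g x ^ 2 + (v : ℝ)⁻¹ * gaussAverage v (fun y => y 0 * g y) x ^ 2 ≤
        gaussAverage v (fun y => g y ^ 2) x := fun hg x => gauss_line_bessel hv (hslice hg x)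
    have hA : ∫ x, a x ∂(gaussPi n v) = ∫ x, f x ∂(gaussPi (n + 1) v) := integral_gaussAverage hf
    have hB : ∫ x, b x ∂(gaussPi n v) = ∫ x, x 0 * f x ∂(gaussPi (n + 1) v) :=
      integral_gaussAverage (hx 0)
    have hF := integral_gaussAverage (v := v) hf.sq
    have hD0 := integral_gaussAverage (v := v) hd0.sq
    have hxa : ∀ i, ∫ x, x i * a x ∂(gaussPi n v) =
        ∫ x, x i.succ * f x ∂(gaussPi (n + 1) v) := fun i => by
      rw [← integral_gaussAverage (hx i.succ)]
      congr 1; ext x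
      simp only [gaussAverage, ha, Fin.cons_succ]
      rw [integral_const_mul]
    -- A derivative in a later variable commutes both with averaging and with multiplication by the
    -- first coordinate. So the derivatives of a and b are the coefficients of the derivative of f,
    -- and Bessel's inequality applies to them.
    have hDi : ∀ i : Fin n, (∫ x, partialDeriv i a x ^ 2 ∂(gaussPi n v)) +
        (v : ℝ)⁻¹ * (∫ x, partialDeriv i b x ^ 2 ∂(gaussPi n v)) ≤
        ∫ x, partialDeriv i.succ f x ^ 2 ∂(gaussPi (n + 1) v) := fun i => by
      have hdi := hf.partialDeriv i.succ
      rw [← integral_gaussAverage (v := v) hdi.sq, ← integral_const_mul,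
        ← integral_add (hat.partialDeriv i).sq.integrable
          ((hbt.partialDeriv i).sq.integrable.const_mul _)]
      refine integral_mono ((hat.partialDeriv i).sq.integrable.add
          ((hbt.partialDeriv i).sq.integrable.const_mul _)) hdi.sq.gaussAverage.integrable
          fun x => ?_
      have hpb : partialDeriv i.succ (fun x => x 0 * f x) =
          fun x => x 0 * partialDeriv i.succ f x := by
        ext x
        have h1 : HasFDerivAt (fun x : Fin (n + 1) → ℝ => x 0)
          (ContinuousLinearMap.proj (R := ℝ) (φ := fun _ : Fin (n + 1) => ℝ) 0) x :=
          hasFDerivAt_apply 0 x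
        have h2 := h1.fun_mul (hf.differentiable x).hasFDerivAt
        rw [partialDeriv, h2.fderiv]
        simp [partialDeriv, (Fin.succ_ne_zero i).symm]
      have := hbes hdi x
      rw [ha, hb, partialDeriv_gaussAverage hf, partialDeriv_gaussAverage (hx 0), hpb]
      exact this
    have hI : 2 * ∫ x, f x ^ 2 ∂(gaussPi (n + 1) v) ≤
        v * (∫ x, partialDeriv 0 f x ^ 2 ∂(gaussPi (n + 1) v)) +
        2 * (∫ x, a x ^ 2 ∂(gaussPi n v)) + (v : ℝ)⁻¹ * ∫ x, b x ^ 2 ∂(gaussPi n v) := by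
      rw [← hF, ← hD0, ← integral_linear_three hd0.sq.gaussAverage.integrable hat.sq.integrable
        hbt.sq.integrable, ← integral_const_mul]
      exact integral_mono (hf.sq.gaussAverage.integrable.const_mul _)
        (((hd0.sq.gaussAverage.const_mul _).add (hat.sq.const_mul _)).add
          (hbt.sq.const_mul _)).integrable hline
    have hbesf : (∫ x, a x ^ 2 ∂(gaussPi n v)) + (v : ℝ)⁻¹ * (∫ x, b x ^ 2 ∂(gaussPi n v)) ≤
        ∫ x, f x ^ 2 ∂(gaussPi (n + 1) v) := by
      rw [← hF, ← integral_const_mul, ← integral_add hat.sq.integrable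
        (hbt.sq.integrable.const_mul _)]
      exact integral_mono (hat.sq.integrable.add (hbt.sq.integrable.const_mul _))
        hf.sq.gaussAverage.integrable (hbes hf)
    have hsum : (∑ i, ∫ x, partialDeriv i a x ^ 2 ∂(gaussPi n v)) +
        (v : ℝ)⁻¹ * (∑ i, ∫ x, partialDeriv i b x ^ 2 ∂(gaussPi n v)) ≤
        ∑ i : Fin n, ∫ x, partialDeriv i.succ f x ^ 2 ∂(gaussPi (n + 1) v) := by
      rw [Finset.mul_sum, ← Finset.sum_add_distrib]
      exact Finset.sum_le_sum fun i _ => hDi i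
    have hsum0 : 0 ≤ ∑ i, ∫ x, partialDeriv i b x ^ 2 ∂(gaussPi n v) :=
      Finset.sum_nonneg fun i _ => integral_nonneg fun x => sq_nonneg _
    rw [Fin.sum_univ_succ, Fin.sum_univ_succ]
    simp only [hxa] at iha2
    rw [hA] at iha1 iha2
    rw [hB] at ihb1
    have hvi : (0 : ℝ) < (v : ℝ)⁻¹ := by positivity
    have hs1 := mul_le_mul_of_nonneg_left hsum hv'.le
    have hs2 := mul_le_mul_of_nonneg_left ihb1 hvi.le
    have hs3 : (v : ℝ) * ((v : ℝ)⁻¹ * ∑ i, ∫ x, partialDeriv i b x ^ 2 ∂(gaussPi n v)) =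
      ∑ i, ∫ x, partialDeriv i b x ^ 2 ∂(gaussPi n v) := by field_simp
    have hs4 : (v : ℝ)⁻¹ * (v * ∑ i, ∫ x, partialDeriv i b x ^ 2 ∂(gaussPi n v)) =
      ∑ i, ∫ x, partialDeriv i b x ^ 2 ∂(gaussPi n v) := by field_simp
    rw [mul_add, hs3] at hs1
    rw [mul_add, hs4] at hs2
    -- For the first inequality, `hI` and Bessel's inequality `hbesf` give ‖f‖² ≤ v‖∂₀f‖² + ‖a‖²,
    -- and the induction hypothesis bounds ‖a‖². For the second, ‖a‖² is bounded by the second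
    -- inequality in dimension n, but ‖b‖² only by the first one; this is why the two are carried
    -- together.
    constructor
    · rw [mul_add]
      linarith
    · rw [mul_add, mul_add]
      linarith

end Tensor

/-! ### From Gaussian products to the weights (1 + |x|²)^(-b) -/

open ProbabilityTheory in
theorem gaussPi_eq_withDensity {n : ℕ} {v : NNReal} (hv : v ≠ 0) :
    gaussPi n v = volume.withDensity fun x => ENNReal.ofReal (∏ i, gaussianPDFReal 0 v (x i)) := by
  refine Measure.pi_eq fun s hs => ?_
  have h0 : ∀ x : Fin n → ℝ, 0 ≤ ∏ i, gaussianPDFReal 0 v (x i) := fun x =>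
    Finset.prod_nonneg fun i _ => gaussianPDFReal_nonneg _ _ _
  have hi : ∀ i, Integrable (gaussianPDFReal 0 v) (volume.restrict (s i)) := fun i =>
    (integrable_gaussianPDFReal 0 v).restrict
  rw [withDensity_apply _ (MeasurableSet.univ_pi hs), volume_pi, Measure.restrict_pi_pi,
    ← ofReal_integral_eq_lintegral_ofReal (Integrable.fintype_prod hi)
      (Eventually.of_forall h0),
    integral_fintype_prod_eq_prod (fun _ : Fin n => gaussianPDFReal 0 v),
    ENNReal.ofReal_prod_of_nonneg fun i _ => integral_nonneg fun x =>
      gaussianPDFReal_nonneg _ _ _]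
  exact Finset.prod_congr rfl fun i _ => (gaussianReal_apply_eq_integral 0 hv (s i)).symm

-- The variance 1/(2t) makes the product density proportional to exp(-t|x|²). The value of the
-- constant is irrelevant, as it cancels once the moments vanish.
open ProbabilityTheory in
theorem exists_integral_gaussPi_eq (n : ℕ) {t : ℝ} (ht : 0 < t) :
    ∃ c : ℝ, 0 < c ∧ ∀ g : (Fin n → ℝ) → ℝ,
      ∫ x, g x ∂(gaussPi n (1 / (2 * t)).toNNReal) =
        c * ∫ x, Real.exp (-t * ∑ i, x i ^ 2) * g x := by
  have hv0 : (0 : ℝ) < 1 / (2 * t) := by positivity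
  have hv : (1 / (2 * t)).toNNReal ≠ 0 := (Real.toNNReal_pos.2 hv0).ne'
  have hc : ((1 / (2 * t)).toNNReal : ℝ) = 1 / (2 * t) := Real.coe_toNNReal _ hv0.le
  refine ⟨((√(2 * Real.pi * (1 / (2 * t))))⁻¹) ^ n, by positivity, fun g => ?_⟩
  have hmeas : Measurable fun x : Fin n → ℝ =>
      ENNReal.ofReal (∏ i, gaussianPDFReal 0 (1 / (2 * t)).toNNReal (x i)) := by fun_prop
  rw [gaussPi_eq_withDensity hv, integral_withDensity_eq_integral_toReal_smul hmeas
    (Eventually.of_forall fun x => ENNReal.ofReal_lt_top), ← integral_const_mul]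
  refine integral_congr_ae (Eventually.of_forall fun x => ?_)
  simp only
  rw [ENNReal.toReal_ofReal (Finset.prod_nonneg fun i _ => gaussianPDFReal_nonneg _ _ _)]
  simp only [gaussianPDFReal, hc, sub_zero, Finset.prod_mul_distrib, Finset.prod_const,
    Finset.card_univ, Fintype.card_fin, ← Real.exp_sum, smul_eq_mul]
  rw [Finset.mul_sum, mul_assoc]
  congr 2
  refine congrArg _ (Finset.sum_congr rfl fun i _ => ?_)
  field_simp

/-- The partial derivative in a coordinate direction of Euclidean space. -/
def pd {d : ℕ} (i : Fin d) (f : EuclideanSpace ℝ (Fin d) → ℝ) (x : EuclideanSpace ℝ (Fin d)) : ℝ :=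
  fderiv ℝ f x (EuclideanSpace.single i 1)

section Euclidean

variable {d : ℕ} {Ω : Set (EuclideanSpace ℝ (Fin d))} {f : EuclideanSpace ℝ (Fin d) → ℝ}

theorem IsTest.pd (hf : IsTest Ω f) (i : Fin d) : IsTest Ω (pd i f) := hf.fderiv_apply _

theorem contDiff_coord (i : Fin d) : ContDiff ℝ ∞ fun x : EuclideanSpace ℝ (Fin d) => x i := by
  fun_prop

theorem IsTest.coord_mul (hf : IsTest Ω f) (i : Fin d) : IsTest Ω fun x => x i * f x :=
  hf.smooth_mul fun _ _ => (contDiff_coord i).contDiffAt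

theorem integral_euclidean (g : EuclideanSpace ℝ (Fin d) → ℝ) :
    ∫ x, g x = ∫ y : Fin d → ℝ, g (WithLp.toLp 2 y) :=
  ((PiLp.volume_preserving_toLp (Fin d)).integral_comp
    (MeasurableEquiv.toLp 2 (Fin d → ℝ)).measurableEmbedding g).symm

/-- The second Gaussian Poincaré inequality, for the weight `exp (-t |x|²)`. -/
theorem gauss_euclidean {t : ℝ} (ht : 0 < t) (hf : IsTest univ f)
    (h0 : ∫ x, Real.exp (-t * ‖x‖ ^ 2) * f x = 0)
    (h1 : ∀ i, ∫ x, Real.exp (-t * ‖x‖ ^ 2) * (x i * f x) = 0) :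
    4 * t * ∫ x, Real.exp (-t * ‖x‖ ^ 2) * f x ^ 2 ≤
      ∑ i, ∫ x, Real.exp (-t * ‖x‖ ^ 2) * pd i f x ^ 2 := by
  have hv0 : (0 : ℝ) < 1 / (2 * t) := by positivity
  have hv : (1 / (2 * t)).toNNReal ≠ 0 := (Real.toNNReal_pos.2 hv0).ne'
  have hcv : ((1 / (2 * t)).toNNReal : ℝ) = 1 / (2 * t) := Real.coe_toNNReal _ hv0.le
  obtain ⟨c, hc, hI⟩ := exists_integral_gaussPi_eq d ht
  let L : (Fin d → ℝ) ≃L[ℝ] EuclideanSpace ℝ (Fin d) :=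
    (PiLp.continuousLinearEquiv 2 ℝ (fun _ : Fin d => ℝ)).symm
  have hL : ∀ y, L y = WithLp.toLp 2 y := fun y => rfl
  have hT : IsTest univ fun y => f (L y) :=
    ⟨hf.contDiff.comp L.contDiff, hf.hasCompactSupport.comp_homeomorph L.toHomeomorph,
      subset_univ _⟩
  have hpd : ∀ i y, partialDeriv i (fun y => f (L y)) y = pd i f (L y) := fun i y => by
    have h := ((hf.differentiable (L y)).hasFDerivAt).comp y L.hasFDerivAt
    rw [partialDeriv, show fderiv ℝ (fun y => f (L y)) y = _ from h.fderiv]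
    rfl
  have hconv : ∀ g : EuclideanSpace ℝ (Fin d) → ℝ,
      ∫ y, g (L y) ∂(gaussPi d (1 / (2 * t)).toNNReal) =
        c * ∫ x, Real.exp (-t * ‖x‖ ^ 2) * g x := fun g => by
    rw [hI, integral_euclidean]
    congr 1
    refine integral_congr_ae (Eventually.of_forall fun y => ?_)
    simp [EuclideanSpace.norm_sq_eq, hL]
  have hg := (gauss_pi hv d _ hT).2
  simp only [hpd] at hg
  have hx : ∀ i, ∫ y, y i * f (L y) ∂(gaussPi d (1 / (2 * t)).toNNReal) = 0 := fun i =>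
    (hconv fun x => x i * f x).trans (by rw [h1 i, mul_zero])
  rw [hconv fun x => f x ^ 2, hconv f, h0, hcv] at hg
  simp only [hx, fun i => hconv fun x => pd i f x ^ 2] at hg
  rw [← Finset.mul_sum] at hg
  simp only [mul_zero, ne_eq, OfNat.ofNat_ne_zero, not_false_eq_true, zero_pow,
    Finset.sum_const_zero, add_zero] at hg
  -- The gap 2/v at variance v = 1/(2t) is 4t.
  have h2 : 2 * c * t * (2 * ∫ x, Real.exp (-t * ‖x‖ ^ 2) * f x ^ 2) ≤
      c * ∑ i, ∫ x, Real.exp (-t * ‖x‖ ^ 2) * pd i f x ^ 2 := by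
    have := mul_le_mul_of_nonneg_left hg (by positivity : 0 ≤ 2 * t)
    have e : 2 * t * (1 / (2 * t) * (c * ∑ i, ∫ x, Real.exp (-t * ‖x‖ ^ 2) * pd i f x ^ 2)) =
      c * ∑ i, ∫ x, Real.exp (-t * ‖x‖ ^ 2) * pd i f x ^ 2 := by field_simp
    rw [e] at this
    linarith
  refine le_of_mul_le_mul_left ?_ hc
  linarith

/-- The weight `(1 + |x|²) ^ b` as a mixture of Gaussians. -/
theorem gaussian_mixture {b : ℝ} (hb : 0 < b) (hf : IsTest Ω f) :
    IntegrableOn (fun t => t ^ (b - 1) * Real.exp (-t) *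
      ∫ x, Real.exp (-t * ‖x‖ ^ 2) * f x) (Ioi 0) ∧
    ∫ t in Ioi 0, t ^ (b - 1) * Real.exp (-t) * ∫ x, Real.exp (-t * ‖x‖ ^ 2) * f x =
      Real.Gamma b * ∫ x, (1 + ‖x‖ ^ 2) ^ (-b) * f x := by
  have hG : IntegrableOn (fun t : ℝ => t ^ (b - 1) * Real.exp (-t)) (Ioi 0) := by
    simpa [mul_comm] using Real.GammaIntegral_convergent hb
  have hprod : Integrable (fun p : ℝ × EuclideanSpace ℝ (Fin d) =>
      p.1 ^ (b - 1) * Real.exp (-p.1) * (Real.exp (-p.1 * ‖p.2‖ ^ 2) * f p.2))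
      ((volume.restrict (Ioi 0)).prod volume) := by
    -- For t > 0 the Gaussian factor is at most 1, so a product of integrable functions dominates
    -- and Fubini's theorem applies.
    refine (Integrable.mul_prod (f := fun t : ℝ => t ^ (b - 1) * Real.exp (-t)) (g := f)
      hG hf.integrable).mono ?_ ?_
    · refine AEStronglyMeasurable.mul ?_ ?_
      · exact (by fun_prop : Measurable fun p : ℝ × EuclideanSpace ℝ (Fin d) =>
          p.1 ^ (b - 1) * Real.exp (-p.1)).aestronglyMeasurable
      · have := hf.continuous
        exact (by fun_prop : Continuous fun p : ℝ × EuclideanSpace ℝ (Fin d) =>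
          Real.exp (-p.1 * ‖p.2‖ ^ 2) * f p.2).aestronglyMeasurable
    · have : ∀ᵐ p ∂((volume.restrict (Ioi (0 : ℝ))).prod
          (volume : Measure (EuclideanSpace ℝ (Fin d)))), p.1 ∈ Ioi (0 : ℝ) :=
        Measure.quasiMeasurePreserving_fst.ae (ae_restrict_mem measurableSet_Ioi)
      filter_upwards [this] with p hp
      have hp' : 0 < p.1 := hp
      rw [norm_mul, norm_mul (Real.exp (-p.1 * ‖p.2‖ ^ 2)),
        norm_mul (p.1 ^ (b - 1) * Real.exp (-p.1)) (f p.2)]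
      refine mul_le_mul_of_nonneg_left ?_ (norm_nonneg _)
      refine mul_le_of_le_one_left (norm_nonneg _) ?_
      rw [Real.norm_eq_abs, Real.abs_exp, Real.exp_le_one_iff]
      nlinarith [sq_nonneg ‖p.2‖]
  constructor
  · refine hprod.integral_prod_left.congr (Eventually.of_forall fun t => ?_)
    simp only
    rw [integral_const_mul]
  · have h1 := integral_integral_swap (f := fun (t : ℝ) (x : EuclideanSpace ℝ (Fin d)) =>
      t ^ (b - 1) * Real.exp (-t) * (Real.exp (-t * ‖x‖ ^ 2) * f x)) hprod
    simp only [integral_const_mul] at h1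
    rw [h1, ← integral_const_mul]
    refine integral_congr_ae (Eventually.of_forall fun x => ?_)
    have hs : (0 : ℝ) < 1 + ‖x‖ ^ 2 := by positivity
    -- The two exponentials merge into exp(-(1+|x|²)t), whose Mellin transform at b is Γ(b)
    -- (1+|x|²)^(-b).
    have h2 := Real.integral_rpow_mul_exp_neg_mul_Ioi hb hs
    have e : ∀ t : ℝ, t ^ (b - 1) * Real.exp (-t) * (Real.exp (-t * ‖x‖ ^ 2) * f x) =
        f x * (t ^ (b - 1) * Real.exp (-((1 + ‖x‖ ^ 2) * t))) := fun t => by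
      rw [show -((1 + ‖x‖ ^ 2) * t) = -t + -t * ‖x‖ ^ 2 by ring, Real.exp_add]; ring
    simp only [e, integral_const_mul]
    rw [h2, Real.rpow_neg hs.le, one_div, Real.inv_rpow hs.le]
    ring

/-- The sharp inequality for functions without radial and linear components. -/
theorem gap_of_orthogonal_gaussians {b : ℝ} (hb : 0 < b) (hf : IsTest univ f)
    (h0 : ∀ t, 0 < t → ∫ x, Real.exp (-t * ‖x‖ ^ 2) * f x = 0)
    (h1 : ∀ t, 0 < t → ∀ i, ∫ x, Real.exp (-t * ‖x‖ ^ 2) * (x i * f x) = 0) :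
    4 * b * ∫ x, (1 + ‖x‖ ^ 2) ^ (-b - 1) * f x ^ 2 ≤
      ∑ i, ∫ x, (1 + ‖x‖ ^ 2) ^ (-b) * pd i f x ^ 2 := by
  -- The mixture for ∫ f² is taken at b+1, not b: the gap 4t supplies one more power of t. This
  -- lowers the weight exponent by one and gives the constant 4Γ(b+1)/Γ(b) = 4b.
  obtain ⟨hi1, he1⟩ := gaussian_mixture (b := b + 1) (by linarith) hf.sq
  have hpd := fun i => gaussian_mixture hb (hf.pd i).sq
  have hG := Real.Gamma_pos_of_pos hb
  have hsum : ∑ i, Real.Gamma b * ∫ x, (1 + ‖x‖ ^ 2) ^ (-b) * pd i f x ^ 2 =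
      ∫ t in Ioi 0, ∑ i, (t ^ (b - 1) * Real.exp (-t) *
        ∫ x, Real.exp (-t * ‖x‖ ^ 2) * pd i f x ^ 2) := by
    rw [integral_finsetSum _ fun i _ => (hpd i).1]
    exact Finset.sum_congr rfl fun i _ => (hpd i).2.symm
  have hmono := setIntegral_mono_on (hi1.const_mul 4)
    (integrable_finsetSum Finset.univ fun i _ => (hpd i).1) measurableSet_Ioi
    (fun t (ht : 0 < t) => by
      rw [← Finset.mul_sum]
      have := gauss_euclidean ht hf (h0 t ht) (h1 t ht)
      have h3 := mul_le_mul_of_nonneg_left this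
        (by positivity : 0 ≤ t ^ (b - 1) * Real.exp (-t))
      have e : t ^ (b + 1 - 1) = t ^ (b - 1) * t := by
        rw [add_sub_right_comm, Real.rpow_add_one ht.ne']
      rw [e]
      linarith)
  rw [integral_const_mul, he1, ← hsum, ← Finset.mul_sum, Real.Gamma_add_one hb.ne'] at hmono
  refine le_of_mul_le_mul_left ?_ hG
  rw [show -b - 1 = -(b + 1) by ring]
  linarith

end Euclidean

/-! ### Spherical means and integrals of radial functions -/

section Radial

variable {d : ℕ}

local notation "𝔼" => EuclideanSpace ℝ (Fin d)

/-- Radial functions with test profile are test functions away from the origin. -/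
theorem IsTest.radial {p : ℝ → ℝ} (hp : IsTest (Ioi 0) p) :
    IsTest ({0}ᶜ : Set 𝔼) fun x => p (‖x‖ ^ 2) := by
  obtain ⟨a, b, ha, hab, hz⟩ := hp.exists_subset_Icc
  have hb : 0 < b := ha.trans hab
  have hK : IsCompact (Metric.closedBall (0 : 𝔼) (√b) ∩ {x | a ≤ ‖x‖ ^ 2}) :=
    (isCompact_closedBall _ _).inter_right (isClosed_le continuous_const (by fun_prop))
  refine IsTest.of_tsupport_subset hK ?_ (hp.contDiff.comp (contDiff_norm_sq ℝ)) ?_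
  · rintro x ⟨-, hx⟩ h0
    simp only [mem_ofPred_eq, mem_singleton_iff.1 h0, norm_zero] at hx
    norm_num at hx
    linarith
  · refine closure_minimal (fun x hx => ?_) hK.isClosed
    have h1 : ‖x‖ ^ 2 ∈ Icc a b := by
      by_contra h
      exact hx (hz _ h)
    refine ⟨?_, h1.1⟩
    rw [mem_closedBall_zero_iff]
    exact Real.le_sqrt_of_sq_le h1.2

theorem contDiffAt_comp_norm_sq {φ : ℝ → ℝ} (hφ : ∀ s ∈ Ioi (0 : ℝ), ContDiffAt ℝ ∞ φ s) :
    ∀ x ∈ ({0}ᶜ : Set 𝔼), ContDiffAt ℝ ∞ (fun x : 𝔼 => φ (‖x‖ ^ 2)) x := fun x hx =>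
  (hφ (‖x‖ ^ 2) (by
    have : x ≠ 0 := hx
    have := norm_pos_iff.2 this
    exact pow_pos this 2)).comp x (contDiff_norm_sq ℝ).contDiffAt

theorem IsTest.radial_mul {u : 𝔼 → ℝ} (hu : IsTest ({0}ᶜ) u) {φ : ℝ → ℝ}
    (hφ : ∀ s ∈ Ioi (0 : ℝ), ContDiffAt ℝ ∞ φ s) : IsTest ({0}ᶜ) fun x => φ (‖x‖ ^ 2) * u x :=
  hu.smooth_mul (contDiffAt_comp_norm_sq hφ)

theorem IsTest.exists_norm_bounds {u : 𝔼 → ℝ} (hu : IsTest ({0}ᶜ) u) :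
    ∃ a b, 0 < a ∧ ∀ x, u x ≠ 0 → a ≤ ‖x‖ ∧ ‖x‖ ≤ b := by
  obtain ⟨b, hb⟩ := hu.hasCompactSupport.isCompact.isBounded.subset_closedBall 0
  have h0 : (0 : 𝔼) ∈ (tsupport u)ᶜ := fun h => hu.tsupport_subset h rfl
  obtain ⟨a, ha, hsub⟩ := Metric.isOpen_iff.1 (isClosed_tsupport u).isOpen_compl 0 h0
  refine ⟨a, b, ha, fun x hx => ⟨?_, mem_closedBall_zero_iff.1 (hb (subset_tsupport u hx))⟩⟩
  by_contra! hlt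
  exact hsub (mem_ball_zero_iff.2 hlt) (subset_tsupport u hx)

/-- The unnormalised surface measure of the unit sphere. -/
abbrev sphereMeasure (d : ℕ) : Measure (Metric.sphere (0 : EuclideanSpace ℝ (Fin d)) 1) :=
  (volume : Measure (EuclideanSpace ℝ (Fin d))).toSphere

/-- The mean of `u` over the sphere of radius `√s`. -/
def sphereMean (u : 𝔼 → ℝ) (s : ℝ) : ℝ :=
  ((sphereMeasure d).real univ)⁻¹ * ∫ θ : Metric.sphere (0 : 𝔼) 1, u (√s • (θ : 𝔼)) ∂(sphereMeasure d)

/-- Since u vanishes near the origin, (s, y) ↦ u(√s y) is smooth on all of ℝ × ℝ^d: for s > 0 the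
square root is smooth, and near a point with s ≤ 0 the function is zero. -/
theorem IsTest.sphereMean {u : 𝔼 → ℝ} (hu : IsTest ({0}ᶜ) u) :
    IsTest (Ioi 0) (sphereMean u) := by
  obtain ⟨a, b, ha, hab⟩ := hu.exists_norm_bounds
  have hΦ : ContDiff ℝ ∞ fun p : ℝ × 𝔼 => u (√p.1 • p.2) := by
    refine contDiff_iff_contDiffAt.2 fun p => ?_
    rcases lt_or_ge 0 p.1 with hp | hp
    · exact hu.contDiff.contDiffAt.comp p
        ((contDiffAt_fst.sqrt hp.ne').smul contDiffAt_snd)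
    · have hc : Continuous fun p : ℝ × 𝔼 => ‖√p.1 • p.2‖ := by fun_prop
      have h0 : ‖√p.1 • p.2‖ < a := by simp [Real.sqrt_eq_zero_of_nonpos hp, ha]
      have : (fun p : ℝ × 𝔼 => u (√p.1 • p.2)) =ᶠ[𝓝 p] fun _ => 0 := by
        filter_upwards [hc.continuousAt.eventually_lt_const h0] with q hq
        by_contra hne
        exact absurd (hab _ hne).1 (not_le.2 hq)
      exact contDiffAt_const.congr_of_eventuallyEq this
  have hsm : ContDiff ℝ ∞ (HardyPoincare.sphereMean u) := by
    have := contDiff_setIntegral (μ := sphereMeasure d) (K := univ)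
      (j := fun θ : Metric.sphere (0 : 𝔼) 1 => (θ : 𝔼)) isCompact_univ MeasurableSet.univ
      continuous_subtype_val hΦ
    simp only [Measure.restrict_univ] at this
    exact contDiff_const.mul this
  refine IsTest.of_tsupport_subset (isCompact_Icc (a := a ^ 2) (b := b ^ 2))
    (fun s hs => lt_of_lt_of_le (by positivity) hs.1) hsm
    (closure_minimal (fun s hs => ?_) isClosed_Icc)
  by_contra hne
  refine hs ?_
  have hz : ∀ θ : Metric.sphere (0 : 𝔼) 1, u (√s • (θ : 𝔼)) = 0 := by
    intro θ
    by_contra h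
    have h1 := hab _ h
    rw [norm_smul, norm_eq_of_mem_sphere, mul_one, Real.norm_eq_abs,
      abs_of_nonneg (Real.sqrt_nonneg s)] at h1
    have hs0 : 0 ≤ s := by
      by_contra! hneg
      rw [Real.sqrt_eq_zero_of_nonpos hneg.le] at h1
      linarith [h1.1]
    refine hne ⟨?_, ?_⟩
    · rw [← Real.sq_sqrt hs0]; exact pow_le_pow_left₀ ha.le h1.1 2
    · rw [← Real.sq_sqrt hs0]; exact pow_le_pow_left₀ (Real.sqrt_nonneg s) h1.2 2
  simp [HardyPoincare.sphereMean, hz]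

/-- Integration in polar coordinates. -/
theorem integral_polar {u : 𝔼 → ℝ} (hd : 0 < d) (hu : Integrable u) :
    ∫ x, u x = ∫ r : Ioi (0 : ℝ), (∫ θ : Metric.sphere (0 : 𝔼) 1, u ((r : ℝ) • (θ : 𝔼))
      ∂(sphereMeasure d)) ∂(Measure.volumeIoiPow (Module.finrank ℝ 𝔼 - 1)) := by
  have : Nonempty (Fin d) := ⟨⟨0, hd⟩⟩
  have : Nontrivial 𝔼 := by infer_instance
  have hmp := (volume : Measure 𝔼).measurePreserving_homeomorphUnitSphereProd
  have hemb := (homeomorphUnitSphereProd 𝔼).measurableEmbedding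
  let g : Metric.sphere (0 : 𝔼) 1 × Ioi (0 : ℝ) → ℝ := fun p => u ((p.2 : ℝ) • (p.1 : 𝔼))
  have hg : ∀ x : ({0}ᶜ : Set 𝔼), g (homeomorphUnitSphereProd 𝔼 x) = u x := fun x => by
    simp only [g, homeomorphUnitSphereProd_apply_snd_coe, homeomorphUnitSphereProd_apply_fst_coe]
    rw [smul_smul, mul_inv_cancel₀ (norm_ne_zero_iff.2 x.2), one_smul]
  have hgI : Integrable g ((volume : Measure 𝔼).toSphere.prod
      (Measure.volumeIoiPow (Module.finrank ℝ 𝔼 - 1))) := by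
    rw [← hmp.integrable_comp_emb hemb]
    have : IntegrableOn u ({0}ᶜ : Set 𝔼) := hu.integrableOn
    rw [integrableOn_iff_comap_subtypeVal (measurableSet_singleton _).compl] at this
    exact this.congr (Eventually.of_forall fun x => (hg x).symm)
  calc ∫ x, u x = ∫ x : ({0}ᶜ : Set 𝔼), u x.1 ∂(Measure.comap Subtype.val volume) := by
        rw [integral_subtype_comap (measurableSet_singleton _).compl, restrict_compl_singleton]
    _ = ∫ x : ({0}ᶜ : Set 𝔼), g (homeomorphUnitSphereProd 𝔼 x) ∂(Measure.comap Subtype.val volume) := by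
        simp only [hg]
    _ = ∫ p, g p ∂((volume : Measure 𝔼).toSphere.prod
      (Measure.volumeIoiPow (Module.finrank ℝ 𝔼 - 1))) := hmp.integral_comp hemb g
    _ = _ := integral_prod_symm _ hgI

theorem sphereMeasure_real_pos (hd : 0 < d) : 0 < (sphereMeasure d).real univ := by
  have : Nonempty (Fin d) := ⟨⟨0, hd⟩⟩
  have : Nontrivial 𝔼 := by infer_instance
  have := Measure.toSphere_ne_zero (volume : Measure 𝔼)
  exact ENNReal.toReal_pos (Measure.measure_univ_ne_zero.2 this) (measure_ne_top _ _)

/-- A function and its spherical mean have the same integrals against radial functions. -/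
theorem integral_radial_mul_sphereMean (hd : 0 < d) {u : 𝔼 → ℝ} (hu : IsTest ({0}ᶜ) u) {φ : ℝ → ℝ}
    (hφ : ∀ s ∈ Ioi (0 : ℝ), ContDiffAt ℝ ∞ φ s) :
    ∫ x, φ (‖x‖ ^ 2) * u x = ∫ x : 𝔼, φ (‖x‖ ^ 2) * sphereMean u (‖x‖ ^ 2) := by
  have hpos := sphereMeasure_real_pos hd
  rw [integral_polar hd (hu.radial_mul hφ).integrable,
    integral_polar hd (hu.sphereMean.radial.radial_mul hφ).integrable]
  refine integral_congr_ae (Eventually.of_forall fun r => ?_)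
  have hr : (0 : ℝ) < r := r.2
  have hn : ∀ θ : Metric.sphere (0 : 𝔼) 1, ‖(r : ℝ) • (θ : 𝔼)‖ = r := fun θ => by
    rw [norm_smul, norm_eq_of_mem_sphere, mul_one, Real.norm_eq_abs, abs_of_pos hr]
  simp only [hn, integral_const_mul, integral_const, smul_eq_mul]
  simp only [sphereMean, Real.sqrt_sq hr.le]
  field_simp

/-- Integrals of radial functions, as integrals over the half-line in the variable `|x|²`. -/
theorem exists_integral_radial (hd : 0 < d) :
    ∃ c : ℝ, 0 < c ∧ ∀ p : ℝ → ℝ, IsTest (Ioi 0) p →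
      ∫ x : 𝔼, p (‖x‖ ^ 2) = c * ∫ s, s ^ ((d : ℝ) / 2 - 1) * p s := by
  have : Nonempty (Fin d) := ⟨⟨0, hd⟩⟩
  have : Nontrivial 𝔼 := by infer_instance
  have hball : 0 < (volume : Measure 𝔼).real (Metric.ball 0 1) :=
    ENNReal.toReal_pos (Metric.measure_ball_pos _ _ one_pos).ne' measure_ball_lt_top.ne
  refine ⟨d * (volume : Measure 𝔼).real (Metric.ball 0 1) / 2, by positivity, fun p hp => ?_⟩
  have h1 := integral_fun_norm_addHaar (volume : Measure 𝔼) fun r => p (r ^ 2)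
  rw [h1]
  -- The substitution s = r² turns r^(d-1) dr into s^(d/2-1) ds / 2.
  have h2 := integral_comp_rpow_Ioi_of_pos (g := fun s => s ^ ((d : ℝ) / 2 - 1) * p s / 2)
    (two_pos : (0 : ℝ) < 2)
  have h3 : ∫ s in Ioi 0, s ^ ((d : ℝ) / 2 - 1) * p s / 2 =
      (∫ s, s ^ ((d : ℝ) / 2 - 1) * p s) / 2 := by
    rw [integral_div]
    congr 1
    exact setIntegral_eq_integral_of_forall_compl_eq_zero fun x hx => by simp [hp.eq_zero hx]
  have h4 : ∫ y in Ioi (0 : ℝ), y ^ (Module.finrank ℝ 𝔼 - 1) • p (y ^ 2) =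
      ∫ x in Ioi (0 : ℝ), (2 * x ^ ((2 : ℝ) - 1)) •
        ((x ^ (2 : ℝ)) ^ ((d : ℝ) / 2 - 1) * p (x ^ (2 : ℝ)) / 2) := by
    refine setIntegral_congr_fun measurableSet_Ioi fun y (hy : 0 < y) => ?_
    have e1 : (y ^ (2 : ℝ)) ^ ((d : ℝ) / 2 - 1) = y ^ ((d : ℝ) - 2) := by
      rw [← Real.rpow_mul hy.le]; congr 1; ring
    have e2 : y ^ (Module.finrank ℝ 𝔼 - 1) = y * y ^ ((d : ℝ) - 2) := by
      rw [finrank_euclideanSpace_fin, ← Real.rpow_natCast, Nat.cast_sub hd, mul_comm,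
        ← Real.rpow_add_one hy.ne']
      congr 1; push_cast; ring
    have e3 : y ^ ((2 : ℝ) - 1) = y := by norm_num
    simp only [smul_eq_mul]
    rw [e1, e2, e3, Real.rpow_two]
    ring
  rw [h4, h2, h3, finrank_euclideanSpace_fin]
  simp only [nsmul_eq_mul, smul_eq_mul]
  ring

/-- The reflection in a coordinate hyperplane. -/
def coordReflection (i : Fin d) : 𝔼 ≃ₗᵢ[ℝ] 𝔼 :=
  LinearIsometryEquiv.piLpCongrRight 2 fun j =>
    if j = i then LinearIsometryEquiv.neg ℝ else LinearIsometryEquiv.refl ℝ ℝ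

theorem coordReflection_self (i : Fin d) (x : 𝔼) : coordReflection i x i = -x i := by
  simp [coordReflection]

theorem coordReflection_of_ne {i j : Fin d} (h : j ≠ i) (x : 𝔼) :
    coordReflection i x j = x j := by
  simp [coordReflection, h]

theorem integral_eq_zero_of_coordReflection (i : Fin d) {u : 𝔼 → ℝ}
    (h : ∀ x, u (coordReflection i x) = -u x) : ∫ x, u x = 0 := by
  have h1 := (coordReflection i).measurePreserving.integral_comp
    (coordReflection i).toHomeomorph.measurableEmbedding u
  simp only [h, integral_neg] at h1
  linarith

theorem integral_coord_radial (i : Fin d) (p : ℝ → ℝ) : ∫ x : 𝔼, x i * p (‖x‖ ^ 2) = 0 :=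
  integral_eq_zero_of_coordReflection i fun x => by
    rw [LinearIsometryEquiv.norm_map, coordReflection_self]; ring

theorem integral_coord_mul_coord_radial {i j : Fin d} (hij : i ≠ j) (p : ℝ → ℝ) :
    ∫ x : 𝔼, x i * x j * p (‖x‖ ^ 2) = 0 :=
  integral_eq_zero_of_coordReflection i fun x => by
    rw [LinearIsometryEquiv.norm_map, coordReflection_self, coordReflection_of_ne hij.symm]; ring

/-- Transpositions of coordinates make the d integrals of this type equal, and their sum contains
|x|². -/
theorem integral_coord_sq_radial {p : ℝ → ℝ} (hp : IsTest (Ioi 0) p) (i : Fin d) :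
    ∫ x : 𝔼, x i * x i * p (‖x‖ ^ 2) = (d : ℝ)⁻¹ * ∫ x : 𝔼, ‖x‖ ^ 2 * p (‖x‖ ^ 2) := by
  have hd : 0 < d := i.pos
  have hsym : ∀ j, ∫ x : 𝔼, x j * x j * p (‖x‖ ^ 2) = ∫ x : 𝔼, x i * x i * p (‖x‖ ^ 2) := by
    intro j
    have h1 := (LinearIsometryEquiv.piLpCongrLeft 2 ℝ ℝ
      (Equiv.swap i j)).measurePreserving.integral_comp (LinearIsometryEquiv.piLpCongrLeft 2 ℝ ℝ
      (Equiv.swap i j)).toHomeomorph.measurableEmbedding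
      (fun x : 𝔼 => x i * x i * p (‖x‖ ^ 2))
    rw [← h1]
    refine integral_congr_ae (Eventually.of_forall fun x => ?_)
    simp only [LinearIsometryEquiv.norm_map]
    rw [LinearIsometryEquiv.piLpCongrLeft_apply]
    simp [Equiv.piCongrLeft'_apply]
  have hsum : ∑ j, ∫ x : 𝔼, x j * x j * p (‖x‖ ^ 2) = ∫ x : 𝔼, ‖x‖ ^ 2 * p (‖x‖ ^ 2) := by
    rw [← integral_finsetSum]
    · refine integral_congr_ae (Eventually.of_forall fun x => ?_)
      simp only
      rw [← Finset.sum_mul, EuclideanSpace.real_norm_sq_eq]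
      simp only [pow_two]
    · intro j _
      simpa only [mul_assoc] using ((hp.radial.coord_mul j).coord_mul j).integrable
  simp only [hsym, Finset.sum_const, Finset.card_univ, Fintype.card_fin, nsmul_eq_mul] at hsum
  rw [← hsum]
  field_simp

end Radial

/-! ### Orthogonality of the sectors for the weighted Dirichlet form -/

section Decomposition

variable {d : ℕ}

section Derivatives

variable {f g : EuclideanSpace ℝ (Fin d) → ℝ} {x : EuclideanSpace ℝ (Fin d)} {i : Fin d}

theorem pd_add (hf : DifferentiableAt ℝ f x) (hg : DifferentiableAt ℝ g x) :
    pd i (fun x => f x + g x) x = pd i f x + pd i g x := by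
  simp only [pd]; rw [fderiv_fun_add hf hg]; rfl

theorem pd_mul (hf : DifferentiableAt ℝ f x) (hg : DifferentiableAt ℝ g x) :
    pd i (fun x => f x * g x) x = f x * pd i g x + g x * pd i f x := by
  simp only [pd]; rw [fderiv_fun_mul hf hg]; simp

theorem pd_sum {ι : Type*} (s : Finset ι) {F : ι → EuclideanSpace ℝ (Fin d) → ℝ}
    (hF : ∀ k ∈ s, DifferentiableAt ℝ (F k) x) :
    pd i (fun x => ∑ k ∈ s, F k x) x = ∑ k ∈ s, pd i (F k) x := by
  simp only [pd]; rw [fderiv_fun_sum hF]; simp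

theorem pd_coord (i j : Fin d) (x : EuclideanSpace ℝ (Fin d)) : pd i (fun x : EuclideanSpace ℝ (Fin d) => x j) x = if i = j then 1 else 0 := by
  have h : HasFDerivAt (fun x : EuclideanSpace ℝ (Fin d) => x j) (EuclideanSpace.proj j : EuclideanSpace ℝ (Fin d) →L[ℝ] ℝ) x :=
    (EuclideanSpace.proj j : EuclideanSpace ℝ (Fin d) →L[ℝ] ℝ).hasFDerivAt
  rw [pd, h.fderiv]
  simp [eq_comm]

theorem differentiableAt_coord (j : Fin d) (x : EuclideanSpace ℝ (Fin d)) : DifferentiableAt ℝ (fun x : EuclideanSpace ℝ (Fin d) => x j) x :=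
  (contDiff_coord j).differentiable (by simp) x

theorem pd_radial {p : ℝ → ℝ} (hp : DifferentiableAt ℝ p (‖x‖ ^ 2)) (i : Fin d) :
    pd i (fun x : EuclideanSpace ℝ (Fin d) => p (‖x‖ ^ 2)) x = deriv p (‖x‖ ^ 2) * (2 * x i) := by
  have h1 := (hasStrictFDerivAt_norm_sq x).hasFDerivAt
  have h2 := hp.hasDerivAt.comp_hasFDerivAt x h1
  rw [pd, show fderiv ℝ (fun x : EuclideanSpace ℝ (Fin d) => p (‖x‖ ^ 2)) x = _ from h2.fderiv]
  simp [EuclideanSpace.inner_single_right]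

theorem IsTest.differentiableAt_radial {p : ℝ → ℝ} (hp : IsTest (Ioi 0) p) (x : EuclideanSpace ℝ (Fin d)) :
    DifferentiableAt ℝ (fun x : EuclideanSpace ℝ (Fin d) => p (‖x‖ ^ 2)) x := hp.radial.differentiable x

theorem integral_mul_pd {Ω Ω' : Set (EuclideanSpace ℝ (Fin d))} (hf : IsTest Ω f) (hg : IsTest Ω' g) (i : Fin d) :
    ∫ x, f x * pd i g x = -∫ x, pd i f x * g x := by
  have hf' := hf.mono (subset_univ _)
  have hg' := hg.mono (subset_univ _)
  exact integral_mul_fderiv_eq_neg_fderiv_mul_of_integrable ((hf'.pd i).mul hg').integrable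
    (hf'.mul (hg'.pd i)).integrable (hf'.mul hg').integrable (fun x _ => hf.differentiable x)
    fun x _ => hg.differentiable x

end Derivatives

/-- Smoothness of a weight on the open half-line. -/
def SmoothProfile (φ : ℝ → ℝ) : Prop := ∀ s ∈ Ioi (0 : ℝ), ContDiffAt ℝ ∞ φ s

theorem SmoothProfile.mul {φ ψ : ℝ → ℝ} (hφ : SmoothProfile φ) (hψ : SmoothProfile ψ) :
    SmoothProfile fun s => φ s * ψ s := fun s hs => (hφ s hs).mul (hψ s hs)

theorem IsTest.smoothProfile {p : ℝ → ℝ} (hp : IsTest (Ioi 0) p) : SmoothProfile p :=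
  fun _ _ => hp.contDiff.contDiffAt

theorem smoothProfile_id : SmoothProfile fun s => s := fun _ _ => contDiffAt_id

theorem smoothProfile_one_add_rpow (b : ℝ) : SmoothProfile fun s => (1 + s) ^ b := fun s hs => by
  have hs' : (0 : ℝ) < s := hs
  exact (contDiffAt_const.add contDiffAt_id).rpow_const_of_ne (by change (1 : ℝ) + s ≠ 0; positivity)

/-- Orthogonality to all radial functions. -/
def RadialOrth (u : EuclideanSpace ℝ (Fin d) → ℝ) : Prop :=
  ∀ φ : ℝ → ℝ, SmoothProfile φ → ∫ x, φ (‖x‖ ^ 2) * u x = 0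

/-- The weighted Dirichlet form. -/
def dirichletForm (w : ℝ → ℝ) (u v : EuclideanSpace ℝ (Fin d) → ℝ) : ℝ :=
  ∑ i, ∫ x, w (‖x‖ ^ 2) * (pd i u x * pd i v x)

/-- The combination `∑ xⱼ qⱼ(|x|²)`. -/
def linearPart (q : Fin d → ℝ → ℝ) (x : EuclideanSpace ℝ (Fin d)) : ℝ := ∑ j, x j * q j (‖x‖ ^ 2)

variable {p w : ℝ → ℝ} {q : Fin d → ℝ → ℝ} {u v f : EuclideanSpace ℝ (Fin d) → ℝ}

theorem IsTest.linearPart (hq : ∀ j, IsTest (Ioi 0) (q j)) :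
    IsTest ({0}ᶜ : Set (EuclideanSpace ℝ (Fin d))) (linearPart q) :=
  IsTest.sum _ fun j _ => (hq j).radial.coord_mul j

theorem sum_sq_coord (x : EuclideanSpace ℝ (Fin d)) : ∑ i, x i * x i = ‖x‖ ^ 2 := by
  rw [EuclideanSpace.real_norm_sq_eq]; simp only [pow_two]

theorem pd_linearPart (hq : ∀ j, IsTest (Ioi 0) (q j)) (i : Fin d) (x : EuclideanSpace ℝ (Fin d)) :
    pd i (linearPart q) x = q i (‖x‖ ^ 2) + 2 * x i * linearPart (fun j => deriv (q j)) x := by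
  have h := fun j => (hq j).differentiableAt_radial x
  rw [show linearPart q = fun x => ∑ j, x j * q j (‖x‖ ^ 2) from rfl,
    pd_sum _ fun j _ => (differentiableAt_coord j x).fun_mul (h j)]
  simp only [fun j => pd_mul (i := i) (differentiableAt_coord j x) (h j), pd_coord,
    fun j => pd_radial (x := x) ((hq j).differentiable _) i]
  rw [Finset.sum_add_distrib, linearPart, Finset.mul_sum, add_comm]
  congr 1
  · simp
  · exact Finset.sum_congr rfl fun j _ => by ring

theorem radialOrth_linearPart (hq : ∀ j, IsTest (Ioi 0) (q j)) :
    RadialOrth (linearPart (d := d) q) := by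
  intro φ hφ
  have : ∀ x : EuclideanSpace ℝ (Fin d), φ (‖x‖ ^ 2) * linearPart q x = ∑ j, x j * (φ (‖x‖ ^ 2) * q j (‖x‖ ^ 2)) :=
    fun x => by
      rw [linearPart, Finset.mul_sum]
      exact Finset.sum_congr rfl fun j _ => by ring
  simp only [this]
  rw [integral_finsetSum _ fun j _ => (((hq j).smooth_mul hφ).radial.coord_mul j).integrable]
  exact Finset.sum_eq_zero fun j _ => integral_coord_radial j fun s => φ s * q j s

/-- Integrate by parts: the divergence of the vector field p(|x|²) x is d p + 2 s p', again radial,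
and u is orthogonal to it. -/
theorem sum_integral_radial_mul_coord_mul_pd (hp : IsTest (Ioi 0) p) (hu : IsTest ({0}ᶜ) u)
    (h : RadialOrth u) : ∑ i, ∫ x, p (‖x‖ ^ 2) * (x i * pd i u x) = 0 := by
  have hPx : ∀ i, IsTest ({0}ᶜ : Set (EuclideanSpace ℝ (Fin d))) fun x => x i * p (‖x‖ ^ 2) := fun i => hp.radial.coord_mul i
  have h1 : ∀ i, ∫ x, p (‖x‖ ^ 2) * (x i * pd i u x) =
      -∫ x, (p (‖x‖ ^ 2) + 2 * deriv p (‖x‖ ^ 2) * (x i * x i)) * u x := fun i => by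
    have := integral_mul_pd (hPx i) hu i
    have e : ∀ x : EuclideanSpace ℝ (Fin d), pd i (fun x : EuclideanSpace ℝ (Fin d) => x i * p (‖x‖ ^ 2)) x =
        p (‖x‖ ^ 2) + 2 * deriv p (‖x‖ ^ 2) * (x i * x i) := fun x => by
      rw [pd_mul (differentiableAt_coord i x) (hp.differentiableAt_radial x), pd_coord,
        pd_radial (hp.differentiable _)]
      simp
      ring
    simp only [e] at this
    rw [← this]
    congr 1; ext x; ring
  simp only [h1]
  rw [Finset.sum_neg_distrib, neg_eq_zero, ← integral_finsetSum]
  · have hφ : SmoothProfile fun s => (d : ℝ) * p s + 2 * (s * deriv p s) := by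
      have hsp : IsTest (Ioi 0) fun s => s * deriv p s :=
        hp.deriv.smooth_mul fun _ _ => contDiffAt_id
      exact ((hp.const_mul _).add (hsp.const_mul 2)).smoothProfile
    rw [← h _ hφ]
    refine integral_congr_ae (Eventually.of_forall fun x => ?_)
    simp only
    rw [← Finset.sum_mul, Finset.sum_add_distrib, ← Finset.mul_sum, sum_sq_coord]
    simp
    left; ring
  · intro i _
    refine IsTest.integrable (Ω := {0}ᶜ) (IsTest.mul ?_ hu)
    refine hp.radial.add ?_
    have := ((hp.deriv.radial (d := d)).coord_mul i).coord_mul i |>.const_mul 2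
    convert this using 2
    ring

/-- The gradient of p(|x|²) is a radial multiple of x, so only the radial derivative x·∇u enters. -/
theorem dirichletForm_radial_left (hw : SmoothProfile w) (hp : IsTest (Ioi 0) p)
    (hu : IsTest ({0}ᶜ) u) (h : RadialOrth u) :
    dirichletForm w (fun x => p (‖x‖ ^ 2)) u = 0 := by
  have hP : IsTest (Ioi 0) fun s => 2 * (w s * deriv p s) := (hp.deriv.smooth_mul hw).const_mul 2
  rw [← sum_integral_radial_mul_coord_mul_pd hP hu h, dirichletForm]
  refine Finset.sum_congr rfl fun i _ => integral_congr_ae (Eventually.of_forall fun x => ?_)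
  simp only
  rw [pd_radial (hp.differentiable _)]
  ring

/-- The i-th derivative of ∑ xⱼ qⱼ is qᵢ + 2 xᵢ ∑ xⱼ qⱼ'. Integrating the first part against ∂ᵢu by
parts gives a radial multiple of xᵢ u. In the second part xⱼ is moved under the derivative, which
gives the radial derivative of xⱼ u minus a multiple of xⱼ u. All of these vanish by hypothesis. -/
theorem dirichletForm_linearPart_left (hw : SmoothProfile w) (hq : ∀ j, IsTest (Ioi 0) (q j))
    (hu : IsTest ({0}ᶜ) u) (h : ∀ j, RadialOrth fun x => x j * u x) :
    dirichletForm w (linearPart q) u = 0 := by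
  have hQ : ∀ j, IsTest (Ioi 0) fun s => w s * q j s := fun j => (hq j).smooth_mul hw
  have hR : ∀ j, IsTest (Ioi 0) fun s => 2 * (w s * deriv (q j) s) := fun j =>
    ((hq j).deriv.smooth_mul hw).const_mul 2
  have h1 : ∀ i, ∫ x, w (‖x‖ ^ 2) * q i (‖x‖ ^ 2) * pd i u x = 0 := fun i => by
    have := integral_mul_pd ((hQ i).radial (d := d)) hu i
    rw [this, neg_eq_zero]
    have hφ : SmoothProfile fun s => 2 * deriv (fun s => w s * q i s) s :=
      ((hQ i).deriv.const_mul 2).smoothProfile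
    rw [← h i _ hφ]
    refine integral_congr_ae (Eventually.of_forall fun x => ?_)
    simp only
    rw [pd_radial ((hQ i).differentiable _)]
    ring
  have h2 : ∀ j, ∑ i, ∫ x, 2 * (w (‖x‖ ^ 2) * deriv (q j) (‖x‖ ^ 2)) * (x i * (x j * pd i u x)) =
      0 := fun j => by
    have hA := sum_integral_radial_mul_coord_mul_pd (hR j) (hu.coord_mul j) (h j)
    have hB := h j _ (hR j).smoothProfile
    have e : ∀ i x, 2 * (w (‖x‖ ^ 2) * deriv (q j) (‖x‖ ^ 2)) * (x i * (x j * pd i u x)) =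
        2 * (w (‖x‖ ^ 2) * deriv (q j) (‖x‖ ^ 2)) * (x i * pd i (fun x => x j * u x) x) -
        if i = j then 2 * (w (‖x‖ ^ 2) * deriv (q j) (‖x‖ ^ 2)) * (x j * u x) else 0 :=
      fun i x => by
        rw [pd_mul (differentiableAt_coord j x) (hu.differentiable x), pd_coord]
        split_ifs with hij
        · subst hij; ring
        · ring
    have hI1 : ∀ i, Integrable fun x : EuclideanSpace ℝ (Fin d) => 2 * (w (‖x‖ ^ 2) * deriv (q j) (‖x‖ ^ 2)) *
        (x i * pd i (fun x => x j * u x) x) := fun i =>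
      ((hR j).radial.mul (((hu.coord_mul j).pd i).coord_mul i)).integrable
    have hI2 : ∀ i, Integrable fun x : EuclideanSpace ℝ (Fin d) => if i = j then
        2 * (w (‖x‖ ^ 2) * deriv (q j) (‖x‖ ^ 2)) * (x j * u x) else 0 := fun i => by
      by_cases hij : i = j
      · simp only [hij, if_true]
        exact ((hR j).radial.mul (hu.coord_mul j)).integrable
      · simp [hij]
    simp only [e]
    simp only [fun i => integral_sub (hI1 i) (hI2 i)]
    rw [Finset.sum_sub_distrib, hA, zero_sub, neg_eq_zero]
    refine Finset.sum_eq_zero fun i _ => ?_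
    by_cases hij : i = j
    · simp only [hij, if_true]; exact hB
    · simp [hij]
  rw [dirichletForm]
  have e : ∀ i, ∫ x, w (‖x‖ ^ 2) * (pd i (linearPart q) x * pd i u x) =
      (∫ x, w (‖x‖ ^ 2) * q i (‖x‖ ^ 2) * pd i u x) +
      ∑ j, ∫ x, 2 * (w (‖x‖ ^ 2) * deriv (q j) (‖x‖ ^ 2)) * (x i * (x j * pd i u x)) := fun i => by
    rw [← integral_finsetSum, ← integral_add]
    · refine integral_congr_ae (Eventually.of_forall fun x => ?_)
      simp only
      rw [pd_linearPart hq, linearPart, add_mul, mul_add, Finset.mul_sum, Finset.sum_mul,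
        Finset.mul_sum]
      congr 1
      · ring
      · exact Finset.sum_congr rfl fun j _ => by ring
    · exact ((hQ i).radial.mul (hu.pd i)).integrable
    · exact integrable_finsetSum _ fun j _ =>
        ((hR j).radial.mul (((hu.pd i).coord_mul j).coord_mul i)).integrable
    · exact fun j _ => ((hR j).radial.mul (((hu.pd i).coord_mul j).coord_mul i)).integrable
  simp only [e, h1, zero_add]
  rw [Finset.sum_comm]
  exact Finset.sum_eq_zero fun j _ => h2 j

theorem dirichletForm_sum_three (hw : SmoothProfile w) {a b c : EuclideanSpace ℝ (Fin d) → ℝ} (ha : IsTest ({0}ᶜ) a)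
    (hb : IsTest ({0}ᶜ) b) (hc : IsTest ({0}ᶜ) c) (hab : dirichletForm w a b = 0)
    (hac : dirichletForm w a c = 0) (hbc : dirichletForm w b c = 0) :
    dirichletForm w (fun x => a x + b x + c x) (fun x => a x + b x + c x) =
      dirichletForm w a a + dirichletForm w b b + dirichletForm w c c := by
  have hI : ∀ {u v : EuclideanSpace ℝ (Fin d) → ℝ}, IsTest ({0}ᶜ) u → IsTest ({0}ᶜ) v → ∀ i,
      Integrable fun x : EuclideanSpace ℝ (Fin d) => w (‖x‖ ^ 2) * (pd i u x * pd i v x) := fun hu hv i =>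
    (((hu.pd i).mul (hv.pd i)).radial_mul hw).integrable
  have e : ∀ i, ∫ x, w (‖x‖ ^ 2) * (pd i (fun x => a x + b x + c x) x *
      pd i (fun x => a x + b x + c x) x) =
      ((∫ x, w (‖x‖ ^ 2) * (pd i a x * pd i a x)) + (∫ x, w (‖x‖ ^ 2) * (pd i b x * pd i b x)) +
        ∫ x, w (‖x‖ ^ 2) * (pd i c x * pd i c x)) +
      2 * ((∫ x, w (‖x‖ ^ 2) * (pd i a x * pd i b x)) + (∫ x, w (‖x‖ ^ 2) * (pd i a x * pd i c x)) +
        ∫ x, w (‖x‖ ^ 2) * (pd i b x * pd i c x)) := fun i => by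
    have h1 := integral_linear_three (hI ha ha i) (hI hb hb i) (hI hc hc i) 1 1 1
    have h2 := integral_linear_three (hI ha hb i) (hI ha hc i) (hI hb hc i) 2 2 2
    have i1 : Integrable fun x => 1 * (w (‖x‖ ^ 2) * (pd i a x * pd i a x)) +
      1 * (w (‖x‖ ^ 2) * (pd i b x * pd i b x)) + 1 * (w (‖x‖ ^ 2) * (pd i c x * pd i c x)) :=
      (((hI ha ha i).const_mul 1).add ((hI hb hb i).const_mul 1)).add ((hI hc hc i).const_mul 1)
    have i2 : Integrable fun x => 2 * (w (‖x‖ ^ 2) * (pd i a x * pd i b x)) +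
      2 * (w (‖x‖ ^ 2) * (pd i a x * pd i c x)) + 2 * (w (‖x‖ ^ 2) * (pd i b x * pd i c x)) :=
      (((hI ha hb i).const_mul 2).add ((hI ha hc i).const_mul 2)).add ((hI hb hc i).const_mul 2)
    have h3 := integral_add i1 i2
    rw [h1, h2] at h3
    rw [show (∫ x, w (‖x‖ ^ 2) * (pd i (fun x => a x + b x + c x) x *
      pd i (fun x => a x + b x + c x) x)) = _ from
      (integral_congr_ae (Eventually.of_forall fun x => ?_)).trans h3]
    · ring
    · rw [pd_add ((ha.differentiable x).fun_add (hb.differentiable x)) (hc.differentiable x),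
        pd_add (ha.differentiable x) (hb.differentiable x)]
      ring
  simp only [dirichletForm] at hab hac hbc ⊢
  simp only [e]
  rw [Finset.sum_add_distrib, Finset.sum_add_distrib, Finset.sum_add_distrib, ← Finset.mul_sum,
    Finset.sum_add_distrib, Finset.sum_add_distrib, hab, hac, hbc]
  ring

/-- In the double sum the terms with j ≠ k vanish by reflection, and in the diagonal ones xⱼ²
averages to |x|²/d. -/
theorem integral_radial_mul_linearPart_mul (hw : SmoothProfile w)
    {r : Fin d → ℝ → ℝ} (hq : ∀ j, IsTest (Ioi 0) (q j)) (hr : ∀ j, IsTest (Ioi 0) (r j)) :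
    ∫ x : EuclideanSpace ℝ (Fin d), w (‖x‖ ^ 2) * (linearPart q x * linearPart r x) =
      ∑ j, (d : ℝ)⁻¹ * ∫ x : EuclideanSpace ℝ (Fin d), ‖x‖ ^ 2 * (w (‖x‖ ^ 2) * (q j (‖x‖ ^ 2) * r j (‖x‖ ^ 2))) := by
  have hT : ∀ j k, IsTest (Ioi 0) fun s => w s * (q j s * r k s) := fun j k =>
    ((hq j).mul (hr k)).smooth_mul hw
  have e : ∀ x : EuclideanSpace ℝ (Fin d), w (‖x‖ ^ 2) * (linearPart q x * linearPart r x) =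
      ∑ j, ∑ k, x j * x k * (w (‖x‖ ^ 2) * (q j (‖x‖ ^ 2) * r k (‖x‖ ^ 2))) := fun x => by
    rw [linearPart, linearPart, Finset.sum_mul_sum, Finset.mul_sum]
    refine Finset.sum_congr rfl fun j _ => ?_
    rw [Finset.mul_sum]
    exact Finset.sum_congr rfl fun k _ => by ring
  have hI : ∀ j k, Integrable fun x : EuclideanSpace ℝ (Fin d) =>
      x j * x k * (w (‖x‖ ^ 2) * (q j (‖x‖ ^ 2) * r k (‖x‖ ^ 2))) := fun j k => by
    simpa only [mul_assoc] using (((hT j k).radial.coord_mul k).coord_mul j).integrable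
  simp only [e]
  rw [integral_finsetSum _ fun j _ => integrable_finsetSum _ fun k _ => hI j k]
  refine Finset.sum_congr rfl fun j _ => ?_
  rw [integral_finsetSum _ fun k _ => hI j k, Finset.sum_eq_single j]
  · exact integral_coord_sq_radial (hT j j) j
  · exact fun k _ hk => integral_coord_mul_coord_radial hk.symm fun s => w s * (q j s * r k s)
  · simp

theorem dirichletForm_radial_self (hw : SmoothProfile w) (hp : IsTest (Ioi 0) p) :
    dirichletForm w (fun x : EuclideanSpace ℝ (Fin d) => p (‖x‖ ^ 2)) (fun x => p (‖x‖ ^ 2)) =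
      4 * ∫ x : EuclideanSpace ℝ (Fin d), ‖x‖ ^ 2 * (w (‖x‖ ^ 2) * deriv p (‖x‖ ^ 2) ^ 2) := by
  have hT : IsTest (Ioi 0) fun s => w s * deriv p s ^ 2 := hp.deriv.sq.smooth_mul hw
  rw [dirichletForm, ← integral_finsetSum, ← integral_const_mul]
  · refine integral_congr_ae (Eventually.of_forall fun x => ?_)
    have e : ∀ i : Fin d, w (‖x‖ ^ 2) * (pd i (fun x => p (‖x‖ ^ 2)) x *
        pd i (fun x => p (‖x‖ ^ 2)) x) = 4 * w (‖x‖ ^ 2) * deriv p (‖x‖ ^ 2) ^ 2 * (x i * x i) :=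
      fun i => by rw [pd_radial (hp.differentiable _)]; ring
    simp only [e]
    rw [← Finset.mul_sum, sum_sq_coord]
    ring
  · exact fun i _ => (((hp.radial.pd i).mul (hp.radial.pd i)).radial_mul hw).integrable

/-- Pointwise, with L = ∑ xⱼ qⱼ and L' = ∑ xⱼ qⱼ', the squared gradient is ∑ qⱼ² + 4 L L' + 4|x|²
L'². The products of L and L' are then integrated as above, so the components decouple. -/
theorem dirichletForm_linearPart_self (hw : SmoothProfile w)
    (hq : ∀ j, IsTest (Ioi 0) (q j)) :
    dirichletForm w (linearPart (d := d) q) (linearPart q) =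
      ∑ j, ((∫ x : EuclideanSpace ℝ (Fin d), w (‖x‖ ^ 2) * q j (‖x‖ ^ 2) ^ 2) +
        4 * (d : ℝ)⁻¹ * (∫ x : EuclideanSpace ℝ (Fin d), ‖x‖ ^ 2 *
          (w (‖x‖ ^ 2) * (q j (‖x‖ ^ 2) * deriv (q j) (‖x‖ ^ 2)))) +
        4 * (d : ℝ)⁻¹ * ∫ x : EuclideanSpace ℝ (Fin d), ‖x‖ ^ 2 *
          (‖x‖ ^ 2 * w (‖x‖ ^ 2) * (deriv (q j) (‖x‖ ^ 2) * deriv (q j) (‖x‖ ^ 2)))) := by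
  have hq' := fun j => (hq j).deriv
  have hsw : SmoothProfile fun s => s * w s := smoothProfile_id.mul hw
  have h2 := integral_radial_mul_linearPart_mul hw hq hq'
  have h3 := integral_radial_mul_linearPart_mul hsw hq' hq'
  have hL := IsTest.linearPart hq
  have hL' := IsTest.linearPart hq'
  have hIq : Integrable fun x : EuclideanSpace ℝ (Fin d) => ∑ j, w (‖x‖ ^ 2) * q j (‖x‖ ^ 2) ^ 2 :=
    integrable_finsetSum _ fun j _ => (((hq j).sq.smooth_mul hw).radial).integrable
  have e : dirichletForm w (linearPart (d := d) q) (linearPart q) =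
      ∫ x : EuclideanSpace ℝ (Fin d), (1 * (∑ j, w (‖x‖ ^ 2) * q j (‖x‖ ^ 2) ^ 2) +
        4 * (w (‖x‖ ^ 2) * (linearPart q x * linearPart (fun j => deriv (q j)) x)) +
        4 * (‖x‖ ^ 2 * w (‖x‖ ^ 2) * (linearPart (fun j => deriv (q j)) x *
          linearPart (fun j => deriv (q j)) x))) := by
    rw [dirichletForm, ← integral_finsetSum]
    · refine integral_congr_ae (Eventually.of_forall fun x => ?_)
      simp only [pd_linearPart hq]
      set G := linearPart (fun j => deriv (q j)) x
      have e1 : ∀ i, w (‖x‖ ^ 2) * ((q i (‖x‖ ^ 2) + 2 * x i * G) * (q i (‖x‖ ^ 2) + 2 * x i * G)) =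
          w (‖x‖ ^ 2) * q i (‖x‖ ^ 2) ^ 2 + 4 * w (‖x‖ ^ 2) * G * (x i * q i (‖x‖ ^ 2)) +
            4 * w (‖x‖ ^ 2) * G * G * (x i * x i) := fun i => by ring
      simp only [e1]
      rw [Finset.sum_add_distrib, Finset.sum_add_distrib, ← Finset.mul_sum, ← Finset.mul_sum,
        ← Finset.mul_sum, sum_sq_coord, linearPart]
      ring
    · exact fun i _ => (((hL.pd i).mul (hL.pd i)).radial_mul hw).integrable
  rw [e, integral_linear_three hIq ((hL.mul hL').radial_mul hw).integrable
    ((hL'.mul hL').radial_mul hsw).integrable, h2, h3, one_mul,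
    integral_finsetSum _ fun j _ => (((hq j).sq.smooth_mul hw).radial).integrable,
    Finset.sum_add_distrib, Finset.sum_add_distrib, Finset.mul_sum, Finset.mul_sum]
  simp only [mul_assoc]

end Decomposition

/-! ### The gap in each sector -/

section Gap

variable {d : ℕ} {p : ℝ → ℝ} {q : Fin d → ℝ → ℝ} {f u : EuclideanSpace ℝ (Fin d) → ℝ} {α δ : ℝ}

/-- The point is that a single constant c serves all k, β and g, and so drops out of every
inequality. -/
theorem exists_integral_radial_weight (hd : 0 < d) :
    ∃ c : ℝ, 0 < c ∧ ∀ (k : ℕ) (β : ℝ) (g : ℝ → ℝ), IsTest (Ioi 0) g →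
      ∫ x : EuclideanSpace ℝ (Fin d), (‖x‖ ^ 2) ^ k * ((1 + ‖x‖ ^ 2) ^ β * g (‖x‖ ^ 2)) =
        c * ∫ s, radialWeight ((d : ℝ) / 2 - 1 + k) β s * g s := by
  obtain ⟨c, hc, h⟩ := exists_integral_radial hd
  refine ⟨c, hc, fun k β g hg => ?_⟩
  rw [h (fun s => s ^ k * ((1 + s) ^ β * g s))
    ((hg.smooth_mul (smoothProfile_one_add_rpow β)).smooth_mul fun _ _ => by fun_prop)]
  congr 2
  ext s
  by_cases hs : s ∈ Ioi (0 : ℝ)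
  · have hs' : 0 < s := hs
    rw [radialWeight, Real.rpow_add hs', Real.rpow_natCast]
    ring
  · simp [hg.eq_zero hs]

/-- The two-step gap with A = d/2 and B = α. The factor 4 comes from |∇p(|x|²)|² = 4 s p'². -/
theorem gap_radial (hd : 0 < d) (hH : RadialHardy ((d : ℝ) / 2 + 2) (α + 2) δ)
    (hpos : 0 ≤ δ - ((d : ℝ) / 2 + α + 2)) (hpos' : 0 ≤ δ - 2 * ((d : ℝ) / 2 + α + 1))
    (hp : IsTest (Ioi 0) p)
    (h0 : ∫ x : EuclideanSpace ℝ (Fin d), (1 + ‖x‖ ^ 2) ^ (α - 1) * p (‖x‖ ^ 2) = 0)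
    (h1 : ∫ x : EuclideanSpace ℝ (Fin d),
      ‖x‖ ^ 2 * ((1 + ‖x‖ ^ 2) ^ (α - 1) * p (‖x‖ ^ 2)) = 0) :
    4 * (δ - 2 * ((d : ℝ) / 2 + α + 1)) *
      ∫ x : EuclideanSpace ℝ (Fin d), (1 + ‖x‖ ^ 2) ^ (α - 1) * p (‖x‖ ^ 2) ^ 2 ≤
      dirichletForm (fun s => (1 + s) ^ α) (fun x : EuclideanSpace ℝ (Fin d) => p (‖x‖ ^ 2))
        (fun x => p (‖x‖ ^ 2)) := by
  obtain ⟨c, hc, h⟩ := exists_integral_radial_weight hd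
  rw [dirichletForm_radial_self (smoothProfile_one_add_rpow α) hp]
  have e0 := h 0 (α - 1) p hp
  have e1 := h 1 (α - 1) p hp
  have e2 := h 0 (α - 1) _ hp.sq
  have e3 := h 1 α _ hp.deriv.sq
  simp only [pow_zero, one_mul, pow_one, Nat.cast_zero, Nat.cast_one, add_zero,
    sub_add_cancel] at e0 e1 e2 e3
  rw [e2, e3]
  have z0 := (mul_eq_zero.1 (e0.symm.trans h0)).resolve_left hc.ne'
  have z1 := (mul_eq_zero.1 (e1.symm.trans h1)).resolve_left hc.ne'
  have z1' : ∫ s, radialWeight ((d : ℝ) / 2 - 1) (α - 1) s * (s * p s) = 0 := by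
    rw [← z1]
    congr 1
    ext s
    by_cases hs : s ∈ Ioi (0 : ℝ)
    · rw [← mul_assoc, radialWeight_mul_self hs]
    · simp [hp.eq_zero hs]
  have := radial_gap_two hH hpos hpos' hp z0 z1'
  nlinarith [mul_le_mul_of_nonneg_left this hc.le]

/-- Here a stands for d/2. Integrating the derivative of s^a (1+s)^α p²/a collapses the first two
terms on the right into -2α times the norm, and the last term is bounded below by the one-step gap
with A = a+1 and B = α. -/
theorem gap_linearPart_component {a c : ℝ} (ha : 0 < a) (hc : 0 < c)
    (hH : RadialHardy (a + 2) (α + 1) δ) (hpos : 0 ≤ δ - (a + 1 + α)) (hp : IsTest (Ioi 0) p)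
    (h0 : ∫ s, radialWeight a (α - 1) s * p s = 0) :
    (-2 * α + 4 * (δ - (a + 1 + α))) * ((2 * a)⁻¹ * (c * ∫ s, radialWeight a (α - 1) s * p s ^ 2)) ≤
      c * (∫ s, radialWeight (a - 1) α s * p s ^ 2) +
      4 * (2 * a)⁻¹ * (c * ∫ s, radialWeight a α s * (p s * deriv p s)) +
      4 * (2 * a)⁻¹ * (c * ∫ s, radialWeight (a + 1) α s * deriv p s ^ 2) := by
  have hgap := radial_gap_one (A := a + 1) (B := α) (δ := δ)
    (by rwa [show a + 1 + 1 = a + 2 by ring]) hpos hp (by simpa using h0)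
  rw [add_sub_cancel_right] at hgap
  have hI1 := (hp.sq.radialWeight_mul (a - 1) α).integrable (μ := volume)
  have hI2 := ((hp.mul hp.deriv).radialWeight_mul a α).integrable (μ := volume)
  have hI3 := (hp.sq.radialWeight_mul a (α - 1)).integrable (μ := volume)
  have hT : IsTest (Ioi 0) fun s => radialWeight a α s * (a⁻¹ * p s ^ 2) :=
    (hp.sq.const_mul _).radialWeight_mul _ _
  have hl := integral_linear_three hI1 hI2 hI3 1 (2 * a⁻¹) (α * a⁻¹)
  have hz : ∫ s, (1 * (radialWeight (a - 1) α s * p s ^ 2) +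
      2 * a⁻¹ * (radialWeight a α s * (p s * deriv p s)) +
      α * a⁻¹ * (radialWeight a (α - 1) s * p s ^ 2)) = 0 := by
    refine hT.integral_eq_zero_of_hasDerivAt (fun s hs => ?_) fun s hs => ?_
    · have hs' : 0 < s := hs
      refine ((hasDerivAt_radialWeight a α hs).fun_mul
        (((hp.hasDerivAt s).fun_pow 2).const_mul a⁻¹)).congr_deriv ?_
      rw [← radialWeight_mul_self (A := a) (B := α) hs]
      have e : radialWeight (a - 1) α s = radialWeight (a - 1) (α - 1) s * (1 + s) := by
        simp only [radialWeight]
        rw [Real.rpow_sub_one (by positivity : (1 : ℝ) + s ≠ 0)]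
        field_simp
      rw [e]
      push_cast
      field_simp
      ring
    · simp [hp.eq_zero hs]
  rw [hz] at hl
  set X := ∫ s, radialWeight a (α - 1) s * p s ^ 2
  set Y := ∫ s, radialWeight (a - 1) α s * p s ^ 2
  set Z := ∫ s, radialWeight a α s * (p s * deriv p s)
  set V := ∫ s, radialWeight (a + 1) α s * deriv p s ^ 2
  have hca : 0 ≤ c * (2 * a⁻¹) := by positivity
  have e : c * Y + 4 * (2 * a)⁻¹ * (c * Z) = -c * α * a⁻¹ * X := by
    have : Y = -(2 * a⁻¹ * Z) - α * a⁻¹ * X := by linarith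
    rw [this]; field_simp; ring
  rw [e]
  have h2 := mul_le_mul_of_nonneg_left hgap hca
  have e3 : 4 * (2 * a)⁻¹ * (c * V) = c * (2 * a⁻¹) * V := by field_simp; ring
  have e4 : (-2 * α + 4 * (δ - (a + 1 + α))) * ((2 * a)⁻¹ * (c * X)) =
      -c * α * a⁻¹ * X + c * (2 * a⁻¹) * ((δ - (a + 1 + α)) * X) := by field_simp; ring
  rw [e3, e4]
  linarith

theorem gap_linearPart (hd : 0 < d) (hH : RadialHardy ((d : ℝ) / 2 + 2) (α + 1) δ)
    (hpos : 0 ≤ δ - ((d : ℝ) / 2 + 1 + α)) (hq : ∀ j, IsTest (Ioi 0) (q j))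
    (h0 : ∀ j, ∫ x : EuclideanSpace ℝ (Fin d),
      ‖x‖ ^ 2 * ((1 + ‖x‖ ^ 2) ^ (α - 1) * q j (‖x‖ ^ 2)) = 0) :
    (-2 * α + 4 * (δ - ((d : ℝ) / 2 + 1 + α))) *
      ∫ x : EuclideanSpace ℝ (Fin d), (1 + ‖x‖ ^ 2) ^ (α - 1) *
        (linearPart q x * linearPart q x) ≤
      dirichletForm (fun s => (1 + s) ^ α) (linearPart (d := d) q) (linearPart q) := by
  obtain ⟨c, hc, h⟩ := exists_integral_radial_weight hd
  have hd' : (0 : ℝ) < d := by exact_mod_cast hd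
  rw [dirichletForm_linearPart_self (smoothProfile_one_add_rpow α) hq,
    integral_radial_mul_linearPart_mul (smoothProfile_one_add_rpow (α - 1)) hq hq, Finset.mul_sum]
  refine Finset.sum_le_sum fun j _ => ?_
  have e0 := h 1 (α - 1) _ (hq j)
  have e1 := h 1 (α - 1) _ ((hq j).mul (hq j))
  have e2 := h 0 α _ (hq j).sq
  have e3 := h 1 α _ ((hq j).mul (hq j).deriv)
  have e4 := h 2 α _ ((hq j).deriv.mul (hq j).deriv)
  simp only [pow_zero, one_mul, pow_one, Nat.cast_zero, Nat.cast_one, add_zero,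
    sub_add_cancel] at e0 e1 e2 e3
  have hsq : ∀ x : EuclideanSpace ℝ (Fin d), ‖x‖ ^ 2 * (‖x‖ ^ 2 * (1 + ‖x‖ ^ 2) ^ α *
      (deriv (q j) (‖x‖ ^ 2) * deriv (q j) (‖x‖ ^ 2))) = (‖x‖ ^ 2) ^ 2 * ((1 + ‖x‖ ^ 2) ^ α *
      (deriv (q j) (‖x‖ ^ 2) * deriv (q j) (‖x‖ ^ 2))) := fun x => by ring
  simp only [hsq]
  rw [e1, e2, e3, e4, show (d : ℝ) / 2 - 1 + (2 : ℕ) = (d : ℝ) / 2 + 1 by push_cast; ring]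
  have z0 := (mul_eq_zero.1 (e0.symm.trans (h0 j))).resolve_left hc.ne'
  have := gap_linearPart_component (a := (d : ℝ) / 2) (by positivity) hc hH hpos (hq j) z0
  rw [show 2 * ((d : ℝ) / 2) = d by ring] at this
  simpa only [pow_two] using this

theorem gap_of_radialOrth (hα : α < 0) (hu : IsTest ({0}ᶜ) u) (h0 : RadialOrth u)
    (h1 : ∀ j, RadialOrth fun x => x j * u x) :
    -4 * α * ∫ x, (1 + ‖x‖ ^ 2) ^ (α - 1) * u x ^ 2 ≤
      dirichletForm (fun s => (1 + s) ^ α) u u := by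
  have hexp : ∀ t : ℝ, SmoothProfile fun s => Real.exp (-t * s) := fun t _ _ =>
    (contDiff_const.mul contDiff_id).exp.contDiffAt
  have := gap_of_orthogonal_gaussians (b := -α) (by linarith) (hu.mono (subset_univ _))
    (fun t _ => h0 _ (hexp t)) fun t _ i => h1 i _ (hexp t)
  simp only [neg_neg] at this
  rw [dirichletForm]
  simp only [← pow_two]
  convert this using 1
  ring

theorem integral_radial_mul_mul_linearPart {w : ℝ → ℝ} (hw : SmoothProfile w)
    (hq : ∀ j, IsTest (Ioi 0) (q j)) (hu : IsTest ({0}ᶜ) u)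
    (h : ∀ j, RadialOrth fun x => x j * u x) :
    ∫ x, w (‖x‖ ^ 2) * (linearPart q x * u x) = 0 := by
  have e : ∀ x, w (‖x‖ ^ 2) * (linearPart q x * u x) =
      ∑ j, w (‖x‖ ^ 2) * q j (‖x‖ ^ 2) * (x j * u x) := fun x => by
    rw [linearPart, Finset.sum_mul, Finset.mul_sum]
    exact Finset.sum_congr rfl fun j _ => by ring
  simp only [e]
  rw [integral_finsetSum _ fun j _ =>
    (((hq j).smooth_mul hw).radial.mul (hu.coord_mul j)).integrable]
  exact Finset.sum_eq_zero fun j _ => h j _ ((hq j).smooth_mul hw).smoothProfile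

/-- Decomposition into a radial part, a linear part and a remainder orthogonal to both. -/
theorem exists_sector_decomposition (hd : 0 < d) (hf : IsTest ({0}ᶜ) f) :
    ∃ (p : ℝ → ℝ) (q : Fin d → ℝ → ℝ) (h : EuclideanSpace ℝ (Fin d) → ℝ), IsTest (Ioi 0) p ∧
      (∀ j, IsTest (Ioi 0) (q j)) ∧ IsTest ({0}ᶜ) h ∧ RadialOrth h ∧
      (∀ j, RadialOrth fun x => x j * h x) ∧
      (f = fun x => p (‖x‖ ^ 2) + linearPart q x + h x) ∧
      (∀ φ, SmoothProfile φ → ∫ x : EuclideanSpace ℝ (Fin d), φ (‖x‖ ^ 2) * p (‖x‖ ^ 2) =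
        ∫ x, φ (‖x‖ ^ 2) * f x) ∧
      ∀ j φ, SmoothProfile φ → ∫ x : EuclideanSpace ℝ (Fin d),
        ‖x‖ ^ 2 * (φ (‖x‖ ^ 2) * q j (‖x‖ ^ 2)) = d * ∫ x, φ (‖x‖ ^ 2) * (x j * f x) := by
  have hd' : (d : ℝ) ≠ 0 := by exact_mod_cast hd.ne'
  have hp := hf.sphereMean
  have hxf := fun j => hf.coord_mul j
  -- The factor d/s normalises the coefficient, since xⱼ² has mean s/d on the sphere |x|² = s.
  have hq : ∀ j, IsTest (Ioi 0) fun s => d * s⁻¹ * sphereMean (fun x => x j * f x) s := fun j =>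
    (hxf j).sphereMean.smooth_mul fun s hs =>
      contDiffAt_const.mul (contDiffAt_inv ℝ (ne_of_gt hs))
  have hL := IsTest.linearPart hq
  have hpφ : ∀ φ, SmoothProfile φ →
      ∫ x : EuclideanSpace ℝ (Fin d), φ (‖x‖ ^ 2) * sphereMean f (‖x‖ ^ 2) =
        ∫ x, φ (‖x‖ ^ 2) * f x := fun φ hφ => (integral_radial_mul_sphereMean hd hf hφ).symm
  have hqφ : ∀ j φ, SmoothProfile φ → ∫ x : EuclideanSpace ℝ (Fin d), ‖x‖ ^ 2 * (φ (‖x‖ ^ 2) *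
      (d * (‖x‖ ^ 2)⁻¹ * sphereMean (fun x => x j * f x) (‖x‖ ^ 2))) =
      d * ∫ x, φ (‖x‖ ^ 2) * (x j * f x) := fun j φ hφ => by
    rw [integral_radial_mul_sphereMean hd (hxf j) hφ, ← integral_const_mul]
    refine integral_congr_ae (Eventually.of_forall fun x => ?_)
    simp only
    by_cases hx : ‖x‖ ^ 2 = 0
    · rw [hx, (hxf j).sphereMean.eq_zero (by simp)]; simp
    · rw [show ∀ a b c e : ℝ, a * (b * (c * a⁻¹ * e)) = a * a⁻¹ * (c * (b * e)) by
        intros; ring, mul_inv_cancel₀ hx, one_mul]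
  refine ⟨sphereMean f, _, fun x => f x - sphereMean f (‖x‖ ^ 2) - linearPart _ x, hp, hq,
    (hf.sub hp.radial).sub hL, ?_, ?_, ?_, hpφ, hqφ⟩
  · intro φ hφ
    have := integral_linear_three (hf.radial_mul hφ).integrable
      (hp.radial.radial_mul hφ).integrable (hL.radial_mul hφ).integrable 1 (-1) (-1) (μ := volume)
    rw [hpφ φ hφ, radialOrth_linearPart hq φ hφ] at this
    refine Eq.trans (integral_congr_ae (Eventually.of_forall fun x => ?_)) (this.trans (by ring))
    simp only
    ring
  · intro j φ hφ
    have := integral_linear_three ((hf.coord_mul j).radial_mul hφ).integrable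
      ((hp.radial.coord_mul j).radial_mul hφ).integrable
      ((hL.coord_mul j).radial_mul hφ).integrable 1 (-1) (-1) (μ := volume)
    have z1 : ∫ x : EuclideanSpace ℝ (Fin d), φ (‖x‖ ^ 2) * (x j * sphereMean f (‖x‖ ^ 2)) = 0 := by
      rw [← integral_coord_radial j fun s => φ s * sphereMean f s]
      refine integral_congr_ae (Eventually.of_forall fun x => ?_)
      simp only
      ring
    have hT : ∀ k, IsTest (Ioi 0) fun s => φ s * (d * s⁻¹ * sphereMean (fun x => x k * f x) s) :=
      fun k => (hq k).smooth_mul hφ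
    have z2 : ∫ x : EuclideanSpace ℝ (Fin d), φ (‖x‖ ^ 2) * (x j * linearPart
        (fun j s => d * s⁻¹ * sphereMean (fun x => x j * f x) s) x) =
        ∫ x, φ (‖x‖ ^ 2) * (x j * f x) := by
      have e : ∀ x : EuclideanSpace ℝ (Fin d), φ (‖x‖ ^ 2) * (x j * linearPart
        (fun j s => d * s⁻¹ * sphereMean (fun x => x j * f x) s) x) = ∑ k, x j * x k *
        (φ (‖x‖ ^ 2) * (d * (‖x‖ ^ 2)⁻¹ * sphereMean (fun x => x k * f x) (‖x‖ ^ 2))) := fun x => by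
        rw [linearPart, Finset.mul_sum, Finset.mul_sum]
        exact Finset.sum_congr rfl fun k _ => by ring
      simp only [e]
      rw [integral_finsetSum, Finset.sum_eq_single j]
      · rw [integral_coord_sq_radial (hT j) j, hqφ j φ hφ, inv_mul_cancel_left₀ hd']
      · exact fun k _ hk => integral_coord_mul_coord_radial hk.symm
          fun s => φ s * (d * s⁻¹ * sphereMean (fun x => x k * f x) s)
      · simp
      · intro k _
        simpa only [mul_assoc] using (((hT k).radial.coord_mul k).coord_mul j).integrable
    rw [z1, z2] at this
    refine Eq.trans (integral_congr_ae (Eventually.of_forall fun x => ?_)) (this.trans (by ring))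
    simp only
    ring
  · ext x
    ring

/-- Cross terms vanish in the norm and in the energy, so Λ only has to lie below the three sector
constants. The constant δ₁ serves the linear sector and δ₂ the radial one. The moments against 1 and
|x|² constrain only the radial part, those against the coordinates only the linear part. -/
theorem gap_of_isTest (hd : 0 < d) (hα : α < 0) {δ₁ δ₂ Λ : ℝ}
    (H₁ : RadialHardy ((d : ℝ) / 2 + 2) (α + 1) δ₁) (hδ₁ : 0 ≤ δ₁ - ((d : ℝ) / 2 + 1 + α))
    (H₂ : RadialHardy ((d : ℝ) / 2 + 2) (α + 2) δ₂) (hδ₂ : 0 ≤ δ₂ - ((d : ℝ) / 2 + α + 2))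
    (hδ₂' : 0 ≤ δ₂ - 2 * ((d : ℝ) / 2 + α + 1))
    (hΛ₀ : Λ ≤ 4 * (δ₂ - 2 * ((d : ℝ) / 2 + α + 1)))
    (hΛ₁ : Λ ≤ -2 * α + 4 * (δ₁ - ((d : ℝ) / 2 + 1 + α))) (hΛ₂ : Λ ≤ -4 * α)
    (hf : IsTest ({0}ᶜ) f) (h0 : ∫ x, (1 + ‖x‖ ^ 2) ^ (α - 1) * f x = 0)
    (h1 : ∀ j, ∫ x, (1 + ‖x‖ ^ 2) ^ (α - 1) * (x j * f x) = 0)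
    (h2 : ∫ x, (1 + ‖x‖ ^ 2) ^ (α - 1) * (‖x‖ ^ 2 * f x) = 0) :
    Λ * ∫ x, (1 + ‖x‖ ^ 2) ^ (α - 1) * f x ^ 2 ≤ dirichletForm (fun s => (1 + s) ^ α) f f := by
  obtain ⟨p, q, h, hp, hq, hh, ho, hox, rfl, hpφ, hqφ⟩ := exists_sector_decomposition hd hf
  have hw := smoothProfile_one_add_rpow α
  have hw' := smoothProfile_one_add_rpow (α - 1)
  have hL := IsTest.linearPart hq
  have hP := hp.radial (d := d)
  have hLo := radialOrth_linearPart hq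
  rw [dirichletForm_sum_three hw hP hL hh (dirichletForm_radial_left hw hp hL hLo)
    (dirichletForm_radial_left hw hp hh ho) (dirichletForm_linearPart_left hw hq hh hox)]
  have z1 := hLo _ (hp.smooth_mul hw').smoothProfile
  have z2 := ho _ (hp.smooth_mul hw').smoothProfile
  have z3 := integral_radial_mul_mul_linearPart hw' hq hh hox
  have i1 := integral_linear_three (hP.sq.radial_mul hw').integrable
    ((hL.mul hL).radial_mul hw').integrable (hh.sq.radial_mul hw').integrable 1 1 1 (μ := volume)
  have hi1 := (((hP.sq.radial_mul hw').const_mul 1).add (((hL.mul hL).radial_mul hw').const_mul 1)).add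
    ((hh.sq.radial_mul hw').const_mul 1) |>.integrable (μ := volume)
  have t1 := hL.radial_mul (hp.smooth_mul hw').smoothProfile
  have t2 := hh.radial_mul (hp.smooth_mul hw').smoothProfile
  have t3 := (hL.mul hh).radial_mul hw'
  have i2 := integral_linear_three t1.integrable t2.integrable t3.integrable 2 2 2 (μ := volume)
  have hi2 := ((t1.const_mul 2).add (t2.const_mul 2)).add (t3.const_mul 2) |>.integrable
    (μ := volume)
  have hN := integral_add hi1 hi2
  rw [i1, i2, z1, z2, z3] at hN
  have hN' : ∫ x : EuclideanSpace ℝ (Fin d), (1 + ‖x‖ ^ 2) ^ (α - 1) *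
      (p (‖x‖ ^ 2) + linearPart q x + h x) ^ 2 =
      (∫ x : EuclideanSpace ℝ (Fin d), (1 + ‖x‖ ^ 2) ^ (α - 1) * p (‖x‖ ^ 2) ^ 2) +
      (∫ x : EuclideanSpace ℝ (Fin d), (1 + ‖x‖ ^ 2) ^ (α - 1) *
        (linearPart q x * linearPart q x)) + ∫ x, (1 + ‖x‖ ^ 2) ^ (α - 1) * h x ^ 2 := by
    refine Eq.trans (integral_congr_ae (Eventually.of_forall fun x => ?_)) (hN.trans (by ring))
    simp only
    ring
  have hnn : ∀ g : EuclideanSpace ℝ (Fin d) → ℝ, 0 ≤ ∫ x, (1 + ‖x‖ ^ 2) ^ (α - 1) * g x ^ 2 :=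
    fun g => integral_nonneg fun x => by positivity
  have g0 := gap_radial hd H₂ hδ₂ hδ₂' hp ((hpφ _ hw').trans h0) (by
    have := hpφ _ (hw'.mul smoothProfile_id)
    simp only [mul_assoc] at this
    rw [h2] at this
    rw [← this]
    refine integral_congr_ae (Eventually.of_forall fun x => ?_)
    simp only
    ring)
  have g1 := gap_linearPart hd H₁ hδ₁ hq fun j => by rw [hqφ j _ hw', h1 j, mul_zero]
  have g2 := gap_of_radialOrth hα hh ho hox
  have n0 := mul_le_mul_of_nonneg_right hΛ₀ (hnn fun x => p (‖x‖ ^ 2))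
  have n1 := mul_le_mul_of_nonneg_right hΛ₁ (hnn (linearPart q))
  have n2 := mul_le_mul_of_nonneg_right hΛ₂ (hnn h)
  simp only [pow_two (linearPart q _)] at n1
  rw [hN']
  linarith

end Gap

/-! ### Square integrable functions and the weighted measures -/

section InnerMemLp

variable {X H : Type*} [MeasurableSpace X] {μ : Measure X} [NormedAddCommGroup H]
  [InnerProductSpace ℝ H] {f g : X → H}

theorem integrable_inner_of_memLp (hf : MemLp f 2 μ) (hg : MemLp g 2 μ) :
    Integrable (fun x => ⟪f x, g x⟫) μ := by
  refine (L2.integrable_inner (𝕜 := ℝ) (hf.toLp f) (hg.toLp g)).congr ?_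
  filter_upwards [hf.coeFn_toLp, hg.coeFn_toLp] with x h1 h2
  rw [h1, h2]

theorem inner_toLp_toLp (hf : MemLp f 2 μ) (hg : MemLp g 2 μ) :
    ⟪hf.toLp f, hg.toLp g⟫ = ∫ x, ⟪f x, g x⟫ ∂μ := by
  rw [L2.inner_def]
  refine integral_congr_ae ?_
  filter_upwards [hf.coeFn_toLp, hg.coeFn_toLp] with x h1 h2
  rw [h1, h2]

theorem norm_toLp_sq (hf : MemLp f 2 μ) : ‖hf.toLp f‖ ^ 2 = ∫ x, ‖f x‖ ^ 2 ∂μ := by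
  rw [← real_inner_self_eq_norm_sq, inner_toLp_toLp]
  simp only [real_inner_self_eq_norm_sq]

theorem sq_integral_inner_le (hf : MemLp f 2 μ) (hg : MemLp g 2 μ) :
    (∫ x, ⟪f x, g x⟫ ∂μ) ^ 2 ≤ (∫ x, ‖f x‖ ^ 2 ∂μ) * ∫ x, ‖g x‖ ^ 2 ∂μ := by
  rw [← inner_toLp_toLp hf hg, ← norm_toLp_sq hf, ← norm_toLp_sq hg, ← mul_pow]
  exact sq_le_sq' (by linarith [neg_abs_le ⟪hf.toLp f, hg.toLp g⟫,
    abs_real_inner_le_norm (hf.toLp f) (hg.toLp g)]) (real_inner_le_norm _ _)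

end InnerMemLp

section WeightMeasure

variable {d : ℕ} {β : ℝ} {H : Type*} [NormedAddCommGroup H]

theorem continuous_one_add_norm_sq_rpow (β : ℝ) :
    Continuous fun x : EuclideanSpace ℝ (Fin d) => (1 + ‖x‖ ^ 2) ^ β :=
  (by fun_prop : Continuous fun x : EuclideanSpace ℝ (Fin d) => 1 + ‖x‖ ^ 2).rpow_const
    fun x => Or.inl (by positivity)

theorem measurable_weight (β : ℝ) :
    Measurable fun x : EuclideanSpace ℝ (Fin d) => ENNReal.ofReal ((1 + ‖x‖ ^ 2) ^ β) :=
  (continuous_one_add_norm_sq_rpow β).measurable.ennreal_ofReal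

theorem integral_weightMeasure [NormedSpace ℝ H] (β : ℝ) (g : EuclideanSpace ℝ (Fin d) → H) :
    ∫ x, g x ∂(weightMeasure d β) = ∫ x, (1 + ‖x‖ ^ 2) ^ β • g x := by
  rw [weightMeasure, integral_withDensity_eq_integral_toReal_smul (measurable_weight β)
    (Eventually.of_forall fun _ => ENNReal.ofReal_lt_top)]
  refine integral_congr_ae (Eventually.of_forall fun x => ?_)
  simp only
  rw [ENNReal.toReal_ofReal (by positivity)]

theorem integrable_weightMeasure_iff [NormedSpace ℝ H] {g : EuclideanSpace ℝ (Fin d) → H} :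
    Integrable g (weightMeasure d β) ↔ Integrable fun x => (1 + ‖x‖ ^ 2) ^ β • g x := by
  rw [weightMeasure, integrable_withDensity_iff_integrable_smul' (measurable_weight β)
    (Eventually.of_forall fun _ => ENNReal.ofReal_lt_top)]
  refine integrable_congr (Eventually.of_forall fun x => ?_)
  simp only
  rw [ENNReal.toReal_ofReal (by positivity)]

theorem weightMeasure_absolutelyContinuous : weightMeasure d β ≪ volume :=
  withDensity_absolutelyContinuous _ _

theorem absolutelyContinuous_weightMeasure : volume ≪ weightMeasure d β :=
  withDensity_absolutelyContinuous' (measurable_weight β).aemeasurable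
    (Eventually.of_forall fun x => by
      rw [ne_eq, ENNReal.ofReal_eq_zero, not_le]; positivity)

theorem ae_weightMeasure : ae (weightMeasure d β) = ae volume :=
  le_antisymm weightMeasure_absolutelyContinuous.ae_le absolutelyContinuous_weightMeasure.ae_le

theorem aestronglyMeasurable_weightMeasure_iff {f : EuclideanSpace ℝ (Fin d) → H} :
    AEStronglyMeasurable f (weightMeasure d β) ↔ AEStronglyMeasurable f volume :=
  ⟨fun h => h.mono_ac absolutelyContinuous_weightMeasure,
    fun h => h.mono_ac weightMeasure_absolutelyContinuous⟩

theorem memLp_weightMeasure_iff_integrable [NormedSpace ℝ H] {f : EuclideanSpace ℝ (Fin d) → H}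
    (hf : AEStronglyMeasurable f volume) :
    MemLp f 2 (weightMeasure d β) ↔ Integrable fun x => (1 + ‖x‖ ^ 2) ^ β * ‖f x‖ ^ 2 := by
  rw [memLp_two_iff_integrable_sq_norm (aestronglyMeasurable_weightMeasure_iff.2 hf),
    integrable_weightMeasure_iff]
  simp only [smul_eq_mul]

theorem memLp_weightMeasure_iff [NormedSpace ℝ H] {f : EuclideanSpace ℝ (Fin d) → H} :
    MemLp f 2 (weightMeasure d β) ↔ MemLp (fun x => (1 + ‖x‖ ^ 2) ^ (β / 2) • f x) 2 volume := by
  have hmeas : AEStronglyMeasurable (fun x => (1 + ‖x‖ ^ 2) ^ (β / 2) • f x) volume ↔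
      AEStronglyMeasurable f volume := by
    refine ⟨fun h => ?_, (continuous_one_add_norm_sq_rpow _).aestronglyMeasurable.smul⟩
    refine ((continuous_one_add_norm_sq_rpow (-(β / 2))).aestronglyMeasurable.smul h).congr
      (Eventually.of_forall fun x => ?_)
    rw [Pi.smul_apply', smul_smul, ← Real.rpow_add (by positivity), neg_add_cancel, Real.rpow_zero, one_smul]
  by_cases hf : AEStronglyMeasurable f volume
  · rw [memLp_weightMeasure_iff_integrable hf, memLp_two_iff_integrable_sq_norm (hmeas.2 hf)]
    refine integrable_congr (Eventually.of_forall fun x => ?_)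
    simp only
    rw [norm_smul, mul_pow, Real.norm_of_nonneg (by positivity), ← Real.rpow_mul_natCast (by positivity)]
    norm_num
  · exact ⟨fun h => (hf (aestronglyMeasurable_weightMeasure_iff.1 h.1)).elim,
      fun h => (hf (hmeas.1 h.1)).elim⟩

theorem one_add_norm_sq_rpow_le_one (hβ : β ≤ 0) (x : EuclideanSpace ℝ (Fin d)) :
    (1 + ‖x‖ ^ 2) ^ β ≤ 1 :=
  Real.rpow_le_one_of_one_le_of_nonpos (by nlinarith [sq_nonneg ‖x‖]) hβ

/-- For β ≤ 0 the full weight can be absorbed into the function, leaving an element of unweighted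
L². The annihilator arguments below thus reduce to Lebesgue measure. -/
theorem MemLp.weight_smul [NormedSpace ℝ H] (hβ : β ≤ 0) {f : EuclideanSpace ℝ (Fin d) → H}
    (hf : MemLp f 2 (weightMeasure d β)) : MemLp (fun x => (1 + ‖x‖ ^ 2) ^ β • f x) 2 volume := by
  have h := memLp_weightMeasure_iff.1 hf
  refine h.mono ((continuous_one_add_norm_sq_rpow _).aestronglyMeasurable.smul
    (aestronglyMeasurable_weightMeasure_iff.1 hf.1)) (Eventually.of_forall fun x => ?_)
  rw [show (1 + ‖x‖ ^ 2) ^ β = (1 + ‖x‖ ^ 2) ^ (β / 2) * (1 + ‖x‖ ^ 2) ^ (β / 2) by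
    rw [← Real.rpow_add (by positivity), add_halves], mul_smul, norm_smul]
  refine mul_le_of_le_one_left (norm_nonneg _) ?_
  rw [Real.norm_of_nonneg (by positivity)]
  exact one_add_norm_sq_rpow_le_one (by linarith) x

end WeightMeasure

/-! ### Correlations with translates, and mollification -/

section Translation

variable {E H : Type*} [NormedAddCommGroup E] [InnerProductSpace ℝ E] [FiniteDimensional ℝ E]
  [MeasurableSpace E] [BorelSpace E] [NormedAddCommGroup H] {W G : E → H}

theorem memLp_comp_sub (hG : MemLp G 2) (y : E) : MemLp (fun x => G (x - y)) 2 :=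
  hG.comp_measurePreserving (measurePreserving_sub_right volume y)

variable [InnerProductSpace ℝ H]

/-- Translations act strongly continuously on L². -/
theorem continuous_integral_inner_translate (hW : MemLp W 2) (hG : MemLp G 2) :
    Continuous fun y => ∫ x, ⟪W x, G (x - y)⟫ := by
  have : Fact ((2 : ℝ≥0∞) ≠ ⊤) := ⟨by simp⟩
  have h : ∀ y, ∫ x, ⟪W x, G (x - y)⟫ =
      ⟪hW.toLp W, (DomAddAct.mk (-y) : Eᵈᵃᵃ) +ᵥ hG.toLp G⟫ := fun y => by
    rw [DomAddAct.mk_vadd_toLp, inner_toLp_toLp]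
    simp only [vadd_eq_add, neg_add_eq_sub]
  simp only [h]
  have hc : Continuous fun y : E => (DomAddAct.mk (-y) : Eᵈᵃᵃ) :=
    DomAddAct.continuous_mk.comp continuous_neg
  exact continuous_const.inner (hc.vadd continuous_const)

theorem integrable_smul_comp_sub {ρ : E → ℝ} (hρ : Continuous ρ) (hρc : HasCompactSupport ρ)
    (hG : MemLp G 2) (x : E) : Integrable fun y => ρ y • G (x - y) :=
  ((hG.comp_measurePreserving (Measure.measurePreserving_sub_left volume x)).locallyIntegrable
    (by norm_num)).integrable_smul_left_of_hasCompactSupport hρ hρc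

/-- Fubini's theorem, justified by the correlation of the norms |W| and |G|: it is continuous in y,
hence integrable against the compactly supported |ρ|. -/
theorem integral_mul_integral_inner_translate [CompleteSpace H] {ρ : E → ℝ} (hρ : Continuous ρ)
    (hρc : HasCompactSupport ρ) (hW : MemLp W 2) (hG : MemLp G 2) :
    ∫ y, ρ y * ∫ x, ⟪W x, G (x - y)⟫ = ∫ x, ⟪W x, ∫ y, ρ y • G (x - y)⟫ := by
  have hmeas : AEStronglyMeasurable (fun p : E × E => ρ p.2 * ⟪W p.1, G (p.1 - p.2)⟫)
      (volume.prod volume) :=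
    (hρ.comp continuous_snd).aestronglyMeasurable.mul
      (hW.1.comp_fst.inner (hG.1.comp_quasiMeasurePreserving
        (quasiMeasurePreserving_sub_of_right_invariant volume volume)))
  have hint : Integrable (fun p : E × E => ρ p.2 * ⟪W p.1, G (p.1 - p.2)⟫)
      (volume.prod volume) := by
    rw [integrable_prod_iff' hmeas]
    refine ⟨Eventually.of_forall fun y =>
      (integrable_inner_of_memLp hW (memLp_comp_sub hG y)).const_mul (ρ y), ?_⟩
    have hc := continuous_integral_inner_translate hW.norm hG.norm
    refine Integrable.mono' ((hρ.norm.mul hc).integrable_of_hasCompactSupport hρc.norm.mul_right)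
      hmeas.norm.prod_swap.integral_prod_right' (Eventually.of_forall fun y => ?_)
    rw [Real.norm_of_nonneg (integral_nonneg fun _ => norm_nonneg _)]
    simp only [norm_mul]
    rw [integral_const_mul]
    refine mul_le_mul_of_nonneg_left (integral_mono
      (integrable_inner_of_memLp hW (memLp_comp_sub hG y)).norm
      (integrable_inner_of_memLp hW.norm (memLp_comp_sub hG.norm y)) fun x => ?_) (norm_nonneg _)
    simp only [Real.inner_apply]
    exact norm_inner_le_norm _ _
  simp only [← integral_const_mul]
  rw [integral_integral_swap (f := fun y x => ρ y * ⟪W x, G (x - y)⟫) hint.swap]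
  refine integral_congr_ae (Eventually.of_forall fun x => ?_)
  simp only
  rw [← integral_inner (integrable_smul_comp_sub hρ hρc hG x)]
  simp only [inner_smul_right]

end Translation

section Mollification

variable {d : ℕ} {f ρ : EuclideanSpace ℝ (Fin d) → ℝ}
  {G : EuclideanSpace ℝ (Fin d) → EuclideanSpace ℝ (Fin d)}

theorem inner_gradient (f : EuclideanSpace ℝ (Fin d) → ℝ) (x v : EuclideanSpace ℝ (Fin d)) :
    ⟪gradient f x, v⟫ = fderiv ℝ f x v := by
  rw [gradient, InnerProductSpace.toDual_symm_apply]

theorem IsTest.continuous_gradient {Ω : Set (EuclideanSpace ℝ (Fin d))} (hf : IsTest Ω f) :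
    Continuous (gradient f) :=
  (InnerProductSpace.toDual ℝ _).symm.continuous.comp
    (hf.contDiff.continuous_fderiv (by simp))

theorem IsTest.hasCompactSupport_gradient {Ω : Set (EuclideanSpace ℝ (Fin d))}
    (hf : IsTest Ω f) : HasCompactSupport (gradient f) :=
  (hf.hasCompactSupport.fderiv ℝ).comp_left (g := (InnerProductSpace.toDual ℝ _).symm)
    (map_zero _)

theorem IsTest.comp_const_sub (hρ : IsTest univ ρ) (x : EuclideanSpace ℝ (Fin d)) :
    IsTest univ fun t => ρ (x - t) :=
  ⟨hρ.contDiff.comp (contDiff_const.sub contDiff_id),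
    hρ.hasCompactSupport.comp_homeomorph (Homeomorph.subLeft x), subset_univ _⟩

theorem fderiv_comp_const_sub (hρ : IsTest univ ρ) (x t v : EuclideanSpace ℝ (Fin d)) :
    fderiv ℝ (fun t => ρ (x - t)) t v = -fderiv ℝ ρ (x - t) v := by
  have h := (hρ.differentiable (x - t)).hasFDerivAt.comp t ((hasFDerivAt_id t).const_sub x)
  rw [show fderiv ℝ (fun t => ρ (x - t)) t = _ from h.fderiv]
  simp

theorem IsWeakGradient.isTest_mollify (h : IsWeakGradient f G) (hf : HasCompactSupport f)
    (hρ : IsTest univ ρ) : IsTest univ fun x => ∫ t, ρ t • f (x - t) := by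
  refine ⟨?_, ?_, subset_univ _⟩
  · exact hρ.hasCompactSupport.contDiff_convolution_left (n := ⊤) (ContinuousLinearMap.lsmul ℝ ℝ)
      hρ.contDiff h.locallyIntegrable_fun
  · exact hρ.hasCompactSupport.convolution (ContinuousLinearMap.lsmul ℝ ℝ) hf

/-- Put the derivative on ρ and use the definition of the weak gradient with the test function t ↦
ρ(x - t). -/
theorem IsWeakGradient.gradient_mollify (h : IsWeakGradient f G)
    (hρ : IsTest univ ρ) (x : EuclideanSpace ℝ (Fin d)) :
    gradient (fun x => ∫ t, ρ t • f (x - t)) x = ∫ t, ρ t • G (x - t) := by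
  have hρ' := hρ.comp_const_sub x
  refine ext_inner_right ℝ fun v => ?_
  have e1 : (fun x => ∫ t, ρ t • f (x - t)) =
      convolution f ρ (ContinuousLinearMap.lsmul ℝ ℝ) volume := by
    ext z
    rw [convolution_eq_swap]
    refine integral_congr_ae (Eventually.of_forall fun t => ?_)
    simp [mul_comm]
  have hfd := hρ.hasCompactSupport.hasFDerivAt_convolution_right (ContinuousLinearMap.lsmul ℝ ℝ)
    h.locallyIntegrable_fun (hρ.contDiff.of_le (by simp)) x
  rw [inner_gradient, e1, hfd.fderiv, convolution_precompR_apply _ h.locallyIntegrable_fun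
    (hρ.hasCompactSupport.fderiv ℝ) (hρ.contDiff.continuous_fderiv (by simp)), convolution_def]
  have hi1 : Integrable fun t => f t • gradient (fun t => ρ (x - t)) t :=
    h.locallyIntegrable_fun.integrable_smul_right_of_hasCompactSupport hρ'.continuous_gradient
      hρ'.hasCompactSupport_gradient
  have hi2 : Integrable fun t => ρ (x - t) • G t :=
    h.locallyIntegrable_grad.integrable_smul_left_of_hasCompactSupport hρ'.continuous
      hρ'.hasCompactSupport
  have key := congrArg (fun z => ⟪v, z⟫) (h.integral_eq _ hρ'.contDiff hρ'.hasCompactSupport)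
  simp only [inner_neg_right] at key
  rw [← integral_inner hi1] at key
  have e2 : ∫ t, ρ t • G (x - t) = ∫ t, ρ (x - t) • G t := by
    rw [← integral_sub_left_eq_self (fun t => ρ (x - t) • G t) volume x]
    simp
  rw [e2, real_inner_comm, ← neg_eq_iff_eq_neg.2 key, ← integral_neg]
  refine integral_congr_ae (Eventually.of_forall fun t => ?_)
  simp only
  rw [inner_smul_right, real_inner_comm, inner_gradient, fderiv_comp_const_sub hρ]
  simp

/-- A pair of square integrable functions that annihilates all test functions annihilates the
compactly supported functions of the Sobolev space. -/
theorem IsWeakGradient.integral_eq_zero_of_hasCompactSupport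
    {U : EuclideanSpace ℝ (Fin d) → ℝ} {W : EuclideanSpace ℝ (Fin d) → EuclideanSpace ℝ (Fin d)}
    (hU : MemLp U 2) (hW : MemLp W 2)
    (hUW : ∀ φ, IsTest univ φ → (∫ x, U x * φ x) + ∫ x, ⟪W x, gradient φ x⟫ = 0)
    (h : IsWeakGradient f G) (hf : MemLp f 2) (hG : MemLp G 2) (hfc : HasCompactSupport f) :
    (∫ x, U x * f x) + ∫ x, ⟪W x, G x⟫ = 0 := by
  -- The pairing of (U, W) with the translate of (f, G) by y is continuous in y. Integrated against
  -- any test ρ it gives the pairing with a mollification of f, which is a test function, hence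
  -- zero. So it vanishes identically, in particular at y = 0, and no convergence of mollifiers has
  -- to be discussed.
  have hc : Continuous fun y => (∫ x, ⟪U x, f (x - y)⟫) + ∫ x, ⟪W x, G (x - y)⟫ :=
    (continuous_integral_inner_translate hU hf).add (continuous_integral_inner_translate hW hG)
  have hz : ∀ᵐ y, (∫ x, ⟪U x, f (x - y)⟫) + ∫ x, ⟪W x, G (x - y)⟫ = 0 := by
    refine ae_eq_zero_of_integral_contDiff_smul_eq_zero hc.locallyIntegrable fun ρ hρ hρc => ?_
    have hT : IsTest univ ρ := ⟨hρ, hρc, subset_univ _⟩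
    have h1 := hUW _ (h.isTest_mollify hfc hT)
    simp only [h.gradient_mollify hT] at h1
    rw [← integral_mul_integral_inner_translate hT.continuous hρc hW hG] at h1
    have h2 := integral_mul_integral_inner_translate hT.continuous hρc hU hf
    have h3 : ∫ x, ⟪U x, ∫ y, ρ y • f (x - y)⟫ = ∫ x, U x * ∫ y, ρ y • f (x - y) := by
      simp [mul_comm]
    rw [← h3, ← h2, ← integral_add] at h1
    · rw [← h1]
      simp only [smul_eq_mul, mul_add]
    · exact (hT.continuous.mul (continuous_integral_inner_translate hU hf)
        ).integrable_of_hasCompactSupport hρc.mul_right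
    · exact (hT.continuous.mul (continuous_integral_inner_translate hW hG)
        ).integrable_of_hasCompactSupport hρc.mul_right
  have h0 := congrFun ((hc.ae_eq_iff_eq volume continuous_const).1 hz) 0
  simpa [mul_comm] using h0

end Mollification

/-! ### Cutoffs near the origin and near infinity -/

theorem deriv_smoothTransition_eq_zero {t : ℝ} (ht : t ∉ Icc (0 : ℝ) 1) :
    deriv Real.smoothTransition t = 0 := by
  rcases not_and_or.1 ht with h | h
  · have : Real.smoothTransition =ᶠ[𝓝 t] fun _ => 0 := by
      filter_upwards [Iio_mem_nhds (not_le.1 h)] with s hs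
      exact Real.smoothTransition.zero_of_nonpos (le_of_lt hs)
    rw [this.deriv_eq, deriv_const]
  · have : Real.smoothTransition =ᶠ[𝓝 t] fun _ => 1 := by
      filter_upwards [Ioi_mem_nhds (not_le.1 h)] with s hs
      exact Real.smoothTransition.one_of_one_le (le_of_lt hs)
    rw [this.deriv_eq, deriv_const]

theorem continuous_deriv_smoothTransition : Continuous (deriv Real.smoothTransition) :=
  (Real.smoothTransition.contDiff (n := 1)).continuous_deriv (by simp)

theorem exists_abs_deriv_smoothTransition_le :
    ∃ C, 0 ≤ C ∧ ∀ t, |deriv Real.smoothTransition t| ≤ C := by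
  have hc : HasCompactSupport (deriv Real.smoothTransition) :=
    HasCompactSupport.of_support_subset_isCompact isCompact_Icc fun t ht => by
      by_contra h
      exact ht (deriv_smoothTransition_eq_zero h)
  obtain ⟨C, hC⟩ := hc.exists_bound_of_continuous continuous_deriv_smoothTransition
  exact ⟨C, (norm_nonneg _).trans (hC 0), hC⟩

section Cutoff

variable {d : ℕ} {f g : EuclideanSpace ℝ (Fin d) → ℝ} {x : EuclideanSpace ℝ (Fin d)}
  {G : EuclideanSpace ℝ (Fin d) → EuclideanSpace ℝ (Fin d)}

theorem gradient_radial {p : ℝ → ℝ} (hp : DifferentiableAt ℝ p (‖x‖ ^ 2)) :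
    gradient (fun x : EuclideanSpace ℝ (Fin d) => p (‖x‖ ^ 2)) x = (2 * deriv p (‖x‖ ^ 2)) • x := by
  refine ext_inner_right ℝ fun v => ?_
  have h1 := (hasStrictFDerivAt_norm_sq x).hasFDerivAt
  have h2 := hp.hasDerivAt.comp_hasFDerivAt x h1
  rw [inner_gradient, show fderiv ℝ (fun x : EuclideanSpace ℝ (Fin d) => p (‖x‖ ^ 2)) x = _ from
    h2.fderiv]
  simp [inner_smul_left]
  ring

theorem gradient_mul (hf : DifferentiableAt ℝ f x) (hg : DifferentiableAt ℝ g x) :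
    gradient (fun x => f x * g x) x = f x • gradient g x + g x • gradient f x := by
  refine ext_inner_right ℝ fun v => ?_
  rw [inner_gradient, fderiv_fun_mul hf hg, inner_add_left, real_inner_smul_left,
    real_inner_smul_left, inner_gradient, inner_gradient]
  simp

/-- A smooth cutoff vanishing on `‖x‖ ≤ 1 / N` and equal to one on `‖x‖ ≥ 2 / N`. -/
def nearCutoff (N : ℝ) (x : EuclideanSpace ℝ (Fin d)) : ℝ :=
  Real.smoothTransition (N ^ 2 * ‖x‖ ^ 2 - 1)

/-- A smooth cutoff equal to one on `‖x‖ ≤ N` and vanishing on `‖x‖ ≥ 2 N`. -/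
def farCutoff (N : ℝ) (x : EuclideanSpace ℝ (Fin d)) : ℝ :=
  Real.smoothTransition (2 - (N ^ 2)⁻¹ * ‖x‖ ^ 2)

theorem contDiff_nearCutoff (N : ℝ) : ContDiff ℝ ∞ (nearCutoff (d := d) N) :=
  (Real.smoothTransition.contDiff (n := ⊤)).comp
    ((contDiff_const.mul (contDiff_norm_sq ℝ)).sub contDiff_const)

theorem contDiff_farCutoff (N : ℝ) : ContDiff ℝ ∞ (farCutoff (d := d) N) :=
  (Real.smoothTransition.contDiff (n := ⊤)).comp
    (contDiff_const.sub (contDiff_const.mul (contDiff_norm_sq ℝ)))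

theorem gradient_smoothTransition_affine (a b : ℝ) (x : EuclideanSpace ℝ (Fin d)) :
    gradient (fun x : EuclideanSpace ℝ (Fin d) => Real.smoothTransition (a * ‖x‖ ^ 2 + b)) x =
      (2 * (a * deriv Real.smoothTransition (a * ‖x‖ ^ 2 + b))) • x := by
  have hd : HasDerivAt (fun s => Real.smoothTransition (a * s + b))
      (a * deriv Real.smoothTransition (a * ‖x‖ ^ 2 + b)) (‖x‖ ^ 2) := by
    have h1 := ((Real.smoothTransition.contDiff (n := 1)).differentiable (by simp)
      (a * ‖x‖ ^ 2 + b)).hasDerivAt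
    have h2 : HasDerivAt (fun s : ℝ => a * s + b) a (‖x‖ ^ 2) := by
      simpa using ((hasDerivAt_id (‖x‖ ^ 2)).const_mul a).add_const b
    rw [mul_comm]
    exact h1.comp (‖x‖ ^ 2) h2
  rw [gradient_radial (p := fun s => Real.smoothTransition (a * s + b)) hd.differentiableAt,
    hd.deriv]

theorem gradient_nearCutoff (N : ℝ) (x : EuclideanSpace ℝ (Fin d)) :
    gradient (nearCutoff N) x =
      (2 * (N ^ 2 * deriv Real.smoothTransition (N ^ 2 * ‖x‖ ^ 2 - 1))) • x :=
  gradient_smoothTransition_affine (N ^ 2) (-1) x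

theorem gradient_farCutoff (N : ℝ) (x : EuclideanSpace ℝ (Fin d)) :
    gradient (farCutoff N) x =
      (2 * (-(N ^ 2)⁻¹ * deriv Real.smoothTransition (2 - (N ^ 2)⁻¹ * ‖x‖ ^ 2))) • x := by
  have h := gradient_smoothTransition_affine (-(N ^ 2)⁻¹) 2 x
  simp only [neg_mul, neg_add_eq_sub] at h ⊢
  exact h

theorem continuous_gradient_of_contDiff (hf : ContDiff ℝ ∞ f) : Continuous (gradient f) :=
  (InnerProductSpace.toDual ℝ _).symm.continuous.comp (hf.continuous_fderiv (by simp))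

theorem hasCompactSupport_farCutoff {N : ℝ} (hN : 0 < N) :
    HasCompactSupport (farCutoff (d := d) N) := by
  refine HasCompactSupport.of_support_subset_isCompact (isCompact_closedBall 0 (2 * N))
    fun x hx => ?_
  rw [mem_closedBall_zero_iff]
  by_contra! h
  refine hx (Real.smoothTransition.zero_of_nonpos ?_)
  rw [sub_nonpos, inv_mul_eq_div, le_div_iff₀ (by positivity)]
  nlinarith

theorem IsTest.nearCutoff_mul (hf : IsTest univ f) (N : ℝ) :
    IsTest ({0}ᶜ) fun x => nearCutoff N x * f x := by
  refine IsTest.of_tsupport_subset (K := tsupport f ∩ {x | 1 ≤ N ^ 2 * ‖x‖ ^ 2})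
    (hf.hasCompactSupport.isCompact.inter_right (isClosed_le continuous_const (by fun_prop)))
    (fun x hx h0 => ?_) ((contDiff_nearCutoff N).mul hf.contDiff)
    (subset_inter tsupport_mul_subset_right (closure_minimal (fun x hx => ?_)
      (isClosed_le continuous_const (by fun_prop))))
  · have : x = 0 := h0
    have h1 : 1 ≤ N ^ 2 * ‖x‖ ^ 2 := hx.2
    simp [this] at h1
    linarith
  · by_contra h
    refine hx ?_
    simp only
    rw [nearCutoff, Real.smoothTransition.zero_of_nonpos, zero_mul]
    have : ¬1 ≤ N ^ 2 * ‖x‖ ^ 2 := h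
    linarith

theorem eventually_nearCutoff (hx : x ≠ 0) :
    ∀ᶠ n : ℕ in atTop, 2 < ((n : ℝ) + 1) ^ 2 * ‖x‖ ^ 2 := by
  have h : Tendsto (fun n : ℕ => ((n : ℝ) + 1) ^ 2 * ‖x‖ ^ 2) atTop atTop :=
    (((tendsto_pow_atTop two_ne_zero).comp
      (tendsto_atTop_add_const_right _ 1 tendsto_natCast_atTop_atTop))).atTop_mul_const
      (pow_pos (norm_pos_iff.2 hx) 2)
  exact h.eventually_gt_atTop 2

theorem eventually_farCutoff (x : EuclideanSpace ℝ (Fin d)) :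
    ∀ᶠ n : ℕ in atTop, (((n : ℝ) + 1) ^ 2)⁻¹ * ‖x‖ ^ 2 < 1 := by
  have h : Tendsto (fun n : ℕ => ((n : ℝ) + 1) ^ 2) atTop atTop :=
    ((tendsto_pow_atTop two_ne_zero).comp
      (tendsto_atTop_add_const_right _ 1 tendsto_natCast_atTop_atTop))
  filter_upwards [h.eventually_gt_atTop (‖x‖ ^ 2)] with n hn
  rw [inv_mul_lt_iff₀ (by positivity)]
  linarith

/-- By scaling, the Dirichlet integral of the cutoff at scale 1/N is N^(2-d) times that at scale 1,
hence bounded for d ≥ 2. -/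
theorem integral_norm_sq_gradient_nearCutoff_le (hd : 2 ≤ d) {N : ℝ} (hN : 1 ≤ N) :
    Integrable (fun x : EuclideanSpace ℝ (Fin d) => ‖gradient (nearCutoff N) x‖ ^ 2) ∧
    ∫ x : EuclideanSpace ℝ (Fin d), ‖gradient (nearCutoff N) x‖ ^ 2 ≤
      ∫ x : EuclideanSpace ℝ (Fin d), ‖gradient (nearCutoff 1) x‖ ^ 2 := by
  have h : ∀ x : EuclideanSpace ℝ (Fin d), ‖gradient (nearCutoff N) x‖ ^ 2 =
      N ^ 2 * ‖gradient (nearCutoff 1) (N • x)‖ ^ 2 := fun x => by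
    simp only [gradient_nearCutoff, norm_smul, mul_pow, one_pow, one_mul, Real.norm_eq_abs, sq_abs]
    ring
  have hc : Continuous fun x : EuclideanSpace ℝ (Fin d) => ‖gradient (nearCutoff 1) x‖ ^ 2 :=
    (continuous_gradient_of_contDiff (contDiff_nearCutoff 1)).norm.pow 2
  have hs : HasCompactSupport fun x : EuclideanSpace ℝ (Fin d) =>
      ‖gradient (nearCutoff 1) x‖ ^ 2 := by
    refine HasCompactSupport.of_support_subset_isCompact (isCompact_closedBall 0 2) fun x hx => ?_
    rw [mem_closedBall_zero_iff]
    by_contra! hlt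
    refine hx ?_
    simp only
    rw [gradient_nearCutoff, deriv_smoothTransition_eq_zero]
    · simp
    · rintro ⟨-, h2⟩
      nlinarith
  have hi := hc.integrable_of_hasCompactSupport hs (μ := volume)
  simp only [h]
  refine ⟨(hi.comp_smul (by linarith)).const_mul _, ?_⟩
  rw [integral_const_mul, Measure.integral_comp_smul volume
    (fun x : EuclideanSpace ℝ (Fin d) => ‖gradient (nearCutoff 1) x‖ ^ 2) N, finrank_euclideanSpace_fin,
    smul_eq_mul, ← mul_assoc]
  refine mul_le_of_le_one_left (integral_nonneg fun _ => by positivity) ?_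
  rw [abs_of_pos (by positivity), ← div_eq_mul_inv]
  exact div_le_one_of_le₀ (pow_le_pow_right₀ hN hd) (by positivity)

end Cutoff

/-! ### Removing the origin -/

section Density

variable {d : ℕ} {α : ℝ} {f u : EuclideanSpace ℝ (Fin d) → ℝ}
  {G V : EuclideanSpace ℝ (Fin d) → EuclideanSpace ℝ (Fin d)}

theorem nearCutoff_eq_one {N : ℝ} {x : EuclideanSpace ℝ (Fin d)} (h : 2 < N ^ 2 * ‖x‖ ^ 2) :
    nearCutoff N x = 1 := Real.smoothTransition.one_of_one_le (by linarith)

theorem gradient_nearCutoff_eq_zero {N : ℝ} {x : EuclideanSpace ℝ (Fin d)}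
    (h : 2 < N ^ 2 * ‖x‖ ^ 2) : gradient (nearCutoff N) x = 0 := by
  rw [gradient_nearCutoff, deriv_smoothTransition_eq_zero, mul_zero, mul_zero, zero_smul]
  rintro ⟨-, h2⟩
  linarith

theorem abs_smoothTransition_le (t : ℝ) : |Real.smoothTransition t| ≤ 1 := by
  rw [abs_of_nonneg (Real.smoothTransition.nonneg t)]
  exact Real.smoothTransition.le_one t

theorem memLp_gradient_nearCutoff (hd : 2 ≤ d) (n : ℕ) :
    MemLp (gradient (nearCutoff (d := d) ((n : ℝ) + 1))) 2 :=
  (memLp_two_iff_integrable_sq_norm (continuous_gradient_of_contDiff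
    (contDiff_nearCutoff _)).aestronglyMeasurable).2
    (integral_norm_sq_gradient_nearCutoff_le hd
      (by linarith [(Nat.cast_nonneg n : (0 : ℝ) ≤ n)])).1

theorem memLp_smul_of_le {E H : Type*} [TopologicalSpace E] [MeasurableSpace E] [BorelSpace E]
    [SecondCountableTopology E] [NormedAddCommGroup H] [NormedSpace ℝ H] {μ : Measure E}
    {k : E → ℝ} {F : E → H} {C : ℝ} {p : ℝ≥0∞} (hk : Continuous k) (hC : ∀ x, ‖k x‖ ≤ C)
    (hF : MemLp F p μ) : MemLp (fun x => k x • F x) p μ :=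
  hF.of_le_mul (hk.aestronglyMeasurable.smul hF.1) (Eventually.of_forall fun x => by
    rw [norm_smul]
    exact mul_le_mul_of_nonneg_right (hC x) (norm_nonneg _))

theorem tendsto_integral_norm_indicator_sq {X H : Type*} [MeasurableSpace X] [NormedAddCommGroup H]
    {μ : Measure X} {F : X → H} (hF : MemLp F 2 μ) {S : ℕ → Set X} (hS : ∀ n, MeasurableSet (S n))
    (h : ∀ᵐ x ∂μ, ∀ᶠ n in atTop, x ∉ S n) :
    Tendsto (fun n => ∫ x, ‖(S n).indicator F x‖ ^ 2 ∂μ) atTop (𝓝 0) := by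
  rw [← integral_zero X ℝ (μ := μ)]
  refine tendsto_integral_of_dominated_convergence (fun x => ‖F x‖ ^ 2)
    (fun n => (hF.1.indicator (hS n)).norm.pow 2) ((memLp_two_iff_integrable_sq_norm hF.1).1 hF)
    (fun n => Eventually.of_forall fun x => ?_) ?_
  · rw [Real.norm_of_nonneg (by positivity)]
    exact pow_le_pow_left₀ (norm_nonneg _) (norm_indicator_le_norm_self _ _) 2
  · filter_upwards [h] with x hx
    refine tendsto_const_nhds.congr' ?_
    filter_upwards [hx] with n hn
    rw [indicator_of_notMem hn]
    simp

/-- Cauchy–Schwarz localised to the set carrying g. When that set shrinks, the product tends to zero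
even if the norm of g merely stays bounded, which is all that is known of the cutoff gradients in
dimension two. -/
theorem sq_integral_inner_le_indicator {X H : Type*} [MeasurableSpace X] [NormedAddCommGroup H]
    [InnerProductSpace ℝ H] {μ : Measure X} {F g : X → H} (hF : MemLp F 2 μ) (hg : MemLp g 2 μ)
    {S : Set X} (hS : MeasurableSet S) (h : ∀ x ∉ S, g x = 0) :
    (∫ x, ⟪F x, g x⟫ ∂μ) ^ 2 ≤ (∫ x, ‖S.indicator F x‖ ^ 2 ∂μ) * ∫ x, ‖g x‖ ^ 2 ∂μ := by
  refine le_trans (le_of_eq ?_) (sq_integral_inner_le (hF.indicator hS) hg)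
  congr 2
  ext x
  by_cases hx : x ∈ S
  · rw [indicator_of_mem hx]
  · rw [h x hx, inner_zero_right, inner_zero_right]

/-- The cutoff error near the origin vanishes in the limit, in dimension at least two. -/
theorem tendsto_integral_inner_gradient_nearCutoff (hd : 2 ≤ d) (hV : MemLp V 2) :
    Tendsto (fun n : ℕ => ∫ x, ⟪V x, gradient (nearCutoff ((n : ℝ) + 1)) x⟫) atTop (𝓝 0) := by
  obtain ⟨S, hmem⟩ : ∃ S : ℕ → Set (EuclideanSpace ℝ (Fin d)),
      ∀ n x, x ∈ S n ↔ ((n : ℝ) + 1) ^ 2 * ‖x‖ ^ 2 ≤ 2 := ⟨fun n => {x | ((n : ℝ) + 1) ^ 2 * ‖x‖ ^ 2 ≤ 2},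
        fun _ _ => Iff.rfl⟩
  have hS : ∀ n, MeasurableSet (S n) := fun n => by
    have : S n = {x | ((n : ℝ) + 1) ^ 2 * ‖x‖ ^ 2 ≤ 2} := ext fun x => hmem n x
    rw [this]
    exact (isClosed_le (by fun_prop) continuous_const).measurableSet
  have hne : ∀ᵐ x : EuclideanSpace ℝ (Fin d), x ≠ 0 := by
    have : Nonempty (Fin d) := ⟨⟨0, by omega⟩⟩
    exact Measure.ae_ne volume 0
  have h1 := tendsto_integral_norm_indicator_sq hV hS (by
    filter_upwards [hne] with x hx
    filter_upwards [eventually_nearCutoff hx] with n hn h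
    exact (((hmem n x).1 h).trans_lt hn).false)
  obtain ⟨K, hK⟩ : ∃ K, K = ∫ x : EuclideanSpace ℝ (Fin d), ‖gradient (nearCutoff 1) x‖ ^ 2 :=
    ⟨_, rfl⟩
  have hb : ∀ n : ℕ, (∫ x, ⟪V x, gradient (nearCutoff ((n : ℝ) + 1)) x⟫) ^ 2 ≤
      (∫ x, ‖(S n).indicator V x‖ ^ 2) * K := fun n => by
    have hle := (integral_norm_sq_gradient_nearCutoff_le hd
      (N := (n : ℝ) + 1) (by linarith [(Nat.cast_nonneg n : (0 : ℝ) ≤ n)])).2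
    rw [← hK] at hle
    have hm := memLp_gradient_nearCutoff hd n
    refine (sq_integral_inner_le_indicator hV hm (hS n) fun x hx => ?_).trans
      (mul_le_mul_of_nonneg_left hle (integral_nonneg fun _ => sq_nonneg _))
    exact gradient_nearCutoff_eq_zero (not_le.1 fun h => hx ((hmem n x).2 h))
  have h2 : Tendsto (fun n : ℕ => (∫ x, ⟪V x, gradient (nearCutoff ((n : ℝ) + 1)) x⟫) ^ 2) atTop
      (𝓝 0) := by
    refine squeeze_zero (fun _ => sq_nonneg _) hb ?_
    simpa using h1.mul_const K
  have h3 := (Real.continuous_sqrt.tendsto 0).comp h2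
  rw [Real.sqrt_zero] at h3
  refine (tendsto_zero_iff_abs_tendsto_zero _).2 (h3.congr fun n => ?_)
  simp [Real.sqrt_sq_eq_abs]

/-- In dimension at least two, points are removable for annihilators of test functions. -/
theorem integral_eq_zero_of_isTest_compl_zero (hd : 2 ≤ d) (hu : MemLp u 2) (hV : MemLp V 2)
    (h : ∀ φ, IsTest ({0}ᶜ) φ → (∫ x, u x * φ x) + ∫ x, ⟪V x, gradient φ x⟫ = 0)
    {φ : EuclideanSpace ℝ (Fin d) → ℝ} (hφ : IsTest univ φ) :
    (∫ x, u x * φ x) + ∫ x, ⟪V x, gradient φ x⟫ = 0 := by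
  have hne : ∀ᵐ x : EuclideanSpace ℝ (Fin d), x ≠ 0 := by
    have : Nonempty (Fin d) := ⟨⟨0, by omega⟩⟩
    exact Measure.ae_ne volume 0
  have hφ2 : MemLp φ 2 := hφ.continuous.memLp_of_hasCompactSupport hφ.hasCompactSupport
  have hg2 : MemLp (gradient φ) 2 :=
    hφ.continuous_gradient.memLp_of_hasCompactSupport hφ.hasCompactSupport_gradient
  have hi1 : Integrable fun x => u x * φ x := hu.integrable_mul hφ2
  have hi2 := integrable_inner_of_memLp hV hg2
  have hφV : MemLp (fun x => φ x • V x) 2 := by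
    obtain ⟨C, hC⟩ := hφ.hasCompactSupport.exists_bound_of_continuous hφ.continuous
    exact memLp_smul_of_le hφ.continuous hC hV
  have hη : ∀ n : ℕ, Continuous (nearCutoff (d := d) ((n : ℝ) + 1)) := fun n =>
    (contDiff_nearCutoff _).continuous
  have t1 : Tendsto (fun n : ℕ => ∫ x, nearCutoff ((n : ℝ) + 1) x * (u x * φ x)) atTop
      (𝓝 (∫ x, u x * φ x)) := by
    refine tendsto_integral_of_dominated_convergence (fun x => ‖u x * φ x‖)
      (fun n => (hη n).aestronglyMeasurable.mul hi1.1) hi1.norm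
      (fun n => Eventually.of_forall fun x => ?_) ?_
    · rw [norm_mul]
      exact mul_le_of_le_one_left (norm_nonneg _) (abs_smoothTransition_le _)
    · filter_upwards [hne] with x hx
      refine tendsto_const_nhds.congr' ?_
      filter_upwards [eventually_nearCutoff hx] with n hn
      rw [nearCutoff_eq_one hn, one_mul]
  have t2 : Tendsto (fun n : ℕ => ∫ x, nearCutoff ((n : ℝ) + 1) x * ⟪V x, gradient φ x⟫) atTop
      (𝓝 (∫ x, ⟪V x, gradient φ x⟫)) := by
    refine tendsto_integral_of_dominated_convergence (fun x => ‖⟪V x, gradient φ x⟫‖)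
      (fun n => (hη n).aestronglyMeasurable.mul hi2.1) hi2.norm
      (fun n => Eventually.of_forall fun x => ?_) ?_
    · rw [norm_mul]
      exact mul_le_of_le_one_left (norm_nonneg _) (abs_smoothTransition_le _)
    · filter_upwards [hne] with x hx
      refine tendsto_const_nhds.congr' ?_
      filter_upwards [eventually_nearCutoff hx] with n hn
      rw [nearCutoff_eq_one hn, one_mul]
  -- The term in which the gradient falls on the cutoff; the other two converge to the desired
  -- pairing by dominated convergence.
  have t3 := tendsto_integral_inner_gradient_nearCutoff hd hφV
  have hsum := (t1.add t2).add t3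
  rw [add_zero] at hsum
  refine tendsto_nhds_unique (hsum.congr fun n => ?_) tendsto_const_nhds
  have hT := hφ.nearCutoff_mul ((n : ℝ) + 1)
  rw [← h _ hT, add_assoc, ← integral_add (hi2.bdd_mul (c := 1) (hη n).aestronglyMeasurable
    (Eventually.of_forall fun x => abs_smoothTransition_le _))
    (integrable_inner_of_memLp hφV (memLp_gradient_nearCutoff hd n))]
  congr 1
  · refine integral_congr_ae (Eventually.of_forall fun x => ?_)
    simp only
    ring
  · refine integral_congr_ae (Eventually.of_forall fun x => ?_)
    simp only
    rw [gradient_mul ((contDiff_nearCutoff _).differentiable (by simp) x) (hφ.differentiable x),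
      inner_add_right, real_inner_smul_right, real_inner_smul_right, real_inner_smul_left]

end Density

/-! ### Truncation at infinity -/

section FarCutoff

variable {d : ℕ} {α : ℝ} {f u k : EuclideanSpace ℝ (Fin d) → ℝ}
  {G V : EuclideanSpace ℝ (Fin d) → EuclideanSpace ℝ (Fin d)}

theorem farCutoff_eq_one {N : ℝ} {x : EuclideanSpace ℝ (Fin d)} (h : (N ^ 2)⁻¹ * ‖x‖ ^ 2 < 1) :
    farCutoff N x = 1 := Real.smoothTransition.one_of_one_le (by linarith)

theorem gradient_farCutoff_eq_zero {N : ℝ} {x : EuclideanSpace ℝ (Fin d)}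
    (h : (N ^ 2)⁻¹ * ‖x‖ ^ 2 < 1) : gradient (farCutoff N) x = 0 := by
  rw [gradient_farCutoff, deriv_smoothTransition_eq_zero, mul_zero, mul_zero, zero_smul]
  rintro ⟨-, h2⟩
  linarith

/-- The gradient lives on N² ≤ |x|² ≤ 2N² and is of order 1/N there. The decay (1+|x|²)^(-1/2),
uniform in N, makes up for the unit difference between the weight exponents of functions and
gradients. -/
theorem exists_norm_gradient_farCutoff_le (d : ℕ) :
    ∃ C : ℝ, 0 ≤ C ∧ ∀ N : ℝ, 1 ≤ N → ∀ x : EuclideanSpace ℝ (Fin d),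
      ‖gradient (farCutoff N) x‖ ≤ C * (1 + ‖x‖ ^ 2) ^ (-(1 / 2) : ℝ) := by
  obtain ⟨C, hC0, hC⟩ := exists_abs_deriv_smoothTransition_le
  refine ⟨6 * C, by positivity, fun N hN x => ?_⟩
  have hN2 : 1 ≤ N ^ 2 := one_le_pow₀ hN
  have hpos : 0 < 1 + ‖x‖ ^ 2 := by positivity
  by_cases h : 2 - (N ^ 2)⁻¹ * ‖x‖ ^ 2 ∈ Icc (0 : ℝ) 1
  · have hx : ‖x‖ ^ 2 ≤ 2 * N ^ 2 := by
      have := h.1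
      rw [sub_nonneg, inv_mul_le_iff₀ (by positivity)] at this
      linarith
    have h1 : ‖gradient (farCutoff N) x‖ ≤ 2 * (N ^ 2)⁻¹ * C * ‖x‖ := by
      rw [gradient_farCutoff, norm_smul]
      refine mul_le_mul_of_nonneg_right ?_ (norm_nonneg _)
      rw [norm_mul, norm_mul, norm_neg, norm_inv, Real.norm_of_nonneg (by positivity : 0 ≤ N ^ 2),
        Real.norm_of_nonneg (by norm_num : (0 : ℝ) ≤ 2), mul_assoc]
      gcongr
      exact hC _
    refine h1.trans ?_
    rw [Real.rpow_neg hpos.le, ← Real.sqrt_eq_rpow, le_mul_inv_iff₀ (by positivity)]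
    have h2 : ‖x‖ * √(1 + ‖x‖ ^ 2) ≤ 3 * N ^ 2 := by
      rw [← abs_of_nonneg (by positivity : 0 ≤ ‖x‖ * √(1 + ‖x‖ ^ 2))]
      refine abs_le_of_sq_le_sq ?_ (by positivity)
      rw [mul_pow, Real.sq_sqrt hpos.le]
      nlinarith [sq_nonneg ‖x‖]
    calc 2 * (N ^ 2)⁻¹ * C * ‖x‖ * √(1 + ‖x‖ ^ 2)
        = 2 * (N ^ 2)⁻¹ * C * (‖x‖ * √(1 + ‖x‖ ^ 2)) := by ring
      _ ≤ 2 * (N ^ 2)⁻¹ * C * (3 * N ^ 2) := by gcongr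
      _ = 6 * C := by field_simp; ring
  · rw [gradient_farCutoff, deriv_smoothTransition_eq_zero h]
    simp
    positivity

theorem IsWeakGradient.smul_of_contDiff (h : IsWeakGradient f G) (hk : ContDiff ℝ ∞ k) :
    IsWeakGradient (fun x => k x * f x) fun x => k x • G x + f x • gradient k x := by
  have hkg := continuous_gradient_of_contDiff hk
  have hl : ∀ {H : Type} [NormedAddCommGroup H] [NormedSpace ℝ H]
      {F : EuclideanSpace ℝ (Fin d) → H}, LocallyIntegrable F →
      LocallyIntegrable fun x => k x • F x := fun hF => by
    rw [← locallyIntegrableOn_univ] at hF ⊢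
    exact hF.continuousOn_smul isOpen_univ.isLocallyClosed hk.continuous.continuousOn
  have hl2 : LocallyIntegrable fun x => f x • gradient k x := by
    have hF := h.locallyIntegrable_fun
    rw [← locallyIntegrableOn_univ] at hF ⊢
    exact hF.smul_continuousOn isOpen_univ.isLocallyClosed hkg.continuousOn
  refine ⟨hl h.locallyIntegrable_fun, (hl h.locallyIntegrable_grad).add hl2, fun φ hφ hφc => ?_⟩
  have hT : IsTest univ φ := ⟨hφ, hφc, subset_univ _⟩
  have hkφ : IsTest univ fun x => k x * φ x := hT.smooth_mul fun _ _ => hk.contDiffAt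
  have i1 := h.locallyIntegrable_fun.integrable_smul_right_of_hasCompactSupport
    hkφ.continuous_gradient hkφ.hasCompactSupport_gradient
  have i2 : Integrable fun x => φ x • f x • gradient k x :=
    hl2.integrable_smul_left_of_hasCompactSupport hT.continuous hφc
  have i3 : Integrable fun x => φ x • k x • G x :=
    (hl h.locallyIntegrable_grad).integrable_smul_left_of_hasCompactSupport hT.continuous hφc
  have e : ∀ x, (k x * f x) • gradient φ x =
      f x • gradient (fun x => k x * φ x) x - φ x • f x • gradient k x := fun x => by
    rw [gradient_mul (hk.differentiable (by simp) x) (hT.differentiable x), smul_add, smul_smul,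
      smul_smul, smul_smul, mul_comm (φ x), add_sub_cancel_right, mul_comm]
  simp only [e, smul_add]
  rw [integral_sub i1 i2, integral_add i3 i2, h.integral_eq _ hkφ.contDiff hkφ.hasCompactSupport]
  simp only [mul_smul, smul_comm (k _)]
  abel

theorem MemLp.smul_of_weight {H : Type*} [NormedAddCommGroup H] [NormedSpace ℝ H] {β : ℝ}
    {F : EuclideanSpace ℝ (Fin d) → H} (hF : MemLp F 2 (weightMeasure d β)) (hk : Continuous k)
    (hkc : HasCompactSupport k) : MemLp (fun x => k x • F x) 2 volume := by
  have hc : Continuous fun x => k x * (1 + ‖x‖ ^ 2) ^ (-(β / 2)) :=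
    hk.mul (continuous_one_add_norm_sq_rpow _)
  obtain ⟨C, hC⟩ := (hkc.mul_right (f' := fun x => (1 + ‖x‖ ^ 2) ^ (-(β / 2)))
    ).exists_bound_of_continuous hc
  refine (memLp_smul_of_le hc hC (memLp_weightMeasure_iff.1 hF)).ae_eq
    (Eventually.of_forall fun x => ?_)
  simp only
  rw [smul_smul, mul_assoc, ← Real.rpow_add (by positivity), neg_add_cancel, Real.rpow_zero,
    mul_one]

theorem hasCompactSupport_gradient (hk : HasCompactSupport k) : HasCompactSupport (gradient k) :=
  (hk.fderiv ℝ).comp_left (g := (InnerProductSpace.toDual ℝ _).symm) (map_zero _)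

theorem tendsto_integral_farCutoff_mul {F : EuclideanSpace ℝ (Fin d) → ℝ} (hF : Integrable F) :
    Tendsto (fun n : ℕ => ∫ x, farCutoff ((n : ℝ) + 1) x * F x) atTop (𝓝 (∫ x, F x)) := by
  refine tendsto_integral_of_dominated_convergence (fun x => ‖F x‖)
    (fun n => (contDiff_farCutoff _).continuous.aestronglyMeasurable.mul hF.1) hF.norm
    (fun n => Eventually.of_forall fun x => ?_) (Eventually.of_forall fun x => ?_)
  · rw [norm_mul]
    exact mul_le_of_le_one_left (norm_nonneg _) (abs_smoothTransition_le _)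
  · refine tendsto_const_nhds.congr' ?_
    filter_upwards [eventually_farCutoff x] with n hn
    rw [farCutoff_eq_one hn, one_mul]

/-- A pair annihilating all test functions supported away from the origin annihilates the form
domain. -/
theorem IsFormElement.integral_eq_zero (hd : 2 ≤ d) (hα : α ≤ 0)
    (hu : MemLp u 2 (weightMeasure d (α - 1))) (hV : MemLp V 2 (weightMeasure d α))
    (h : ∀ φ, IsTest ({0}ᶜ) φ → (∫ x, u x * φ x ∂(weightMeasure d (α - 1))) +
      ∫ x, ⟪V x, gradient φ x⟫ ∂(weightMeasure d α) = 0) (hf : IsFormElement α f G) :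
    (∫ x, u x * f x ∂(weightMeasure d (α - 1))) + ∫ x, ⟪V x, G x⟫ ∂(weightMeasure d α) = 0 := by
  obtain ⟨C, hC0, hC⟩ := exists_norm_gradient_farCutoff_le d
  have hfw := memLp_weightMeasure_iff.1 hf.memLp_fun
  have hVw := memLp_weightMeasure_iff.1 hV
  have hfG := hf.isWeakGradient
  have hU2 := MemLp.weight_smul (by linarith) hu
  have hW2 := MemLp.weight_smul hα hV
  have i1 := integrable_weightMeasure_iff.1 (hu.integrable_mul hf.memLp_fun)
  have i2 := integrable_weightMeasure_iff.1 (integrable_inner_of_memLp hV hf.memLp_grad)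
  have i3 := (hVw.norm.integrable_mul hfw.norm).const_mul C
  simp only [integral_weightMeasure] at h ⊢
  have hχ : ∀ n : ℕ, ContDiff ℝ ∞ (farCutoff (d := d) ((n : ℝ) + 1)) := fun n =>
    contDiff_farCutoff _
  have hχc : ∀ n : ℕ, HasCompactSupport (farCutoff (d := d) ((n : ℝ) + 1)) := fun n =>
    hasCompactSupport_farCutoff (by positivity)
  have hfχ : ∀ n : ℕ, MemLp (fun x => f x • gradient (farCutoff ((n : ℝ) + 1)) x) 2 := fun n => by
    have hg := continuous_gradient_of_contDiff (hχ n)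
    refine (MemLp.smul_of_weight hf.memLp_fun hg.norm
      (hasCompactSupport_gradient (hχc n)).norm).mono ?_ (Eventually.of_forall fun x => ?_)
    · exact (hf.isWeakGradient.locallyIntegrable_fun.aestronglyMeasurable).smul
        hg.aestronglyMeasurable
    · rw [norm_smul, norm_smul, norm_norm, mul_comm]
  -- The truncated function has compact support, so after the weights are absorbed into u and V the
  -- two preceding reductions apply: first from the punctured space to all test functions, then to
  -- compactly supported Sobolev functions.
  have hloc : ∀ n : ℕ, ((∫ x, ((1 + ‖x‖ ^ 2) ^ (α - 1) • u x) *
      (farCutoff ((n : ℝ) + 1) x * f x)) + ∫ x, ⟪(1 + ‖x‖ ^ 2) ^ α • V x,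
        farCutoff ((n : ℝ) + 1) x • G x + f x • gradient (farCutoff ((n : ℝ) + 1)) x⟫) = 0 :=
    fun n => by
    refine (hfG.smul_of_contDiff (hχ n)).integral_eq_zero_of_hasCompactSupport hU2 hW2
      (fun φ hφ => integral_eq_zero_of_isTest_compl_zero hd hU2 hW2 (fun ψ hψ => ?_) hφ)
      (MemLp.smul_of_weight hf.memLp_fun (hχ n).continuous (hχc n))
      ((MemLp.smul_of_weight hf.memLp_grad (hχ n).continuous (hχc n)).add (hfχ n)) (hχc n).mul_right
    · rw [← h ψ hψ]
      simp only [smul_eq_mul, mul_assoc, inner_smul_left]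
      simp
  -- Since α - 1/2 = α/2 + (α-1)/2, the decay of the cutoff gradient lets the integrand be dominated
  -- by a product of two square integrable functions, one weighted for V and one for f.
  have t3 : Tendsto (fun n : ℕ => ∫ x, f x * ⟪(1 + ‖x‖ ^ 2) ^ α • V x,
      gradient (farCutoff ((n : ℝ) + 1)) x⟫) atTop (𝓝 0) := by
    rw [← integral_zero (EuclideanSpace ℝ (Fin d)) ℝ (μ := volume)]
    refine tendsto_integral_of_dominated_convergence _
      (fun n => hf.isWeakGradient.locallyIntegrable_fun.aestronglyMeasurable.mul
        (hW2.1.inner (continuous_gradient_of_contDiff (hχ n)).aestronglyMeasurable)) i3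
      (fun n => Eventually.of_forall fun x => ?_) (Eventually.of_forall fun x => ?_)
    · have hw : 0 ≤ (1 + ‖x‖ ^ 2) ^ α := by positivity
      have e : (1 + ‖x‖ ^ 2) ^ α * (1 + ‖x‖ ^ 2) ^ (-(1 / 2) : ℝ) =
          (1 + ‖x‖ ^ 2) ^ (α / 2) * (1 + ‖x‖ ^ 2) ^ ((α - 1) / 2) := by
        rw [← Real.rpow_add (by positivity), ← Real.rpow_add (by positivity)]
        ring_nf
      rw [norm_mul]
      calc ‖f x‖ * ‖⟪(1 + ‖x‖ ^ 2) ^ α • V x, gradient (farCutoff ((n : ℝ) + 1)) x⟫‖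
          ≤ ‖f x‖ * (((1 + ‖x‖ ^ 2) ^ α * ‖V x‖) * (C * (1 + ‖x‖ ^ 2) ^ (-(1 / 2) : ℝ))) := by
            refine mul_le_mul_of_nonneg_left ((norm_inner_le_norm _ _).trans ?_) (norm_nonneg _)
            rw [norm_smul, Real.norm_of_nonneg hw]
            exact mul_le_mul_of_nonneg_left (hC _ (by
              linarith [(Nat.cast_nonneg n : (0 : ℝ) ≤ n)]) x) (by positivity)
        _ = ‖f x‖ * ‖V x‖ * C * ((1 + ‖x‖ ^ 2) ^ α * (1 + ‖x‖ ^ 2) ^ (-(1 / 2) : ℝ)) := by ring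
        _ = _ := by
            rw [e]
            simp only [Pi.mul_apply, norm_smul]
            rw [Real.norm_of_nonneg (by positivity : 0 ≤ (1 + ‖x‖ ^ 2) ^ (α / 2)),
              Real.norm_of_nonneg (by positivity : 0 ≤ (1 + ‖x‖ ^ 2) ^ ((α - 1) / 2))]
            ring
    · refine tendsto_const_nhds.congr' ?_
      filter_upwards [eventually_farCutoff x] with n hn
      rw [gradient_farCutoff_eq_zero hn, inner_zero_right, mul_zero]
  have hsum := ((tendsto_integral_farCutoff_mul i1).add (tendsto_integral_farCutoff_mul i2)).add t3
  rw [add_zero] at hsum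
  refine tendsto_nhds_unique (hsum.congr fun n => ?_) tendsto_const_nhds
  have i3' : Integrable fun x => f x * ⟪(1 + ‖x‖ ^ 2) ^ α • V x,
      gradient (farCutoff ((n : ℝ) + 1)) x⟫ := by
    simpa only [real_inner_smul_right] using integrable_inner_of_memLp hW2 (hfχ n)
  rw [← hloc n, add_assoc, ← integral_add (i2.bdd_mul (c := 1)
    (hχ n).continuous.aestronglyMeasurable
    (Eventually.of_forall fun x => abs_smoothTransition_le _)) i3']
  congr 1
  · refine integral_congr_ae (Eventually.of_forall fun x => ?_)
    simp only [Pi.mul_apply, smul_eq_mul]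
    ring
  · refine integral_congr_ae (Eventually.of_forall fun x => ?_)
    simp only
    simp only [inner_add_right, real_inner_smul_right, real_inner_smul_left, smul_eq_mul]

end FarCutoff

/-! ### Density of test functions in the form domain -/

section FormSpace

variable {d : ℕ} {α : ℝ} {f φ : EuclideanSpace ℝ (Fin d) → ℝ}
  {G : EuclideanSpace ℝ (Fin d) → EuclideanSpace ℝ (Fin d)}

theorem isWeakGradient_gradient (hf : ContDiff ℝ ∞ f) : IsWeakGradient f (gradient f) := by
  have hg := continuous_gradient_of_contDiff hf
  refine ⟨hf.continuous.locallyIntegrable, hg.locallyIntegrable, fun φ hφ hφc => ?_⟩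
  have hT : IsTest univ φ := ⟨hφ, hφc, subset_univ _⟩
  refine ext_inner_left ℝ fun v => ?_
  rw [inner_neg_right, ← integral_inner (hf.continuous.locallyIntegrable
      |>.integrable_smul_right_of_hasCompactSupport hT.continuous_gradient
        hT.hasCompactSupport_gradient), ← integral_inner
      (hg.locallyIntegrable.integrable_smul_left_of_hasCompactSupport hT.continuous hφc)]
  have e : ∀ (g : EuclideanSpace ℝ (Fin d) → ℝ) (x : EuclideanSpace ℝ (Fin d)),
      ⟪v, gradient g x⟫ = fderiv ℝ g x v := fun g x => by rw [real_inner_comm, inner_gradient]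
  simp only [real_inner_smul_right, e]
  have h1 := integral_mul_fderiv_eq_neg_fderiv_mul_of_integrable (μ := volume) (f := f) (g := φ)
    (v := v) ?_ ?_ ?_ (fun x _ => hf.differentiable (by simp) x) fun x _ => hT.differentiable x
  · rw [h1]
    simp only [mul_comm]
  · exact ((hT.smooth_mul (g := fun x => fderiv ℝ f x v) fun x _ => ((hf.fderiv_right (m := ∞)
      (by simp)).clm_apply contDiff_const).contDiffAt)).integrable
  · exact ((hT.fderiv_apply v).smooth_mul fun x _ => hf.contDiffAt).integrable
  · exact (hT.smooth_mul fun x _ => hf.contDiffAt).integrable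

theorem memLp_weightMeasure_of_hasCompactSupport {H : Type*} [NormedAddCommGroup H]
    [NormedSpace ℝ H] {F : EuclideanSpace ℝ (Fin d) → H} (hF : Continuous F)
    (hFc : HasCompactSupport F) (β : ℝ) : MemLp F 2 (weightMeasure d β) :=
  memLp_weightMeasure_iff.2 (((continuous_one_add_norm_sq_rpow _).smul
    hF).memLp_of_hasCompactSupport hFc.smul_left)

theorem IsTest.isFormElement {Ω : Set (EuclideanSpace ℝ (Fin d))} (hφ : IsTest Ω φ) (α : ℝ) :
    IsFormElement α φ (gradient φ) :=
  ⟨memLp_weightMeasure_of_hasCompactSupport hφ.continuous hφ.hasCompactSupport _,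
    memLp_weightMeasure_of_hasCompactSupport hφ.continuous_gradient hφ.hasCompactSupport_gradient _,
    isWeakGradient_gradient hφ.contDiff⟩

theorem IsWeakGradient.sub {f₁ f₂ : EuclideanSpace ℝ (Fin d) → ℝ}
    {G₁ G₂ : EuclideanSpace ℝ (Fin d) → EuclideanSpace ℝ (Fin d)} (h₁ : IsWeakGradient f₁ G₁)
    (h₂ : IsWeakGradient f₂ G₂) :
    IsWeakGradient (fun x => f₁ x - f₂ x) fun x => G₁ x - G₂ x := by
  refine ⟨h₁.1.sub h₂.1, h₁.2.sub h₂.2, fun φ hφ hφc => ?_⟩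
  have hT : IsTest univ φ := ⟨hφ, hφc, subset_univ _⟩
  simp only [sub_smul, smul_sub]
  rw [integral_sub, integral_sub, h₁.3 φ hφ hφc, h₂.3 φ hφ hφc]
  · abel
  · exact h₁.2.integrable_smul_left_of_hasCompactSupport hT.continuous hφc
  · exact h₂.2.integrable_smul_left_of_hasCompactSupport hT.continuous hφc
  · exact h₁.1.integrable_smul_right_of_hasCompactSupport hT.continuous_gradient
      hT.hasCompactSupport_gradient
  · exact h₂.1.integrable_smul_right_of_hasCompactSupport hT.continuous_gradient
      hT.hasCompactSupport_gradient

theorem IsFormElement.sub {f₁ f₂ : EuclideanSpace ℝ (Fin d) → ℝ}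
    {G₁ G₂ : EuclideanSpace ℝ (Fin d) → EuclideanSpace ℝ (Fin d)} (h₁ : IsFormElement α f₁ G₁)
    (h₂ : IsFormElement α f₂ G₂) :
    IsFormElement α (fun x => f₁ x - f₂ x) fun x => G₁ x - G₂ x :=
  ⟨h₁.1.sub h₂.1, h₁.2.sub h₂.2, h₁.3.sub h₂.3⟩

/-- The Hilbert space containing the graph of the gradient. -/
abbrev FormSpace (d : ℕ) (α : ℝ) : Type :=
  WithLp 2 (Lp ℝ 2 (weightMeasure d (α - 1)) × Lp (EuclideanSpace ℝ (Fin d)) 2 (weightMeasure d α))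

/-- The element of the Hilbert space given by a function of the form domain. -/
def IsFormElement.toFormSpace (h : IsFormElement α f G) : FormSpace d α :=
  WithLp.toLp 2 (h.memLp_fun.toLp f, h.memLp_grad.toLp G)

theorem IsFormElement.toFormSpace_eq {f' : EuclideanSpace ℝ (Fin d) → ℝ}
    {G' : EuclideanSpace ℝ (Fin d) → EuclideanSpace ℝ (Fin d)} (h : IsFormElement α f G)
    (h' : IsFormElement α f' G') (hf : f = f') (hG : G = G') : h.toFormSpace = h'.toFormSpace := by
  subst hf hG; rfl

theorem gradient_add {g : EuclideanSpace ℝ (Fin d) → ℝ} (hf : Differentiable ℝ f)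
    (hg : Differentiable ℝ g) :
    gradient (fun x => f x + g x) = fun x => gradient f x + gradient g x := by
  ext1 x
  refine ext_inner_right ℝ fun v => ?_
  rw [inner_gradient, fderiv_fun_add (hf x) (hg x), inner_add_left, inner_gradient, inner_gradient]
  rfl

theorem gradient_const_mul (hf : Differentiable ℝ f) (c : ℝ) :
    gradient (fun x => c * f x) = fun x => c • gradient f x := by
  ext1 x
  refine ext_inner_right ℝ fun v => ?_
  rw [inner_gradient, fderiv_const_mul (hf x), real_inner_smul_left, inner_gradient]
  rfl

/-- The test functions supported away from the origin inside the Hilbert space. -/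
def testSpace (d : ℕ) (α : ℝ) : Submodule ℝ (FormSpace d α) where
  carrier := {v | ∃ (φ : EuclideanSpace ℝ (Fin d) → ℝ) (hφ : IsTest ({0}ᶜ) φ),
    v = (hφ.isFormElement α).toFormSpace}
  zero_mem' := by
    refine ⟨_, IsTest.zero, ?_⟩
    have h : gradient (fun _ : EuclideanSpace ℝ (Fin d) => (0 : ℝ)) = fun _ => 0 :=
      funext fun x => by simp [gradient]
    rw [IsFormElement.toFormSpace_eq ((IsTest.zero (Ω := {0}ᶜ)).isFormElement α) (h ▸ (IsTest.zero (Ω := {0}ᶜ)).isFormElement α)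
      rfl h]
    rfl
  add_mem' := by
    rintro _ _ ⟨φ, hφ, rfl⟩ ⟨ψ, hψ, rfl⟩
    refine ⟨_, hφ.add hψ, ?_⟩
    have h := gradient_add hφ.differentiable hψ.differentiable
    rw [IsFormElement.toFormSpace_eq ((hφ.add hψ).isFormElement α)
      (h ▸ (hφ.add hψ).isFormElement α) rfl h]
    rfl
  smul_mem' := by
    rintro c _ ⟨φ, hφ, rfl⟩
    refine ⟨_, hφ.const_mul c, ?_⟩
    have h := gradient_const_mul hφ.differentiable c
    rw [IsFormElement.toFormSpace_eq ((hφ.const_mul c).isFormElement α)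
      (h ▸ (hφ.const_mul c).isFormElement α) rfl h]
    rfl

theorem IsFormElement.toFormSpace_sub {f₁ f₂ : EuclideanSpace ℝ (Fin d) → ℝ}
    {G₁ G₂ : EuclideanSpace ℝ (Fin d) → EuclideanSpace ℝ (Fin d)} (h₁ : IsFormElement α f₁ G₁)
    (h₂ : IsFormElement α f₂ G₂) :
    (h₁.sub h₂).toFormSpace = h₁.toFormSpace - h₂.toFormSpace := rfl

theorem inner_toFormSpace (v : FormSpace d α) (h : IsFormElement α f G) :
    ⟪v, h.toFormSpace⟫ = (∫ x, v.fst x * f x ∂(weightMeasure d (α - 1))) +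
      ∫ x, ⟪v.snd x, G x⟫ ∂(weightMeasure d α) := by
  rw [WithLp.prod_inner_apply, L2.inner_def, L2.inner_def]
  congr 1
  · refine integral_congr_ae ?_
    filter_upwards [h.memLp_fun.coeFn_toLp] with x hx
    change ⟪v.fst x, h.memLp_fun.toLp f x⟫ = _
    rw [hx]
    simp [mul_comm]
  · refine integral_congr_ae ?_
    filter_upwards [h.memLp_grad.coeFn_toLp] with x hx
    change ⟪v.snd x, h.memLp_grad.toLp G x⟫ = _
    rw [hx]

/-- The closure is the double orthogonal complement. A vector orthogonal to the test space is a pair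
annihilating all test functions, hence one annihilating the form domain. -/
theorem IsFormElement.toFormSpace_mem_closure (hd : 2 ≤ d) (hα : α ≤ 0)
    (h : IsFormElement α f G) : h.toFormSpace ∈ (testSpace d α).topologicalClosure := by
  rw [← Submodule.orthogonal_orthogonal_eq_closure, Submodule.mem_orthogonal]
  intro v hv
  rw [Submodule.mem_orthogonal'] at hv
  rw [inner_toFormSpace]
  refine h.integral_eq_zero hd hα (Lp.memLp v.fst) (Lp.memLp v.snd) fun φ hφ => ?_
  rw [← hv _ ⟨φ, hφ, rfl⟩, inner_toFormSpace]

/-- The map R extends a linear right inverse of ℓ restricted to K, and is continuous because F is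
finite-dimensional. Then e ↦ e - R(ℓ e) sends K into K ∩ ker ℓ, which lets approximation by K
respect finitely many linear constraints. -/
theorem exists_finiteDimensional_correction {E F : Type*} [NormedAddCommGroup E] [NormedSpace ℝ E]
    [NormedAddCommGroup F] [NormedSpace ℝ F] [FiniteDimensional ℝ F] (K : Submodule ℝ E)
    (ℓ : E →L[ℝ] F) : ∃ R : F →L[ℝ] E, (∀ y, R y ∈ K) ∧ ∀ e ∈ K, ℓ (R (ℓ e)) = ℓ e := by
  obtain ⟨g, hg⟩ := LinearMap.exists_rightInverse_of_surjective
    ((ℓ : E →ₗ[ℝ] F).domRestrict K).rangeRestrict (LinearMap.range_rangeRestrict _)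
  obtain ⟨R, hR⟩ := LinearMap.exists_extend g
  refine ⟨(K.subtype ∘ₗ R).toContinuousLinearMap, fun y => (R y).2, fun e he => ?_⟩
  have h1 : ℓ e ∈ ((ℓ : E →ₗ[ℝ] F).domRestrict K).range := ⟨⟨e, he⟩, rfl⟩
  have h2 : R (ℓ e) = g ⟨ℓ e, h1⟩ := LinearMap.congr_fun hR ⟨ℓ e, h1⟩
  have h3 := congrArg Subtype.val (LinearMap.congr_fun hg ⟨ℓ e, h1⟩)
  exact (congrArg ℓ (congrArg Subtype.val h2)).trans h3

end FormSpace

theorem lintegral_enorm_sq_of_memLp {X H : Type*} [MeasurableSpace X] [NormedAddCommGroup H]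
    {μ : Measure X} {F : X → H} (hF : MemLp F 2 μ) :
    ∫⁻ x, ‖F x‖ₑ ^ 2 ∂μ = ENNReal.ofReal (∫ x, ‖F x‖ ^ 2 ∂μ) := by
  rw [ofReal_integral_eq_lintegral_ofReal ((memLp_two_iff_integrable_sq_norm hF.1).1 hF)
    (Eventually.of_forall fun x => by positivity)]
  refine lintegral_congr fun x => ?_
  rw [ENNReal.ofReal_pow (norm_nonneg _), ofReal_norm]

theorem integrable_smul_of_memLp {X H : Type*} [MeasurableSpace X] [NormedAddCommGroup H]
    [NormedSpace ℝ H] {μ : Measure X} {k : X → ℝ} {F : X → H} (hk : MemLp k 2 μ)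
    (hF : MemLp F 2 μ) : Integrable (fun x => k x • F x) μ :=
  (hk.norm.integrable_mul hF.norm).mono (hk.1.smul hF.1)
    (Eventually.of_forall fun x => by simp [norm_smul])

/-! ### The moment conditions and passage to the form domain -/

section Moments

variable {d : ℕ} {α Λ : ℝ} {f φ : EuclideanSpace ℝ (Fin d) → ℝ}
  {G : EuclideanSpace ℝ (Fin d) → EuclideanSpace ℝ (Fin d)}

/-- If the weak gradient has infinite energy there is nothing to prove. Otherwise f is in the form
domain and both sides are real integrals. -/
theorem hardyPoincareInequality_iff : HardyPoincareInequality d α Λ ↔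
    ∀ f G, IsFormElement α f G → IsAdmissible α f →
      Λ * ∫ x : EuclideanSpace ℝ (Fin d), f x ^ 2 ∂(weightMeasure d (α - 1)) ≤
        ∫ x, ‖G x‖ ^ 2 ∂(weightMeasure d α) := by
  have key : ∀ f G, IsFormElement (d := d) α f G →
      (ENNReal.ofReal Λ * ∫⁻ x, ‖f x‖ₑ ^ 2 ∂(weightMeasure d (α - 1)) ≤
        ∫⁻ x, ‖G x‖ₑ ^ 2 ∂(weightMeasure d α) ↔
      Λ * ∫ x : EuclideanSpace ℝ (Fin d), f x ^ 2 ∂(weightMeasure d (α - 1)) ≤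
        ∫ x, ‖G x‖ ^ 2 ∂(weightMeasure d α)) := fun f G h => by
    have h0 : 0 ≤ ∫ x, ‖f x‖ ^ 2 ∂(weightMeasure d (α - 1)) :=
      integral_nonneg fun _ => sq_nonneg _
    have h1 : 0 ≤ ∫ x, ‖G x‖ ^ 2 ∂(weightMeasure d α) := integral_nonneg fun _ => sq_nonneg _
    rw [lintegral_enorm_sq_of_memLp h.memLp_fun, lintegral_enorm_sq_of_memLp h.memLp_grad,
      ← ENNReal.ofReal_mul' h0, ENNReal.ofReal_le_ofReal_iff h1]
    simp only [Real.norm_eq_abs, sq_abs]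
  refine ⟨fun h f G hf ha => ?_, fun h f ha => ?_⟩
  · rw [← key f G hf]
    exact (h f ha).trans (iInf₂_le G hf.isWeakGradient)
  · refine le_iInf₂ fun G hG => ?_
    by_cases hfin : ∫⁻ x, ‖G x‖ₑ ^ 2 ∂(weightMeasure d α) = ⊤
    · rw [hfin]; exact le_top
    · have hGL : MemLp G 2 (weightMeasure d α) := by
        refine ⟨aestronglyMeasurable_weightMeasure_iff.2
          hG.locallyIntegrable_grad.aestronglyMeasurable, ?_⟩
        rw [eLpNorm_lt_top_iff_lintegral_rpow_enorm_lt_top (by simp) (by simp)]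
        simpa using lt_top_iff_ne_top.2 hfin
      have hf : IsFormElement α f G := ⟨ha.memLp, hGL, hG⟩
      exact (key f G hf).2 (h f G hf ha)

/-- The functions `1`, `|x|²` and the coordinates. -/
def moment : Option (Option (Fin d)) → EuclideanSpace ℝ (Fin d) → ℝ
  | none, _ => 1
  | some none, x => ‖x‖ ^ 2
  | some (some i), x => x i

theorem continuous_moment (k : Option (Option (Fin d))) : Continuous (moment k) := by
  rcases k with _ | _ | i
  · exact continuous_const
  · exact (continuous_norm.pow 2)
  · exact (contDiff_coord i).continuous

theorem moment_sq_le (k : Option (Option (Fin d))) (x : EuclideanSpace ℝ (Fin d)) :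
    moment k x ^ 2 ≤ (1 + ‖x‖ ^ 2) ^ 2 := by
  have h := sq_nonneg ‖x‖
  rcases k with _ | _ | i <;> simp only [moment]
  · nlinarith
  · nlinarith
  · have h1 : x i ^ 2 ≤ ‖x‖ ^ 2 := by
      rw [← sq_abs]
      exact pow_le_pow_left₀ (abs_nonneg _) (PiLp.norm_apply_le x i) 2
    nlinarith

theorem integrable_one_add_norm_sq_rpow {β : ℝ} (hβ : β < -(d : ℝ) / 2) :
    Integrable fun x : EuclideanSpace ℝ (Fin d) => (1 + ‖x‖ ^ 2) ^ β := by
  have := integrable_rpow_neg_one_add_norm_sq (E := EuclideanSpace ℝ (Fin d)) (μ := volume)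
    (r := -2 * β) (by rw [finrank_euclideanSpace_fin]; linarith)
  simpa using this

/-- The extreme case is |x|²: it requires (1+|x|²)^(α+1) to be integrable, that is α + 1 < -d/2,
which is the standing bound on α. -/
theorem memLp_moment (hα : α < -((d : ℝ) + 2) / 2) (k : Option (Option (Fin d))) :
    MemLp (moment k) 2 (weightMeasure d (α - 1)) := by
  have hc := continuous_moment k
  rw [memLp_weightMeasure_iff_integrable hc.aestronglyMeasurable]
  refine (integrable_one_add_norm_sq_rpow (β := α + 1) (by linarith)).mono'
    ((continuous_one_add_norm_sq_rpow _).mul (hc.norm.pow 2)).aestronglyMeasurable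
    (Eventually.of_forall fun x => ?_)
  rw [Real.norm_of_nonneg (by positivity), Real.norm_eq_abs, sq_abs]
  calc (1 + ‖x‖ ^ 2) ^ (α - 1) * moment k x ^ 2
      ≤ (1 + ‖x‖ ^ 2) ^ (α - 1) * (1 + ‖x‖ ^ 2) ^ 2 :=
        mul_le_mul_of_nonneg_left (moment_sq_le k x) (by positivity)
    _ = (1 + ‖x‖ ^ 2) ^ (α + 1) := by
      rw [← Real.rpow_add_natCast (by positivity)]
      norm_num
      ring_nf

theorem isAdmissible_iff (hα : α < -((d : ℝ) + 2) / 2) :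
    IsAdmissible α f ↔ MemLp f 2 (weightMeasure d (α - 1)) ∧
      ∀ k, ∫ x, moment k x * f x ∂(weightMeasure d (α - 1)) = 0 := by
  have hx : MemLp (fun x : EuclideanSpace ℝ (Fin d) => x) 2 (weightMeasure d (α - 1)) := by
    refine ((memLp_moment hα none).add (memLp_moment hα (some none))).mono
      continuous_id.aestronglyMeasurable (Eventually.of_forall fun x => ?_)
    change ‖x‖ ≤ ‖1 + ‖x‖ ^ 2‖
    rw [Real.norm_of_nonneg (by positivity)]
    nlinarith [sq_nonneg (‖x‖ - 1)]
  have hcoord : MemLp f 2 (weightMeasure d (α - 1)) → ∀ i : Fin d,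
      (∫ x, f x • x ∂(weightMeasure d (α - 1))) i =
        ∫ x, moment (some (some i)) x * f x ∂(weightMeasure d (α - 1)) := fun hf i => by
    have hi : Integrable (fun x => f x • x) (weightMeasure d (α - 1)) :=
      integrable_smul_of_memLp hf hx
    have := (EuclideanSpace.proj i : EuclideanSpace ℝ (Fin d) →L[ℝ] ℝ).integral_comp_comm hi
    refine this.symm.trans (integral_congr_ae (Eventually.of_forall fun x => ?_))
    simp [moment, mul_comm]
  refine ⟨fun h => ⟨h.memLp, ?_⟩, fun h => ⟨h.1, ?_, ?_, ?_⟩⟩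
  · rintro (_ | _ | i)
    · simpa [moment] using h.integral_eq_zero
    · exact h.integral_sq_mul_eq_zero
    · rw [← hcoord h.memLp, h.integral_smul_eq_zero]; rfl
  · simpa [moment] using h.2 none
  · ext i
    rw [hcoord h.1, h.2]; rfl
  · exact h.2 (some none)

/-- The moments as a continuous linear map. -/
def momentMap (hα : α < -((d : ℝ) + 2) / 2) :
    FormSpace d α →L[ℝ] (Option (Option (Fin d)) → ℝ) :=
  ContinuousLinearMap.pi fun k =>
    (innerSL ℝ ((memLp_moment hα k).toLp (moment k))).comp (WithLp.fstL 2 ℝ _ _)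

theorem momentMap_toFormSpace (hα : α < -((d : ℝ) + 2) / 2) (h : IsFormElement α f G)
    (k : Option (Option (Fin d))) :
    momentMap hα h.toFormSpace k = ∫ x, moment k x * f x ∂(weightMeasure d (α - 1)) := by
  have : momentMap hα h.toFormSpace k =
    ⟪(memLp_moment hα k).toLp (moment k), h.memLp_fun.toLp f⟫ := rfl
  rw [this, inner_toLp_toLp]
  simp [mul_comm]

theorem IsFormElement.norm_sq_fst (h : IsFormElement α f G) :
    ‖h.toFormSpace.fst‖ ^ 2 = ∫ x, f x ^ 2 ∂(weightMeasure d (α - 1)) := by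
  have := norm_toLp_sq h.memLp_fun
  simp only [Real.norm_eq_abs, sq_abs] at this
  exact this

theorem IsFormElement.norm_sq_snd (h : IsFormElement α f G) :
    ‖h.toFormSpace.snd‖ ^ 2 = ∫ x, ‖G x‖ ^ 2 ∂(weightMeasure d α) := norm_toLp_sq h.memLp_grad

theorem isAdmissible_iff_momentMap (hα : α < -((d : ℝ) + 2) / 2) (h : IsFormElement α f G) :
    IsAdmissible α f ↔ momentMap hα h.toFormSpace = 0 := by
  rw [isAdmissible_iff hα, and_iff_right h.memLp_fun, funext_iff]
  simp only [momentMap_toFormSpace, Pi.zero_apply]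

/-- The inequality follows from its validity for test functions supported away from the origin. -/
theorem hardyPoincareInequality_of_isTest (hd : 2 ≤ d) (hα : α < -((d : ℝ) + 2) / 2)
    (h : ∀ φ : EuclideanSpace ℝ (Fin d) → ℝ, IsTest ({0}ᶜ) φ → IsAdmissible α φ →
      Λ * ∫ x, φ x ^ 2 ∂(weightMeasure d (α - 1)) ≤
        ∫ x, ‖gradient φ x‖ ^ 2 ∂(weightMeasure d α)) : HardyPoincareInequality d α Λ := by
  have hα0 : α ≤ 0 := by linarith [(Nat.cast_nonneg d : (0 : ℝ) ≤ d)]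
  rw [hardyPoincareInequality_iff]
  intro f G hf ha
  obtain ⟨R, hR, hR'⟩ := exists_finiteDimensional_correction (testSpace d α) (momentMap hα)
  -- The inequality for e with its moments corrected is a closed condition on e. It holds on the
  -- test space because there the corrected vector is an admissible test function, and for an
  -- admissible element of the form domain the correction is zero.
  have hclosed : IsClosed {e : FormSpace d α | Λ * ‖(e - R (momentMap hα e)).fst‖ ^ 2 ≤
      ‖(e - R (momentMap hα e)).snd‖ ^ 2} := by
    have hT : Continuous fun e : FormSpace d α => e - R (momentMap hα e) := by fun_prop
    have h1 := (WithLp.continuous_fst 2 _ _).comp hT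
    have h2 := (WithLp.continuous_snd 2 _ _).comp hT
    exact isClosed_le (continuous_const.mul (h1.norm.pow 2)) (h2.norm.pow 2)
  have hsub : ((testSpace d α).topologicalClosure : Set (FormSpace d α)) ⊆
      {e | Λ * ‖(e - R (momentMap hα e)).fst‖ ^ 2 ≤ ‖(e - R (momentMap hα e)).snd‖ ^ 2} := by
    refine closure_minimal (fun e he => ?_) hclosed
    have he' : e ∈ testSpace d α := he
    obtain ⟨φ, hφ, hφe⟩ := (testSpace d α).sub_mem he' (hR (momentMap hα e))
    have hz : momentMap hα (e - R (momentMap hα e)) = 0 := by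
      rw [map_sub, hR' e he', sub_self]
    rw [hφe, ← isAdmissible_iff_momentMap] at hz
    rw [mem_ofPred_eq, hφe, IsFormElement.norm_sq_fst, IsFormElement.norm_sq_snd]
    exact h φ hφ hz
  have := hsub (hf.toFormSpace_mem_closure hd hα0)
  rw [mem_ofPred_eq, (isAdmissible_iff_momentMap hα hf).1 ha, map_zero, sub_zero,
    hf.norm_sq_fst, hf.norm_sq_snd] at this
  exact this

theorem le_of_isEigenfunction_of_isAdmissible {lam : ℝ} (hΛ : HardyPoincareInequality d α Λ)
    (ha : IsAdmissible α f) (hf : IsEigenfunction α lam f) : Λ ≤ lam := by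
  obtain ⟨hne, -, G, hG, hgraph⟩ := hf
  have h1 := hardyPoincareInequality_iff.1 hΛ f G hG ha
  have h2 := hgraph f G hG
  have hi : Integrable (fun x => f x ^ 2) (weightMeasure d (α - 1)) := ha.memLp.integrable_sq
  have h3 : 0 < ∫ x, f x ^ 2 ∂(weightMeasure d (α - 1)) := by
    refine lt_of_le_of_ne (integral_nonneg fun _ => sq_nonneg _) fun h0 => hne ?_
    have := (integral_eq_zero_iff_of_nonneg (fun _ => sq_nonneg _) hi).1 h0.symm
    rw [EventuallyEq, ae_weightMeasure] at this
    filter_upwards [this] with x hx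
    simpa using hx
  simp only [real_inner_self_eq_norm_sq, mul_assoc, ← pow_two] at h2
  rw [integral_const_mul] at h2
  rw [h2] at h1
  exact le_of_mul_le_mul_right h1 h3

end Moments

/-! ### The constants, and the lower bound on the essential spectrum -/

section Constants

variable {d : ℕ} {α Λ : ℝ} {f φ : EuclideanSpace ℝ (Fin d) → ℝ}
  {G : EuclideanSpace ℝ (Fin d) → EuclideanSpace ℝ (Fin d)}

theorem gradient_apply (f : EuclideanSpace ℝ (Fin d) → ℝ) (x : EuclideanSpace ℝ (Fin d))
    (i : Fin d) : gradient f x i = pd i f x := by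
  rw [HardyPoincare.pd, ← inner_gradient, EuclideanSpace.inner_single_right]
  simp

theorem IsTest.integral_norm_sq_gradient {Ω : Set (EuclideanSpace ℝ (Fin d))} (hφ : IsTest Ω φ)
    (α : ℝ) : ∫ x, ‖gradient φ x‖ ^ 2 ∂(weightMeasure d α) =
      dirichletForm (fun s => (1 + s) ^ α) φ φ := by
  rw [integral_weightMeasure, dirichletForm, ← integral_finsetSum]
  · refine integral_congr_ae (Eventually.of_forall fun x => ?_)
    simp only
    rw [← Finset.mul_sum, smul_eq_mul, EuclideanSpace.real_norm_sq_eq (gradient φ x)]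
    simp only [gradient_apply, ← pow_two]
  · intro i _
    have h := (hφ.mono (subset_univ _)).pd i
    exact ((h.mul h).smooth_mul (g := fun x => (1 + ‖x‖ ^ 2) ^ α) fun x _ =>
      ((contDiff_const.add (contDiff_norm_sq ℝ)).contDiffAt.rpow_const_of_ne
        (by positivity))).integrable

theorem hardyPoincareInequality_of_radialHardy (hd : 2 ≤ d) (hα : α < -((d : ℝ) + 2) / 2)
    {δ₁ δ₂ : ℝ}
    (H₁ : RadialHardy ((d : ℝ) / 2 + 2) (α + 1) δ₁) (hδ₁ : 0 ≤ δ₁ - ((d : ℝ) / 2 + 1 + α))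
    (H₂ : RadialHardy ((d : ℝ) / 2 + 2) (α + 2) δ₂) (hδ₂ : 0 ≤ δ₂ - ((d : ℝ) / 2 + α + 2))
    (hδ₂' : 0 ≤ δ₂ - 2 * ((d : ℝ) / 2 + α + 1))
    (hΛ₀ : Λ ≤ 4 * (δ₂ - 2 * ((d : ℝ) / 2 + α + 1)))
    (hΛ₁ : Λ ≤ -2 * α + 4 * (δ₁ - ((d : ℝ) / 2 + 1 + α))) (hΛ₂ : Λ ≤ -4 * α) :
    HardyPoincareInequality d α Λ := by
  refine hardyPoincareInequality_of_isTest hd hα fun φ hφ ha => ?_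
  have hα0 : α < 0 := by linarith [(Nat.cast_nonneg d : (0 : ℝ) ≤ d)]
  have hm := ((isAdmissible_iff hα).1 ha).2
  simp only [integral_weightMeasure, smul_eq_mul] at hm
  rw [hφ.integral_norm_sq_gradient, integral_weightMeasure]
  refine gap_of_isTest (by omega) hα0 H₁ hδ₁ H₂ hδ₂ hδ₂' hΛ₀ hΛ₁ hΛ₂ hφ ?_ (fun j => ?_) ?_
  · simpa [moment] using hm none
  · simpa [moment] using hm (some (some j))
  · simpa [moment] using hm (some none)

/-- With q = d/2 + α in [-3, -1), the radial sector gives (q+3)² - 8(q+1) = (q-1)², which is the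
constant. The linear sector has room to spare: for q ≥ -2 the Hardy inequality yields q² - 2α, and
for q ≤ -2 the trivial Hardy constant suffices. -/
theorem hardyPoincareInequality_quarter (hd : 2 ≤ d)
    (hα : α ∈ Ico (-((d : ℝ) + 6) / 2) (-((d : ℝ) + 2) / 2)) :
    HardyPoincareInequality d α (1 / 4 * ((d : ℝ) - 2 + 2 * α) ^ 2) := by
  have hd' : (2 : ℝ) ≤ d := by exact_mod_cast hd
  obtain ⟨h1, h2⟩ := hα
  have H₂ := radialHardy_sq (A := (d : ℝ) / 2 + 2) (B := α + 2) (γ := ((d : ℝ) / 2 + α + 3) / 2)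
    (by linarith) (by ring) (by linarith)
  rcases le_total (-2) ((d : ℝ) / 2 + α) with hq | hq
  · have H₁ := radialHardy_sq (A := (d : ℝ) / 2 + 2) (B := α + 1) (γ := ((d : ℝ) / 2 + α + 2) / 2)
      (by linarith) (by ring) (by linarith)
    refine hardyPoincareInequality_of_radialHardy hd h2 H₁ ?_ H₂ ?_ ?_ ?_ ?_ ?_ <;> nlinarith
  · have H₁ := radialHardy_zero ((d : ℝ) / 2 + 2) (α + 1)
    refine hardyPoincareInequality_of_radialHardy hd h2 H₁ ?_ H₂ ?_ ?_ ?_ ?_ ?_ <;> nlinarith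

/-- With trivial Hardy constants the three sectors give -8α - 4(d+2), -6α - 2(d+2) and -4α. They
coincide at α = -(d+2), and the first is the smallest to the right of that point. -/
theorem hardyPoincareInequality_radial (hd : 2 ≤ d)
    (hα : α ∈ Icc (-((d : ℝ) + 2)) (-((d : ℝ) + 6) / 2)) :
    HardyPoincareInequality d α (-8 * α - 4 * ((d : ℝ) + 2)) := by
  obtain ⟨h1, h2⟩ := hα
  refine hardyPoincareInequality_of_radialHardy hd (by linarith) (radialHardy_zero _ _) ?_
    (radialHardy_zero _ _) ?_ ?_ ?_ ?_ ?_ <;> linarith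

theorem hardyPoincareInequality_quadrupole (hd : 2 ≤ d) (hα : α ∈ Iic (-((d : ℝ) + 2))) :
    HardyPoincareInequality d α (-4 * α) := by
  have hd' : (2 : ℝ) ≤ d := by exact_mod_cast hd
  have h1 : α ≤ -((d : ℝ) + 2) := hα
  refine hardyPoincareInequality_of_radialHardy hd (by linarith) (radialHardy_zero _ _) ?_
    (radialHardy_zero _ _) ?_ ?_ ?_ ?_ ?_ <;> linarith

theorem tendsto_norm_sub_sq {E : Type*} [NormedAddCommGroup E] {a b : ℕ → E} {L : ℝ}
    (ha : Tendsto (fun n => ‖a n‖ ^ 2) atTop (𝓝 L)) (hb : Tendsto b atTop (𝓝 0)) :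
    Tendsto (fun n => ‖a n - b n‖ ^ 2) atTop (𝓝 L) := by
  have hL : 0 ≤ L := ge_of_tendsto' ha fun _ => sq_nonneg _
  have h1 : Tendsto (fun n => ‖a n‖) atTop (𝓝 √L) :=
    ((Real.continuous_sqrt.tendsto L).comp ha).congr fun n => by simp
  have h2 : Tendsto (fun n => ‖a n - b n‖ - ‖a n‖) atTop (𝓝 0) := by
    refine squeeze_zero_norm (fun n => ?_) (tendsto_zero_iff_norm_tendsto_zero.1 hb)
    have := abs_norm_sub_norm_le (a n - b n) (a n)
    rwa [sub_sub_cancel_left, norm_neg] at this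
  have h3 := (h2.add h1).pow 2
  simpa [Real.sq_sqrt hL] using h3

/-- Along a Weyl sequence the moments tend to zero by weak convergence, so the finite-rank
correction tends to zero in norm. The corrected vectors are admissible, and their norms and energies
tend to 1 and `lam`. -/
theorem le_of_mem_continuousSpectrum {lam : ℝ} (hd : 2 ≤ d) (hα : α < -((d : ℝ) + 2) / 2)
    (hΛ : HardyPoincareInequality d α Λ) (hlam : lam ∈ continuousSpectrum d α) : Λ ≤ lam := by
  have hα0 : α ≤ 0 := by linarith [(Nat.cast_nonneg d : (0 : ℝ) ≤ d)]
  obtain ⟨f, h, hgraph, hnorm, hweak, hres⟩ := hlam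
  choose hh G hG hform using hgraph
  obtain ⟨R, hR, hR'⟩ := exists_finiteDimensional_correction (testSpace d α) (momentMap hα)
  set e : ℕ → FormSpace d α := fun n => (hG n).toFormSpace
  have hfst : ∀ n, ‖(e n).fst‖ = 1 := fun n => by
    have := (hG n).norm_sq_fst
    rw [hnorm] at this
    exact (pow_eq_one_iff_of_nonneg (norm_nonneg _) two_ne_zero).1 this
  have hsnd : Tendsto (fun n => ‖(e n).snd‖ ^ 2) atTop (𝓝 lam) := by
    -- Testing the equation for f n with f n itself expresses the defect of the energy through the
    -- residual, which Cauchy–Schwarz then bounds.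
    have e1 : ∀ n, ‖(e n).snd‖ ^ 2 - lam =
        ∫ x, ⟪h n x - lam * f n x, f n x⟫ ∂(weightMeasure d (α - 1)) := fun n => by
      have i1 : Integrable (fun x => h n x * f n x) _ := (hh n).integrable_mul (hG n).memLp_fun
      have i2 := (hG n).memLp_fun.integrable_sq.const_mul lam
      have h2 := hform n _ _ (hG n)
      simp only [real_inner_self_eq_norm_sq] at h2
      rw [(hG n).norm_sq_snd, h2]
      have h3 : lam = lam * ∫ x, f n x ^ 2 ∂(weightMeasure d (α - 1)) := by rw [hnorm, mul_one]
      conv_lhs => rw [h3]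
      rw [← integral_const_mul, ← integral_sub i1 i2]
      refine integral_congr_ae (Eventually.of_forall fun x => ?_)
      simp
      ring
    have h2 : Tendsto (fun n => (‖(e n).snd‖ ^ 2 - lam) ^ 2) atTop (𝓝 0) := by
      refine squeeze_zero (fun _ => sq_nonneg _) (fun n => ?_) hres
      have := sq_integral_inner_le ((hh n).sub ((hG n).memLp_fun.const_mul lam)) (hG n).memLp_fun
      simp only [Real.norm_eq_abs, sq_abs, Pi.sub_apply, hnorm, mul_one] at this
      rw [e1]
      exact this
    have h3 := (Real.continuous_sqrt.tendsto 0).comp h2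
    rw [Real.sqrt_zero] at h3
    rw [← tendsto_sub_nhds_zero_iff, tendsto_zero_iff_abs_tendsto_zero]
    refine h3.congr fun n => ?_
    simp [Real.sqrt_sq_eq_abs]
  have hmom : Tendsto (fun n => R (momentMap hα (e n))) atTop (𝓝 0) := by
    rw [← map_zero R]
    refine (R.continuous.tendsto 0).comp (tendsto_pi_nhds.2 fun k => ?_)
    refine (hweak _ (memLp_moment hα k)).congr fun n => ?_
    rw [momentMap_toFormSpace]
    simp only [mul_comm]
  set t : ℕ → FormSpace d α := fun n => e n - R (momentMap hα (e n))
  have ht1 : Tendsto (fun n => ‖(t n).fst‖ ^ 2) atTop (𝓝 1) := by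
    refine tendsto_norm_sub_sq (a := fun n => (e n).fst) ?_
      (((WithLp.continuous_fst 2 _ _).tendsto (0 : FormSpace d α)).comp hmom)
    simp only [hfst, one_pow, tendsto_const_nhds_iff]
  have ht2 : Tendsto (fun n => ‖(t n).snd‖ ^ 2) atTop (𝓝 lam) :=
    tendsto_norm_sub_sq (a := fun n => (e n).snd) hsnd
      (((WithLp.continuous_snd 2 _ _).tendsto (0 : FormSpace d α)).comp hmom)
  -- The vectors e n are not test functions, but the relation saying that the correction removes the
  -- moments passes from the test space to its closure, which contains them.
  have hgap : ∀ n, Λ * ‖(t n).fst‖ ^ 2 ≤ ‖(t n).snd‖ ^ 2 := fun n => by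
    obtain ⟨φ, hφ, hφe⟩ := hR (momentMap hα (e n))
    have hclosed : IsClosed {v : FormSpace d α |
        momentMap hα (v - R (momentMap hα v)) = 0} :=
      isClosed_eq (by fun_prop) continuous_const
    have hsub : ((testSpace d α).topologicalClosure : Set (FormSpace d α)) ⊆
        {v | momentMap hα (v - R (momentMap hα v)) = 0} :=
      closure_minimal (fun v hv => by
        rw [mem_ofPred_eq, map_sub, hR' v hv, sub_self]) hclosed
    have hz : momentMap hα (t n) = 0 := hsub ((hG n).toFormSpace_mem_closure hd hα0)
    have ht : t n = ((hG n).sub (hφ.isFormElement α)).toFormSpace := by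
      rw [IsFormElement.toFormSpace_sub (hG n) (hφ.isFormElement α), ← hφe]
    have hs := (hG n).sub (hφ.isFormElement α)
    rw [ht] at hz ⊢
    rw [hs.norm_sq_fst, hs.norm_sq_snd]
    exact hardyPoincareInequality_iff.1 hΛ _ _ hs ((isAdmissible_iff_momentMap hα hs).2 hz)
  have := le_of_tendsto_of_tendsto' (ht1.const_mul Λ) ht2 hgap
  linarith

end Constants

/-! ### Functions in the domain of the operator -/

section Graph

variable {d : ℕ} {α : ℝ} {f h : EuclideanSpace ℝ (Fin d) → ℝ}

theorem contDiff_pd (hf : ContDiff ℝ ∞ f) (i : Fin d) : ContDiff ℝ ∞ (pd i f) :=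
  (hf.fderiv_right (m := ∞) (by simp)).clm_apply contDiff_const

theorem norm_sq_gradient (f : EuclideanSpace ℝ (Fin d) → ℝ) (x : EuclideanSpace ℝ (Fin d)) :
    ‖gradient f x‖ ^ 2 = ∑ i, pd i f x ^ 2 := by
  rw [EuclideanSpace.real_norm_sq_eq]
  simp only [gradient_apply]

theorem inner_gradient_gradient (f g : EuclideanSpace ℝ (Fin d) → ℝ)
    (x : EuclideanSpace ℝ (Fin d)) :
    ⟪gradient f x, gradient g x⟫ = ∑ i, pd i f x * pd i g x := by
  rw [PiLp.inner_apply]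
  simp only [gradient_apply, Real.inner_apply]

theorem contDiff_one_add_norm_sq_rpow (β : ℝ) :
    ContDiff ℝ ∞ fun x : EuclideanSpace ℝ (Fin d) => (1 + ‖x‖ ^ 2) ^ β :=
  contDiff_iff_contDiffAt.2 fun _ =>
    (contDiff_const.add (contDiff_norm_sq ℝ)).contDiffAt.rpow_const_of_ne (by positivity)

theorem pd_one_add_norm_sq_rpow (β : ℝ) (i : Fin d) (x : EuclideanSpace ℝ (Fin d)) :
    pd i (fun x => (1 + ‖x‖ ^ 2) ^ β) x = 2 * β * x i * (1 + ‖x‖ ^ 2) ^ (β - 1) := by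
  have h : HasDerivAt (fun s : ℝ => (1 + s) ^ β) (β * (1 + ‖x‖ ^ 2) ^ (β - 1)) (‖x‖ ^ 2) := by
    simpa using ((hasDerivAt_id (‖x‖ ^ 2)).const_add 1).rpow_const (p := β)
      (Or.inl (by change (1 : ℝ) + ‖x‖ ^ 2 ≠ 0; positivity))
  rw [pd_radial (p := fun s => (1 + s) ^ β) h.differentiableAt, h.deriv]
  ring

theorem integral_mul_pd_of_contDiff {g φ : EuclideanSpace ℝ (Fin d) → ℝ} (hg : ContDiff ℝ ∞ g)
    {Ω : Set (EuclideanSpace ℝ (Fin d))} (hφ : IsTest Ω φ) (i : Fin d) :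
    ∫ x, g x * pd i φ x = -∫ x, pd i g x * φ x := by
  have hφ' := hφ.mono (subset_univ Ω)
  exact integral_mul_fderiv_eq_neg_fderiv_mul_of_integrable
    (hφ'.smooth_mul fun x _ => (contDiff_pd hg i).contDiffAt).integrable
    ((hφ'.pd i).smooth_mul fun x _ => hg.contDiffAt).integrable
    (hφ'.smooth_mul fun x _ => hg.contDiffAt).integrable
    (fun x _ => hg.differentiable (by simp) x) fun x _ => hφ.differentiable x

/-- Smooth functions on which the differential expression is square integrable belong to the domain
of the operator. -/
theorem isInGraph_of_contDiff (hd : 2 ≤ d) (hα : α ≤ 0) (hf : ContDiff ℝ ∞ f)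
    (hf2 : MemLp f 2 (weightMeasure d (α - 1))) (hg2 : MemLp (gradient f) 2 (weightMeasure d α))
    (hh2 : MemLp h 2 (weightMeasure d (α - 1)))
    (hL : ∀ x, h x = -((1 + ‖x‖ ^ 2) * ∑ i, pd i (pd i f) x + 2 * α * ∑ i, x i * pd i f x)) :
    IsInGraph α f h := by
  refine ⟨hh2, gradient f, ⟨hf2, hg2, isWeakGradient_gradient hf⟩, fun φ Φ hφ => ?_⟩
  have hw := contDiff_one_add_norm_sq_rpow (d := d) α
  -- The pair (-h, ∇f) has to annihilate the form domain, and it is enough to test it on smooth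
  -- functions supported away from the origin, where classical integration by parts applies.
  have key := hφ.integral_eq_zero hd hα hh2.neg hg2 fun φ hφ => by
    have hφ' := hφ.mono (subset_univ _)
    simp only [integral_weightMeasure, smul_eq_mul, inner_gradient_gradient, Finset.mul_sum]
    have hwf : ∀ i, ContDiff ℝ ∞ fun x : EuclideanSpace ℝ (Fin d) =>
        (1 + ‖x‖ ^ 2) ^ α * pd i f x := fun i => hw.mul (contDiff_pd hf i)
    have e1 : ∀ i, ∫ x, (1 + ‖x‖ ^ 2) ^ α * (pd i f x * pd i φ x) =
        -∫ x, pd i (fun x => (1 + ‖x‖ ^ 2) ^ α * pd i f x) x * φ x := fun i => by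
      rw [← integral_mul_pd_of_contDiff (hwf i) hφ' i]
      simp only [mul_assoc]
    rw [integral_finsetSum _ fun i _ => ?_]
    · simp only [e1]
      rw [Finset.sum_neg_distrib, ← integral_finsetSum _ fun i _ => ?_, ← sub_eq_add_neg,
        sub_eq_zero]
      · refine integral_congr_ae (Eventually.of_forall fun x => ?_)
        simp only [Pi.neg_apply]
        rw [hL, ← Finset.sum_mul, neg_neg]
        have e2 : ∀ i, pd i (fun x => (1 + ‖x‖ ^ 2) ^ α * pd i f x) x =
            (1 + ‖x‖ ^ 2) ^ (α - 1) * ((1 + ‖x‖ ^ 2) * pd i (pd i f) x +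
              2 * α * (x i * pd i f x)) := fun i => by
          rw [pd_mul (hw.differentiable (by simp) x) ((contDiff_pd hf i).differentiable (by simp) x),
            pd_one_add_norm_sq_rpow, Real.rpow_sub_one (by positivity)]
          field_simp
        simp only [e2]
        rw [← Finset.mul_sum, Finset.sum_add_distrib, ← Finset.mul_sum, ← Finset.mul_sum]
        ring
      · exact (hφ'.smooth_mul fun x _ => (contDiff_pd (hwf i) i).contDiffAt).integrable
    · simpa only [mul_assoc] using ((hφ'.pd i).smooth_mul
        fun x _ => (hwf i).contDiffAt).integrable
  simp only [Pi.neg_apply, neg_mul] at key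
  rw [integral_neg] at key
  linarith

theorem memLp_of_sq_le {H : Type*} [NormedAddCommGroup H] [NormedSpace ℝ H]
    {F : EuclideanSpace ℝ (Fin d) → H} {β C : ℝ} (n : ℕ) (hF : AEStronglyMeasurable F volume)
    (hβ : β + n < -(d : ℝ) / 2) (hb : ∀ x, ‖F x‖ ^ 2 ≤ C * (1 + ‖x‖ ^ 2) ^ n) :
    MemLp F 2 (weightMeasure d β) := by
  rw [memLp_weightMeasure_iff_integrable hF]
  refine ((integrable_one_add_norm_sq_rpow hβ).const_mul C).mono'
    ((continuous_one_add_norm_sq_rpow _).aestronglyMeasurable.mul (hF.norm.pow 2))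
    (Eventually.of_forall fun x => ?_)
  rw [Real.norm_of_nonneg (by positivity), Real.rpow_add_natCast (by positivity)]
  calc (1 + ‖x‖ ^ 2) ^ β * ‖F x‖ ^ 2 ≤ (1 + ‖x‖ ^ 2) ^ β * (C * (1 + ‖x‖ ^ 2) ^ n) :=
        mul_le_mul_of_nonneg_left (hb x) (by positivity)
    _ = _ := by ring

theorem pd_pd_radial {p : ℝ → ℝ} (hp : ContDiff ℝ ∞ p) (i : Fin d) (x : EuclideanSpace ℝ (Fin d)) :
    pd i (pd i fun x => p (‖x‖ ^ 2)) x =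
      2 * deriv p (‖x‖ ^ 2) + 4 * deriv (deriv p) (‖x‖ ^ 2) * (x i * x i) := by
  have hp' : ContDiff ℝ ∞ (deriv p) := (contDiff_infty_iff_deriv.1 hp).2
  have e : (pd i fun x : EuclideanSpace ℝ (Fin d) => p (‖x‖ ^ 2)) =
      fun x => (2 * x i) * deriv p (‖x‖ ^ 2) := funext fun x => by
    rw [pd_radial (hp.differentiable (by simp) _)]; ring
  have hd1 : DifferentiableAt ℝ (fun x : EuclideanSpace ℝ (Fin d) => deriv p (‖x‖ ^ 2)) x :=
    (hp'.comp (contDiff_norm_sq ℝ)).differentiable (by simp) x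
  have hd2 : DifferentiableAt ℝ (fun x : EuclideanSpace ℝ (Fin d) => 2 * x i) x :=
    (differentiableAt_coord i x).const_mul 2
  have e2 : pd i (fun x : EuclideanSpace ℝ (Fin d) => 2 * x i) x = 2 := by
    rw [pd, fderiv_const_mul (differentiableAt_coord i x)]
    have := pd_coord i i x
    rw [pd] at this
    simp [this]
  rw [e, pd_mul hd2 hd1, e2, pd_radial (hp'.differentiable (by simp) _)]
  ring

/-- The operator on radial functions. -/
theorem isInGraph_radial (hd : 2 ≤ d) (hα : α ≤ 0) {p : ℝ → ℝ} (hp : ContDiff ℝ ∞ p)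
    (hf2 : MemLp (fun x => p (‖x‖ ^ 2)) 2 (weightMeasure d (α - 1)))
    (hg2 : MemLp (fun x => (2 * deriv p (‖x‖ ^ 2)) • x) 2 (weightMeasure d α))
    (hh2 : MemLp h 2 (weightMeasure d (α - 1)))
    (hL : ∀ x, h x = -((1 + ‖x‖ ^ 2) * (2 * d * deriv p (‖x‖ ^ 2) +
      4 * ‖x‖ ^ 2 * deriv (deriv p) (‖x‖ ^ 2)) + 4 * α * ‖x‖ ^ 2 * deriv p (‖x‖ ^ 2))) :
    IsInGraph α (fun x => p (‖x‖ ^ 2)) h := by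
  have hg : gradient (fun x : EuclideanSpace ℝ (Fin d) => p (‖x‖ ^ 2)) =
      fun x => (2 * deriv p (‖x‖ ^ 2)) • x :=
    funext fun x => gradient_radial (hp.differentiable (by simp) _)
  refine isInGraph_of_contDiff hd hα (hp.comp (contDiff_norm_sq ℝ)) hf2 (hg ▸ hg2) hh2 fun x => ?_
  rw [hL]
  simp only [pd_pd_radial hp, fun i => pd_radial (x := x) (hp.differentiable (by simp) (‖x‖ ^ 2)) i]
  have e : ∀ i, x i * (deriv p (‖x‖ ^ 2) * (2 * x i)) = 2 * deriv p (‖x‖ ^ 2) * (x i * x i) :=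
    fun i => by ring
  simp only [e]
  rw [Finset.sum_add_distrib, ← Finset.mul_sum, ← Finset.mul_sum, ← Finset.mul_sum, sum_sq_coord]
  simp
  ring

end Graph

/-! ### Eigenfunctions -/

section Eigenfunctions

variable {d : ℕ} {α : ℝ}

theorem not_ae_eq_zero {f : EuclideanSpace ℝ (Fin d) → ℝ} (hf : Continuous f)
    (x : EuclideanSpace ℝ (Fin d)) (hx : f x ≠ 0) : ¬f =ᵐ[volume] 0 := fun h =>
  hx (congrFun ((hf.ae_eq_iff_eq volume continuous_const).1 h) x)

theorem integral_weight_coord_mul_coord {i j : Fin d} (hij : i ≠ j) (β : ℝ) (p : ℝ → ℝ) :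
    ∫ x : EuclideanSpace ℝ (Fin d), p (‖x‖ ^ 2) * (x i * x j) ∂(weightMeasure d β) = 0 := by
  rw [integral_weightMeasure]
  refine Eq.trans (integral_congr_ae (Eventually.of_forall fun x => ?_))
    (integral_coord_mul_coord_radial hij fun s => (1 + s) ^ β * p s)
  simp only [smul_eq_mul]
  ring

theorem norm_coord_le (x : EuclideanSpace ℝ (Fin d)) (i : Fin d) : |x i| ≤ ‖x‖ :=
  PiLp.norm_apply_le x i

/-- The product of two distinct coordinates is an eigenfunction. -/
theorem exists_quadrupole_eigenfunction (hd : 2 ≤ d) (hα : α < -((d : ℝ) + 2) / 2) :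
    ∃ f : EuclideanSpace ℝ (Fin d) → ℝ, IsAdmissible α f ∧ IsEigenfunction α (-4 * α) f := by
  have hα0 : α ≤ 0 := by linarith [(Nat.cast_nonneg d : (0 : ℝ) ≤ d)]
  obtain ⟨i, j, hij⟩ : ∃ i j : Fin d, i ≠ j :=
    ⟨⟨0, by omega⟩, ⟨1, by omega⟩, by simp [Fin.ext_iff]⟩
  have hsm : ContDiff ℝ ∞ fun x : EuclideanSpace ℝ (Fin d) => x i * x j :=
    (contDiff_coord i).mul (contDiff_coord j)
  have hpd : ∀ k x, pd k (fun x : EuclideanSpace ℝ (Fin d) => x i * x j) x =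
      x i * (if k = j then 1 else 0) + x j * (if k = i then 1 else 0) := fun k x => by
    rw [pd_mul (differentiableAt_coord i x) (differentiableAt_coord j x), pd_coord, pd_coord]
  -- The function xᵢxⱼ is harmonic and homogeneous of degree 2, so only the drift -2α x·∇ acts, with
  -- eigenvalue -4α.
  have hpd2 : ∀ k x, pd k (pd k fun x : EuclideanSpace ℝ (Fin d) => x i * x j) x = 0 := fun k x => by
    have e : pd k (fun x : EuclideanSpace ℝ (Fin d) => x i * x j) =
      fun x => x i * (if k = j then 1 else 0) + x j * (if k = i then 1 else 0) := funext (hpd k)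
    have hc : ∀ c : ℝ, pd k (fun _ : EuclideanSpace ℝ (Fin d) => c) x = 0 := fun c => by simp [pd]
    rw [e, pd_add ((differentiableAt_coord i x).mul_const _)
      ((differentiableAt_coord j x).mul_const _), pd_mul (differentiableAt_coord i x)
      (differentiableAt_const _), pd_mul (differentiableAt_coord j x) (differentiableAt_const _),
      hc, hc, pd_coord, pd_coord]
    by_cases h1 : k = i <;> by_cases h2 : k = j <;> simp [h1, h2]
    · exact hij
    · exact fun h => h2 (h1.trans h)
    · exact fun h => h1 (h2.trans h)
  have hmem : MemLp (fun x : EuclideanSpace ℝ (Fin d) => x i * x j) 2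
      (weightMeasure d (α - 1)) := by
    refine memLp_of_sq_le (C := 1) 2 hsm.continuous.aestronglyMeasurable
      (by push_cast; linarith) fun x => ?_
    have h1 := norm_coord_le x i
    have h2 := norm_coord_le x j
    rw [one_mul, norm_mul, Real.norm_eq_abs, Real.norm_eq_abs]
    refine pow_le_pow_left₀ (by positivity) ?_ 2
    calc |x i| * |x j| ≤ ‖x‖ * ‖x‖ := by gcongr
      _ ≤ 1 + ‖x‖ ^ 2 := by nlinarith
  have hgrad : MemLp (gradient fun x : EuclideanSpace ℝ (Fin d) => x i * x j) 2
      (weightMeasure d α) := by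
    refine memLp_of_sq_le (C := ∑ _ : Fin d, 4) 1
      (continuous_gradient_of_contDiff hsm).aestronglyMeasurable (by push_cast; linarith)
      fun x => ?_
    rw [norm_sq_gradient, pow_one, Finset.sum_mul]
    refine Finset.sum_le_sum fun k _ => ?_
    have h1 := norm_coord_le x i
    have h2 := norm_coord_le x j
    have h3 : |pd k (fun x : EuclideanSpace ℝ (Fin d) => x i * x j) x| ≤ 2 * ‖x‖ := by
      rw [hpd]
      refine (abs_add_le _ _).trans ?_
      have h4 : ∀ (a : ℝ) (P : Prop) [Decidable P], |a * (if P then 1 else 0)| ≤ |a| :=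
        fun a P _ => by split_ifs <;> simp
      linarith [h4 (x i) (k = j), h4 (x j) (k = i)]
    rw [← sq_abs]
    nlinarith [abs_nonneg (pd k (fun x : EuclideanSpace ℝ (Fin d) => x i * x j) x)]
  refine ⟨fun x => x i * x j, (isAdmissible_iff hα).2 ⟨hmem, ?_⟩,
    not_ae_eq_zero hsm.continuous (EuclideanSpace.single i 1 + EuclideanSpace.single j 1) ?_,
    isInGraph_of_contDiff hd hα0 hsm hmem hgrad (hmem.const_mul _) fun x => ?_⟩
  · rintro (_ | _ | k)
    · simpa [moment] using integral_weight_coord_mul_coord hij (α - 1) fun _ => 1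
    · exact integral_weight_coord_mul_coord hij (α - 1) fun s => s
    · rw [integral_weightMeasure]
      -- Choose the reflection that fixes xₖ and changes the sign of xᵢxⱼ.
      by_cases hk : k = i
      · refine integral_eq_zero_of_coordReflection j fun x => ?_
        simp only [moment, smul_eq_mul]
        rw [LinearIsometryEquiv.norm_map, coordReflection_self, coordReflection_of_ne hij,
          coordReflection_of_ne (hk ▸ hij)]
        ring
      · refine integral_eq_zero_of_coordReflection i fun x => ?_
        simp only [moment, smul_eq_mul]
        rw [LinearIsometryEquiv.norm_map, coordReflection_self, coordReflection_of_ne hij.symm,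
          coordReflection_of_ne hk]
        ring
  · simp [hij, hij.symm]
  · simp only [hpd2, hpd]
    have e : ∑ k, x k * (x i * (if k = j then 1 else 0) + x j * (if k = i then 1 else 0)) =
        2 * (x i * x j) := by
      simp only [mul_add, mul_ite, mul_one, mul_zero]
      rw [Finset.sum_add_distrib]
      simp
      ring
    rw [e]
    simp
    ring

theorem memLp_radial_of_le {β C : ℝ} (n : ℕ) {p : ℝ → ℝ} (hp : Continuous p)
    (hβ : β + n < -(d : ℝ) / 2) (hb : ∀ s, 0 ≤ s → p s ^ 2 ≤ C * (1 + s) ^ n) :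
    MemLp (fun x : EuclideanSpace ℝ (Fin d) => p (‖x‖ ^ 2)) 2 (weightMeasure d β) := by
  refine memLp_of_sq_le (C := C) n (hp.comp (continuous_norm.pow 2)).aestronglyMeasurable hβ fun x => ?_
  rw [Real.norm_eq_abs, sq_abs]
  exact hb _ (by positivity)

theorem memLp_radial_smul_of_le {β C : ℝ} (n : ℕ) {p : ℝ → ℝ} (hp : Continuous p)
    (hβ : β + n < -(d : ℝ) / 2) (hb : ∀ s, 0 ≤ s → p s ^ 2 * s ≤ C * (1 + s) ^ n) :
    MemLp (fun x : EuclideanSpace ℝ (Fin d) => p (‖x‖ ^ 2) • x) 2 (weightMeasure d β) := by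
  refine memLp_of_sq_le (C := C) n
    ((hp.comp (continuous_norm.pow 2)).smul continuous_id).aestronglyMeasurable hβ fun x => ?_
  rw [norm_smul, mul_pow, Real.norm_eq_abs, sq_abs]
  exact hb _ (by positivity)

/-- The operator is symmetric; this serves to prove orthogonality without computing integrals. -/
theorem integral_mul_symm {f₁ f₂ h₁ h₂ : EuclideanSpace ℝ (Fin d) → ℝ} (hf₁ : IsInGraph α f₁ h₁)
    (hf₂ : IsInGraph α f₂ h₂) : ∫ x, h₁ x * f₂ x ∂(weightMeasure d (α - 1)) =
      ∫ x, h₂ x * f₁ x ∂(weightMeasure d (α - 1)) := by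
  obtain ⟨G₁, hG₁, hform₁⟩ := hf₁.2
  obtain ⟨G₂, hG₂, hform₂⟩ := hf₂.2
  rw [← hform₁ _ _ hG₂, ← hform₂ _ _ hG₁]
  simp only [real_inner_comm]

/-- The radial eigenfunction of degree four. -/
theorem exists_radial_eigenfunction (hd : 2 ≤ d) (hα : α < -((d : ℝ) + 6) / 2) :
    ∃ f : EuclideanSpace ℝ (Fin d) → ℝ, IsAdmissible α f ∧
      IsEigenfunction α (-8 * α - 4 * ((d : ℝ) + 2)) f := by
  have hd' : (2 : ℝ) ≤ d := by exact_mod_cast hd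
  have hα0 : α ≤ 0 := by linarith
  set lam := -8 * α - 4 * ((d : ℝ) + 2) with hlam
  have hlam0 : 0 < lam := by linarith
  -- The operator maps polynomials of degree two in s = |x|² to such polynomials. For s² - As + B
  -- the leading coefficient gives the eigenvalue, and matching the coefficients of s and of 1
  -- determines A and then B.
  set A := (4 * (d : ℝ) + 8) / (-2 * d - 8 - 4 * α) with hA
  have hAd : 0 < -2 * (d : ℝ) - 8 - 4 * α := by linarith
  have hA1 : A * (-2 * (d : ℝ) - 8 - 4 * α) = 4 * d + 8 := div_mul_cancel₀ _ hAd.ne'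
  have hA0 : 0 < A := by positivity
  set B := 2 * d * A / lam with hB
  have hB1 : B * lam = 2 * d * A := div_mul_cancel₀ _ hlam0.ne'
  have hB0 : 0 < B := by positivity
  have hD : ∀ s : ℝ, HasDerivAt (fun s : ℝ => s ^ 2 - A * s + B) (2 * s - A) s := fun s => by
    simpa using (((hasDerivAt_id s).fun_pow 2).sub ((hasDerivAt_id s).const_mul A)).add_const B
  have hD' : deriv (fun s : ℝ => s ^ 2 - A * s + B) = fun s => 2 * s - A :=
    funext fun s => (hD s).deriv
  have hDD' : ∀ s, deriv (fun s : ℝ => 2 * s - A) s = 2 := fun s => by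
    simp
  have hp : ContDiff ℝ ∞ fun s : ℝ => s ^ 2 - A * s + B := by fun_prop
  have hid : deriv (fun s : ℝ => s) = fun _ => 1 := funext fun s => (hasDerivAt_id s).deriv
  have hmem : MemLp (fun x : EuclideanSpace ℝ (Fin d) => (‖x‖ ^ 2) ^ 2 - A * ‖x‖ ^ 2 + B) 2
      (weightMeasure d (α - 1)) := by
    -- The square of the profile grows like s⁴, so square integrability needs α + 3 < -d/2, which is
    -- the hypothesis on α.
    refine memLp_radial_of_le (p := fun s => s ^ 2 - A * s + B) (C := (1 + A + B) ^ 2) 4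
      hp.continuous (by push_cast; linarith) fun s hs => ?_
    rw [show (1 + A + B) ^ 2 * (1 + s) ^ 4 = ((1 + A + B) * (1 + s) ^ 2) ^ 2 by ring]
    refine sq_le_sq' ?_ ?_ <;> nlinarith [mul_nonneg hA0.le hs, mul_nonneg hB0.le hs]
  have hg : MemLp (fun x : EuclideanSpace ℝ (Fin d) =>
      (2 * (2 * ‖x‖ ^ 2 - A)) • x) 2 (weightMeasure d α) := by
    refine memLp_radial_smul_of_le (p := fun s => 2 * (2 * s - A)) (C := (4 + 2 * A) ^ 2) 3
      (by fun_prop) (by push_cast; linarith) fun s hs => ?_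
    have h1 : (2 * (2 * s - A)) ^ 2 ≤ ((4 + 2 * A) * (1 + s)) ^ 2 := by
      refine sq_le_sq' ?_ ?_ <;> nlinarith [mul_nonneg hA0.le hs]
    calc (2 * (2 * s - A)) ^ 2 * s ≤ ((4 + 2 * A) * (1 + s)) ^ 2 * (1 + s) :=
          mul_le_mul h1 (by linarith) hs (by positivity)
      _ = _ := by ring
  have hgraph : IsInGraph α (fun x : EuclideanSpace ℝ (Fin d) => (‖x‖ ^ 2) ^ 2 - A * ‖x‖ ^ 2 + B)
      fun x => lam * ((‖x‖ ^ 2) ^ 2 - A * ‖x‖ ^ 2 + B) := by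
    refine isInGraph_radial (p := fun s => s ^ 2 - A * s + B) hd hα0 hp hmem ?_
      (hmem.const_mul _) fun x => ?_
    · rw [hD']; exact hg
    · rw [hD', hDD']
      linear_combination (-‖x‖ ^ 2) * hA1 + hB1
  have hgraph2 : IsInGraph α (fun x : EuclideanSpace ℝ (Fin d) => ‖x‖ ^ 2)
      fun x => -(2 * d) - (2 * d + 4 * α) * ‖x‖ ^ 2 := by
    refine isInGraph_radial (p := fun s => s) hd hα0 contDiff_id (memLp_moment (by linarith)
      (some none)) ?_ ?_ fun x => ?_
    · rw [hid]
      exact memLp_radial_smul_of_le (p := fun _ => 2 * 1) (C := 4) 1 continuous_const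
        (by push_cast; linarith) fun s hs => by linarith
    · exact ((memLp_moment (by linarith) none).const_mul (-(2 * d))).sub
        ((memLp_moment (by linarith) (some none)).const_mul (2 * d + 4 * α)) |>.ae_eq
        (Eventually.of_forall fun x => by simp [moment])
    · simp only [hid, deriv_const]
      ring
  have hgraph1 : IsInGraph α (fun _ : EuclideanSpace ℝ (Fin d) => (1 : ℝ)) fun _ => 0 := by
    refine isInGraph_radial (p := fun _ => 1) hd hα0 contDiff_const (memLp_moment (by linarith)
      none) ?_ MemLp.zero fun x => ?_
    · simp
    · simp
  -- By symmetry against 1, which the operator kills, the mean of the eigenfunction is zero. Against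
  -- |x|², an eigenfunction up to constants with eigenvalue -(2d+4α) different from `lam`, the
  -- second moment is zero too.
  have hf1 := integral_mul_symm hgraph hgraph1
  have hf2 := integral_mul_symm hgraph hgraph2
  have hα' : α < -((d : ℝ) + 2) / 2 := by linarith
  have hfi := (hmem.integrable_mul (memLp_moment hα' none)).congr
    (Eventually.of_forall fun x => mul_one _)
  have hfi2 := hmem.integrable_mul (memLp_moment hα' (some none))
  have h1 : ∫ x : EuclideanSpace ℝ (Fin d), ((‖x‖ ^ 2) ^ 2 - A * ‖x‖ ^ 2 + B)
      ∂(weightMeasure d (α - 1)) = 0 := by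
    simp only [mul_one, zero_mul, integral_zero] at hf1
    rw [integral_const_mul] at hf1
    exact (mul_eq_zero.1 hf1).resolve_left hlam0.ne'
  have h2 : ∫ x : EuclideanSpace ℝ (Fin d), ‖x‖ ^ 2 * ((‖x‖ ^ 2) ^ 2 - A * ‖x‖ ^ 2 + B)
      ∂(weightMeasure d (α - 1)) = 0 := by
    have e1 : ∀ x : EuclideanSpace ℝ (Fin d),
        lam * ((‖x‖ ^ 2) ^ 2 - A * ‖x‖ ^ 2 + B) * ‖x‖ ^ 2 =
          lam * (‖x‖ ^ 2 * ((‖x‖ ^ 2) ^ 2 - A * ‖x‖ ^ 2 + B)) := fun x => by ring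
    have e2 : ∀ x : EuclideanSpace ℝ (Fin d),
        (-(2 * d) - (2 * d + 4 * α) * ‖x‖ ^ 2) * ((‖x‖ ^ 2) ^ 2 - A * ‖x‖ ^ 2 + B) =
          -(2 * d) * ((‖x‖ ^ 2) ^ 2 - A * ‖x‖ ^ 2 + B) - (2 * d + 4 * α) *
            (‖x‖ ^ 2 * ((‖x‖ ^ 2) ^ 2 - A * ‖x‖ ^ 2 + B)) := fun x => by ring
    simp only [e1, e2] at hf2
    have hfi3 : Integrable (fun x : EuclideanSpace ℝ (Fin d) =>
        ‖x‖ ^ 2 * ((‖x‖ ^ 2) ^ 2 - A * ‖x‖ ^ 2 + B)) (weightMeasure d (α - 1)) :=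
      hfi2.congr (Eventually.of_forall fun x => mul_comm _ _)
    rw [integral_const_mul, integral_sub (hfi.const_mul _) (hfi3.const_mul _), integral_const_mul,
      integral_const_mul, h1] at hf2
    have h3 : (lam + (2 * d + 4 * α)) * ∫ x : EuclideanSpace ℝ (Fin d),
        ‖x‖ ^ 2 * ((‖x‖ ^ 2) ^ 2 - A * ‖x‖ ^ 2 + B) ∂(weightMeasure d (α - 1)) = 0 := by
      linear_combination hf2
    exact (mul_eq_zero.1 h3).resolve_left (by rw [hlam]; linarith)
  refine ⟨_, (isAdmissible_iff hα').2 ⟨hmem, ?_⟩, not_ae_eq_zero (by fun_prop) 0 ?_, hgraph⟩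
  · rintro (_ | _ | k)
    · simpa [moment] using h1
    · exact h2
    · rw [integral_weightMeasure]
      refine integral_eq_zero_of_coordReflection k fun x => ?_
      simp only [moment, smul_eq_mul]
      rw [LinearIsometryEquiv.norm_map, coordReflection_self]
      ring
  · simpa using hB0.ne'

end Eigenfunctions

/-! ### Weyl sequences escaping to infinity -/

section WeylCriterion

variable {d : ℕ} {α : ℝ} {f h : EuclideanSpace ℝ (Fin d) → ℝ}
  {G : EuclideanSpace ℝ (Fin d) → EuclideanSpace ℝ (Fin d)}

theorem IsWeakGradient.const_mul (hf : IsWeakGradient f G) (c : ℝ) :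
    IsWeakGradient (fun x => c * f x) fun x => c • G x := by
  refine ⟨hf.1.smul c, hf.2.smul c, fun φ hφ hφc => ?_⟩
  simp only [mul_smul, smul_comm _ c]
  rw [integral_smul, integral_smul, hf.3 φ hφ hφc, smul_neg]

theorem IsInGraph.const_mul (hf : IsInGraph α f h) (c : ℝ) :
    IsInGraph α (fun x => c * f x) fun x => c * h x := by
  obtain ⟨hh, G, hG, hform⟩ := hf
  refine ⟨hh.const_mul c, fun x => c • G x, ⟨hG.1.const_mul c, hG.2.const_smul c,
    hG.3.const_mul c⟩, fun φ Φ hφ => ?_⟩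
  simp only [real_inner_smul_left, mul_assoc]
  rw [integral_const_mul, integral_const_mul, hform φ Φ hφ]

theorem tendsto_integral_indicator_norm_ge {X : Type*} [NormedAddCommGroup X] [MeasurableSpace X]
    [OpensMeasurableSpace X] {μ : Measure X} {F : X → ℝ} (hF : Integrable F μ) :
    Tendsto (fun n : ℕ => ∫ x, {x | (n : ℝ) ≤ ‖x‖}.indicator F x ∂μ) atTop (𝓝 0) := by
  have hm : ∀ n : ℕ, MeasurableSet {x : X | (n : ℝ) ≤ ‖x‖} := fun n =>
    measurableSet_le measurable_const measurable_norm
  rw [← integral_zero X ℝ (μ := μ)]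
  refine tendsto_integral_of_dominated_convergence (fun x => ‖F x‖)
    (fun n => hF.1.indicator (hm n)) hF.norm
    (fun n => Eventually.of_forall fun x => norm_indicator_le_norm_self _ _)
    (Eventually.of_forall fun x => ?_)
  obtain ⟨N, hN⟩ := exists_nat_gt ‖x‖
  refine tendsto_const_nhds.congr' ((eventually_ge_atTop N).mono fun n hn => ?_)
  have : (N : ℝ) ≤ n := by exact_mod_cast hn
  have hx : x ∉ {x : X | (n : ℝ) ≤ ‖x‖} := fun h => absurd h (not_le.2 (hN.trans_le this))
  exact (indicator_of_notMem hx F).symm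

/-- A sequence of approximate eigenfunctions which are supported away from larger and larger balls
is a Weyl sequence. -/
theorem mem_continuousSpectrum_of_support {lam : ℝ} {f h : ℕ → EuclideanSpace ℝ (Fin d) → ℝ}
    (hg : ∀ n, IsInGraph α (f n) (h n))
    (hpos : ∀ n, 0 < ∫ x, f n x ^ 2 ∂(weightMeasure d (α - 1)))
    (hres : Tendsto (fun n => (∫ x, f n x ^ 2 ∂(weightMeasure d (α - 1)))⁻¹ *
      ∫ x, (h n x - lam * f n x) ^ 2 ∂(weightMeasure d (α - 1))) atTop (𝓝 0))
    (hsupp : ∀ (n : ℕ) x, ‖x‖ < n → f n x = 0) : lam ∈ continuousSpectrum d α := by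
  set D : ℕ → ℝ := fun n => ∫ x, f n x ^ 2 ∂(weightMeasure d (α - 1))
  have hD : ∀ n, ((√(D n))⁻¹) ^ 2 = (D n)⁻¹ := fun n => by
    rw [inv_pow, Real.sq_sqrt (hpos n).le]
  have hnorm : ∀ n, ∫ x, ((√(D n))⁻¹ * f n x) ^ 2 ∂(weightMeasure d (α - 1)) = 1 := fun n => by
    simp only [mul_pow, hD]
    rw [integral_const_mul]
    exact inv_mul_cancel₀ (hpos n).ne'
  have hgn := fun n => (hg n).const_mul (√(D n))⁻¹
  refine ⟨_, _, hgn, hnorm, fun φ hφ => ?_, hres.congr fun n => ?_⟩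
  · rw [tendsto_zero_iff_abs_tendsto_zero]
    -- Because f n vanishes on |x| < n, its pairing with φ sees only the tail of φ, whose norm tends
    -- to zero.
    have h1 := tendsto_integral_indicator_norm_ge hφ.integrable_sq
    have h2 : Tendsto (fun n => (∫ x, (√(D n))⁻¹ * f n x * φ x ∂(weightMeasure d (α - 1))) ^ 2)
        atTop (𝓝 0) := by
      refine squeeze_zero (fun _ => sq_nonneg _) (fun n => ?_) h1
      obtain ⟨-, G, hG, -⟩ := hgn n
      have hm : MeasurableSet {x : EuclideanSpace ℝ (Fin d) | (n : ℝ) ≤ ‖x‖} :=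
        measurableSet_le measurable_const measurable_norm
      have h3 := sq_integral_inner_le hG.memLp_fun (hφ.indicator hm)
      simp only [Real.norm_eq_abs, sq_abs, hnorm, one_mul] at h3
      refine le_trans (le_of_eq ?_) (h3.trans (le_of_eq ?_))
      · congr 1
        refine integral_congr_ae (Eventually.of_forall fun x => ?_)
        simp only [Real.inner_apply]
        by_cases hx : (n : ℝ) ≤ ‖x‖
        · rw [indicator_of_mem (show x ∈ {x | (n : ℝ) ≤ ‖x‖} from hx)]
        · simp [hsupp n x (not_le.1 hx)]
      · refine integral_congr_ae (Eventually.of_forall fun x => ?_)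
        by_cases hx : (n : ℝ) ≤ ‖x‖
        · simp [indicator, hx]
        · simp [indicator, hx]
    have h3 := (Real.continuous_sqrt.tendsto 0).comp h2
    simpa [Function.comp_def, Real.sqrt_sq_eq_abs] using h3
  · have e : ∀ x, ((√(D n))⁻¹ * h n x - lam * ((√(D n))⁻¹ * f n x)) ^ 2 =
        (D n)⁻¹ * (h n x - lam * f n x) ^ 2 := fun x => by rw [← hD]; ring
    simp only [e]
    rw [integral_const_mul]

end WeylCriterion

/-! ### Powers modulated in the logarithmic variable -/

section LogProfile

/-- The function `s ^ κ θ(log s)` on the half-line, extended by zero. -/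
def logProfile (κ : ℝ) (θ : ℝ → ℝ) (s : ℝ) : ℝ := if 0 < s then s ^ κ * θ (Real.log s) else 0

variable {κ a b : ℝ} {θ : ℝ → ℝ}

theorem logProfile_of_pos {s : ℝ} (hs : 0 < s) : logProfile κ θ s = s ^ κ * θ (Real.log s) :=
  if_pos hs

theorem logProfile_eq_zero (hθ : ∀ y ∉ Icc a b, θ y = 0) {s : ℝ}
    (hs : s ∉ Icc (Real.exp a) (Real.exp b)) : logProfile κ θ s = 0 := by
  unfold logProfile
  split_ifs with h
  · rw [hθ, mul_zero]
    rwa [mem_Icc, Real.le_log_iff_exp_le h, Real.log_le_iff_le_exp h]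
  · rfl

theorem logProfile_eventuallyEq {s : ℝ} (hs : 0 < s) :
    logProfile κ θ =ᶠ[𝓝 s] fun s => s ^ κ * θ (Real.log s) :=
  mem_of_superset (Ioi_mem_nhds hs) fun _ ht => logProfile_of_pos ht

theorem logProfile_eventuallyEq_zero (hθ : ∀ y ∉ Icc a b, θ y = 0) {s : ℝ} (hs : ¬0 < s) :
    logProfile κ θ =ᶠ[𝓝 s] fun _ => 0 :=
  mem_of_superset (Iio_mem_nhds ((not_lt.1 hs).trans_lt (Real.exp_pos a))) fun _ ht =>
    logProfile_eq_zero hθ fun h => absurd h.1 (not_le.2 ht)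

theorem isTest_logProfile (hθ : ContDiff ℝ ∞ θ) (hθ0 : ∀ y ∉ Icc a b, θ y = 0) :
    IsTest (Ioi 0) (logProfile κ θ) := by
  refine IsTest.of_tsupport_subset (K := Icc (Real.exp a) (Real.exp b)) isCompact_Icc
    (fun s hs => (Real.exp_pos a).trans_le hs.1) (contDiff_iff_contDiffAt.2 fun s => ?_)
    (closure_minimal (fun s hs => not_imp_comm.1 (logProfile_eq_zero hθ0) hs) isClosed_Icc)
  by_cases hs : 0 < s
  · refine ContDiffAt.congr_of_eventuallyEq ?_ (logProfile_eventuallyEq hs)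
    exact (contDiffAt_id.rpow_const_of_ne hs.ne').mul
      (hθ.contDiffAt.comp s (Real.contDiffAt_log.2 hs.ne'))
  · exact contDiffAt_const.congr_of_eventuallyEq (logProfile_eventuallyEq_zero hθ0 hs)

/-- Differentiation keeps the class of these profiles, acting on θ as κ + d/dy and lowering the
power by one, so second derivatives follow by applying it twice. -/
theorem deriv_logProfile (hθ : Differentiable ℝ θ) (hθ0 : ∀ y ∉ Icc a b, θ y = 0) :
    deriv (logProfile κ θ) = logProfile (κ - 1) fun y => κ * θ y + deriv θ y := by
  ext s
  by_cases hs : 0 < s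
  · rw [(logProfile_eventuallyEq hs).deriv_eq, logProfile_of_pos hs]
    have h1 := (Real.hasDerivAt_rpow_const (p := κ) (Or.inl hs.ne')).mul
      ((hθ (Real.log s)).hasDerivAt.comp s (Real.hasDerivAt_log hs.ne'))
    refine h1.deriv.trans ?_
    rw [Function.comp_apply, Real.rpow_sub_one hs.ne']
    field_simp
  · rw [(logProfile_eventuallyEq_zero hθ0 hs).deriv_eq, deriv_const, logProfile, if_neg hs]

theorem deriv_eq_zero_of_notMem_Icc (hθ : ∀ y ∉ Icc a b, θ y = 0) :
    ∀ y ∉ Icc a b, deriv θ y = 0 := fun y hy => by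
  have : θ =ᶠ[𝓝 y] fun _ => 0 := mem_of_superset (isClosed_Icc.isOpen_compl.mem_nhds hy) hθ
  rw [this.deriv_eq, deriv_const]

theorem integral_indicator_inv (hab : a ≤ b) (C : ℝ) :
    Integrable ((Icc (Real.exp a) (Real.exp b)).indicator fun s : ℝ => C * s⁻¹) ∧
      ∫ s, (Icc (Real.exp a) (Real.exp b)).indicator (fun s : ℝ => C * s⁻¹) s = C * (b - a) := by
  have h0 : ∀ s ∈ Icc (Real.exp a) (Real.exp b), s ≠ 0 := fun s hs =>
    ((Real.exp_pos a).trans_le hs.1).ne'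
  constructor
  · rw [integrable_indicator_iff measurableSet_Icc]
    exact (continuousOn_const.mul (continuousOn_inv₀.mono h0)).integrableOn_Icc
  · rw [integral_indicator measurableSet_Icc, integral_const_mul, integral_Icc_eq_integral_Ioc,
      ← intervalIntegral.integral_of_le (Real.exp_le_exp.2 hab),
      integral_inv_of_pos (Real.exp_pos _) (Real.exp_pos _), ← Real.exp_sub, Real.log_exp]

variable {A B : ℝ} {g : ℝ → ℝ}

/-- At the critical exponent, and since (1+s)^B ≤ s^B, the integrand is at most M² ds/s, which
measures logarithmic length. -/
theorem integral_radialWeight_mul_sq_le (hAB : A + B + 2 * κ = -1) (hB : B ≤ 0) (hab : a ≤ b)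
    (hg : IsTest (Ioi 0) g) {M : ℝ} (hg0 : ∀ s ∉ Icc (Real.exp a) (Real.exp b), g s = 0)
    (hgM : ∀ s ∈ Icc (Real.exp a) (Real.exp b), |g s| ≤ s ^ κ * M) :
    ∫ s, radialWeight A B s * g s ^ 2 ≤ M ^ 2 * (b - a) := by
  rw [← (integral_indicator_inv hab (M ^ 2)).2]
  refine integral_mono (hg.sq.radialWeight_mul A B).integrable (integral_indicator_inv hab _).1
    fun s => ?_
  by_cases hs : s ∈ Icc (Real.exp a) (Real.exp b)
  · have hs0 : 0 < s := (Real.exp_pos a).trans_le hs.1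
    rw [indicator_of_mem hs]
    have h1 : g s ^ 2 ≤ (s ^ κ * M) ^ 2 := by
      rw [← sq_abs]
      exact pow_le_pow_left₀ (abs_nonneg _) (hgM s hs) 2
    have h2 : (1 + s) ^ B ≤ s ^ B := Real.rpow_le_rpow_of_nonpos hs0 (by linarith) hB
    calc radialWeight A B s * g s ^ 2 ≤ s ^ A * s ^ B * (s ^ κ * M) ^ 2 := by
          unfold radialWeight
          gcongr
      _ = M ^ 2 * s⁻¹ := by
          rw [← Real.rpow_neg_one, ← hAB, Real.rpow_add hs0, Real.rpow_add hs0, mul_comm 2 κ,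
            Real.rpow_mul hs0.le, Real.rpow_two]
          ring
  · simp [hg0 s hs, hs]

/-- The converse estimate: for s ≥ 1 one has (1+s)^B ≥ (2s)^B, so a plateau contributes a fixed
multiple of its logarithmic length. -/
theorem le_integral_radialWeight_mul_sq (hAB : A + B + 2 * κ = -1) (hB : B ≤ 0) (ha : 0 ≤ a)
    (hab : a ≤ b) (hg : IsTest (Ioi 0) g)
    (hg1 : ∀ s ∈ Icc (Real.exp a) (Real.exp b), g s = s ^ κ) :
    2 ^ B * (b - a) ≤ ∫ s, radialWeight A B s * g s ^ 2 := by
  rw [← (integral_indicator_inv hab (2 ^ B)).2]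
  refine integral_mono (integral_indicator_inv hab _).1 (hg.sq.radialWeight_mul A B).integrable
    fun s => ?_
  by_cases hs : s ∈ Icc (Real.exp a) (Real.exp b)
  · have hs1 : 1 ≤ s := (Real.one_le_exp ha).trans hs.1
    have hs0 : 0 < s := by linarith
    rw [indicator_of_mem hs]
    have h2 : (2 * s) ^ B ≤ (1 + s) ^ B :=
      Real.rpow_le_rpow_of_nonpos (by linarith) (by linarith) hB
    calc 2 ^ B * s⁻¹ = s ^ A * (2 * s) ^ B * (s ^ κ) ^ 2 := by
          rw [← Real.rpow_neg_one, ← hAB, Real.rpow_add hs0, Real.rpow_add hs0, mul_comm 2 κ,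
            Real.rpow_mul hs0.le, Real.rpow_two, Real.mul_rpow zero_le_two hs0.le]
          ring
      _ ≤ radialWeight A B s * g s ^ 2 := by
          rw [hg1 s hs]
          unfold radialWeight
          gcongr
  · rw [indicator_of_notMem hs]
    by_cases h0 : 0 < s
    · exact mul_nonneg (radialWeight_nonneg A B h0) (sq_nonneg _)
    · simp [hg.eq_zero (show s ∉ Ioi (0 : ℝ) from h0)]

end LogProfile

/-! ### The bottom of the essential spectrum -/

section Bottom

variable {d : ℕ} {α : ℝ}

theorem memLp_radial_of_isTest {p : ℝ → ℝ} (hp : IsTest (Ioi 0) p) (β : ℝ) :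
    MemLp (fun x : EuclideanSpace ℝ (Fin d) => p (‖x‖ ^ 2)) 2 (weightMeasure d β) :=
  memLp_weightMeasure_of_hasCompactSupport hp.radial.continuous hp.radial.hasCompactSupport β

/-- The operator on radial test functions. -/
def radialOperator (d : ℕ) (α : ℝ) (p : ℝ → ℝ) (s : ℝ) : ℝ :=
  -((1 + s) * (2 * d * deriv p s + 4 * s * deriv (deriv p) s) + 4 * α * s * deriv p s)

theorem isTest_radialOperator {p : ℝ → ℝ} (hp : IsTest (Ioi 0) p) :
    IsTest (Ioi 0) (radialOperator d α p) := by
  refine ((((hp.deriv.const_mul (2 * d)).add (hp.deriv.deriv.smooth_mul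
    (g := fun s => 4 * s) fun _ _ => by fun_prop)).smooth_mul (g := fun s => 1 + s)
    fun _ _ => by fun_prop).add (hp.deriv.smooth_mul (g := fun s => 4 * α * s)
    fun _ _ => by fun_prop)).neg

theorem isInGraph_radial_of_isTest (hd : 2 ≤ d) (hα : α ≤ 0) {p : ℝ → ℝ}
    (hp : IsTest (Ioi 0) p) :
    IsInGraph α (fun x : EuclideanSpace ℝ (Fin d) => p (‖x‖ ^ 2))
      fun x => radialOperator d α p (‖x‖ ^ 2) := by
  refine isInGraph_radial hd hα hp.contDiff (memLp_radial_of_isTest hp _) ?_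
    (memLp_radial_of_isTest (isTest_radialOperator hp) _) fun x => rfl
  have h1 := (hp.deriv.const_mul 2).radial (d := d)
  exact memLp_weightMeasure_of_hasCompactSupport (h1.continuous.smul continuous_id)
    h1.hasCompactSupport.smul_right α

/-- At infinity the operator is of Euler type. For this κ its indicial polynomial minus 4κ² has a
double root, so to leading order both the θ and the θ' terms cancel. Only -4θ'' and terms smaller by
a factor 1/s remain. -/
theorem radialOperator_logProfile {κ a b : ℝ} {θ : ℝ → ℝ} (hθ : ContDiff ℝ ∞ θ)
    (hθ0 : ∀ y ∉ Icc a b, θ y = 0) (hκ : 1 - 2 * κ = d / 2 + α) {s : ℝ} (hs : 0 < s) :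
    radialOperator d α (logProfile κ θ) s - 4 * κ ^ 2 * logProfile κ θ s =
      s ^ κ * (-4 * deriv (deriv θ) (Real.log s) - s⁻¹ * (4 * deriv (deriv θ) (Real.log s) +
        (8 * κ + 2 * d - 4) * deriv θ (Real.log s) +
        (4 * κ ^ 2 + (2 * d - 4) * κ) * θ (Real.log s))) := by
  have hθd : Differentiable ℝ θ := hθ.differentiable (by simp)
  have hθ' : ContDiff ℝ ∞ (deriv θ) := (contDiff_infty_iff_deriv.1 hθ).2
  have hθd' : Differentiable ℝ (deriv θ) := hθ'.differentiable (by simp)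
  have hθ0' := deriv_eq_zero_of_notMem_Icc hθ0
  have e1 : ∀ y, deriv (fun y => κ * θ y + deriv θ y) y = κ * deriv θ y + deriv (deriv θ) y :=
    fun y => (((hθd y).hasDerivAt.const_mul κ).add (hθd' y).hasDerivAt).deriv
  have hα : α = 1 - 2 * κ - d / 2 := by linarith
  rw [radialOperator, deriv_logProfile hθd hθ0, deriv_logProfile (a := a) (b := b)
    (θ := fun y => κ * θ y + deriv θ y) ((hθd.const_mul κ).add hθd') fun y hy => by rw [hθ0 y hy, hθ0' y hy]; ring]
  rw [logProfile_of_pos hs, logProfile_of_pos hs, logProfile_of_pos hs, e1, hα]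
  simp only [Real.rpow_sub_one hs.ne']
  field_simp
  ring

theorem exists_unit_bump : ∃ ψ : ℝ → ℝ, ContDiff ℝ ∞ ψ ∧ (∀ y ∉ Icc (1 : ℝ) 2, ψ y = 0) ∧
    ∀ y ∈ Icc (5 / 4 : ℝ) (7 / 4), ψ y = 1 := by
  let ψ : ContDiffBump (3 / 2 : ℝ) := ⟨1 / 4, 1 / 2, by norm_num, by norm_num⟩
  refine ⟨ψ, ψ.contDiff, fun y hy => ψ.zero_of_le_dist ?_, fun y hy =>
    ψ.one_of_mem_closedBall ?_⟩
  · change 1 / 2 ≤ dist y (3 / 2)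
    rw [Real.dist_eq]
    by_contra! h
    rw [abs_lt] at h
    exact hy ⟨by linarith, by linarith⟩
  · rw [Metric.mem_closedBall, Real.dist_eq, abs_le]
    change -(1 / 4) ≤ _ ∧ _ ≤ 1 / 4
    exact ⟨by linarith [hy.1], by linarith [hy.2]⟩

theorem exists_bound_of_eq_zero {a b : ℝ} {ψ : ℝ → ℝ} (hψ : Continuous ψ)
    (h0 : ∀ y ∉ Icc a b, ψ y = 0) : ∃ M, ∀ y, |ψ y| ≤ M :=
  (HasCompactSupport.intro isCompact_Icc h0).exists_bound_of_continuous hψ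

/-- Smooth functions with values in slowly varying plateaus. -/
theorem exists_slow_bump : ∃ M : ℝ, ∀ N : ℝ, 1 ≤ N → ∃ θ : ℝ → ℝ, ContDiff ℝ ∞ θ ∧
    (∀ y ∉ Icc N (2 * N), θ y = 0) ∧ (∀ y ∈ Icc (5 / 4 * N) (7 / 4 * N), θ y = 1) ∧
    ∀ y, |θ y| ≤ M ∧ |deriv θ y| ≤ M / N ∧ |deriv (deriv θ) y| ≤ M / N := by
  obtain ⟨ψ, hψ, hψ0, hψ1⟩ := exists_unit_bump
  have hψ' : ContDiff ℝ ∞ (deriv ψ) := (contDiff_infty_iff_deriv.1 hψ).2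
  have hψ'' : ContDiff ℝ ∞ (deriv (deriv ψ)) := (contDiff_infty_iff_deriv.1 hψ').2
  have hψ0' := deriv_eq_zero_of_notMem_Icc hψ0
  obtain ⟨M₀, hM₀⟩ := exists_bound_of_eq_zero hψ.continuous hψ0
  obtain ⟨M₁, hM₁⟩ := exists_bound_of_eq_zero hψ'.continuous hψ0'
  obtain ⟨M₂, hM₂⟩ := exists_bound_of_eq_zero hψ''.continuous (deriv_eq_zero_of_notMem_Icc hψ0')
  have h0 := (abs_nonneg _).trans (hM₀ 0)
  have h1 := (abs_nonneg _).trans (hM₁ 0)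
  have h2 := (abs_nonneg _).trans (hM₂ 0)
  refine ⟨M₀ + M₁ + M₂, fun N hN => ?_⟩
  have hN0 : 0 < N := by linarith
  have ht : N⁻¹ ≤ 1 := inv_le_one_of_one_le₀ hN
  have ht0 : 0 < N⁻¹ := inv_pos.2 hN0
  have hmem : ∀ a b y : ℝ, N⁻¹ * y ∈ Icc a b ↔ y ∈ Icc (a * N) (b * N) := fun a b y => by
    rw [mem_Icc, mem_Icc, inv_mul_eq_div, le_div_iff₀ hN0, div_le_iff₀ hN0]
  have hd1 : deriv (fun y => ψ (N⁻¹ * y)) = fun y => N⁻¹ * deriv ψ (N⁻¹ * y) := funext fun y =>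
    deriv_comp_mul_left _ _ _
  have hd2 : deriv (deriv fun y => ψ (N⁻¹ * y)) =
      fun y => N⁻¹ * (N⁻¹ * deriv (deriv ψ) (N⁻¹ * y)) := funext fun y => by
    rw [hd1, deriv_const_mul_field]
    exact congrArg _ (deriv_comp_mul_left _ _ _)
  refine ⟨fun y => ψ (N⁻¹ * y), hψ.comp (contDiff_const.mul contDiff_id),
    fun y hy => hψ0 _ ?_, fun y hy => hψ1 _ ((hmem _ _ _).2 hy), fun y => ⟨?_, ?_, ?_⟩⟩
  · rwa [hmem, one_mul]
  · exact (hM₀ _).trans (by linarith)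
  · rw [hd1, abs_mul, abs_of_pos ht0, div_eq_inv_mul]
    exact mul_le_mul_of_nonneg_left ((hM₁ _).trans (by linarith)) ht0.le
  · rw [hd2, abs_mul, abs_mul, abs_of_pos ht0, div_eq_inv_mul]
    refine mul_le_mul_of_nonneg_left ?_ ht0.le
    calc N⁻¹ * |deriv (deriv ψ) (N⁻¹ * y)| ≤ 1 * M₂ := by gcongr; exact hM₂ _
      _ ≤ _ := by linarith

/-- Radial profiles which almost solve the eigenvalue equation at the bottom of the essential
spectrum. -/
theorem exists_approximate_profile {κ : ℝ} (hα : α ≤ 0) (hκ : 1 - 2 * κ = d / 2 + α) :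
    ∃ K : ℝ, ∀ N : ℝ, 1 ≤ N → ∃ p : ℝ → ℝ, IsTest (Ioi 0) p ∧
      (∀ s < Real.exp N, p s = 0) ∧
      2 ^ (α - 1) * (N / 2) ≤ ∫ s, radialWeight ((d : ℝ) / 2 - 1) (α - 1) s * p s ^ 2 ∧
      ∫ s, radialWeight ((d : ℝ) / 2 - 1) (α - 1) s *
        (radialOperator d α p s - 4 * κ ^ 2 * p s) ^ 2 ≤ K / N := by
  obtain ⟨M, hM⟩ := exists_slow_bump
  set A := 8 * κ + 2 * d - 4 with hA
  set B := 4 * κ ^ 2 + (2 * d - 4) * κ with hB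
  set K := 4 * M + (4 * M + |A| * M + |B| * M) with hK
  refine ⟨K ^ 2, fun N hN => ?_⟩
  have hN0 : 0 < N := by linarith
  obtain ⟨θ, hθ, hθ0, hθ1, hθM⟩ := hM N hN
  have hM0 : 0 ≤ M := (abs_nonneg _).trans (hθM 0).1
  have hp : IsTest (Ioi 0) (logProfile κ θ) := isTest_logProfile hθ hθ0
  have hexp : (d : ℝ) / 2 - 1 + (α - 1) + 2 * κ = -1 := by linarith
  refine ⟨logProfile κ θ, hp, fun s hs => logProfile_eq_zero hθ0 fun h =>
    absurd h.1 (not_le.2 hs), ?_, ?_⟩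
  -- The plateau where θ = 1 has logarithmic length N/2.
  · have := le_integral_radialWeight_mul_sq (a := 5 / 4 * N) (b := 7 / 4 * N) hexp
      (by linarith) (by positivity) (by linarith) hp fun s hs => by
        have hs0 : 0 < s := (Real.exp_pos _).trans_le hs.1
        rw [logProfile_of_pos hs0, hθ1, mul_one]
        rwa [mem_Icc, Real.le_log_iff_exp_le hs0, Real.log_le_iff_le_exp hs0]
    refine le_trans (le_of_eq ?_) this
    ring
  · have hr := (isTest_radialOperator (d := d) (α := α) hp).sub (hp.const_mul (4 * κ ^ 2))
    -- The residual is at most s^κ K/N on a set of logarithmic length N, so its squared norm is at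
    -- most K²/N.
    have := integral_radialWeight_mul_sq_le (a := N) (b := 2 * N) (M := K / N) hexp
      (by linarith) (by linarith) hr ?_ fun s hs => ?_
    · refine this.trans (le_of_eq ?_)
      field_simp
      ring
    · intro s hs
      by_cases h0 : 0 < s
      · have hl : Real.log s ∉ Icc N (2 * N) := by
          rwa [mem_Icc, Real.le_log_iff_exp_le h0, Real.log_le_iff_le_exp h0]
        have h1 := deriv_eq_zero_of_notMem_Icc hθ0
        rw [radialOperator_logProfile hθ hθ0 hκ h0, hθ0 _ hl, h1 _ hl,
          deriv_eq_zero_of_notMem_Icc h1 _ hl]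
        ring
      · exact hr.eq_zero (show s ∉ Ioi (0 : ℝ) from h0)
    · have hs0 : 0 < s := (Real.exp_pos _).trans_le hs.1
      obtain ⟨h0, h1, h2⟩ := hθM (Real.log s)
      have h1' : |deriv θ (Real.log s)| ≤ M := h1.trans (div_le_self hM0 hN)
      have h2' : |deriv (deriv θ) (Real.log s)| ≤ M := h2.trans (div_le_self hM0 hN)
      -- On the support s ≥ exp N ≥ N, so the lower-order terms are of order 1/N, like θ''.
      have hsN : s⁻¹ ≤ N⁻¹ := inv_anti₀ hN0 (by linarith [Real.add_one_le_exp N, hs.1])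
      rw [radialOperator_logProfile hθ hθ0 hκ hs0, abs_mul, abs_of_pos (Real.rpow_pos_of_pos hs0 κ)]
      refine mul_le_mul_of_nonneg_left ?_ (Real.rpow_nonneg hs0.le κ)
      refine (abs_sub _ _).trans ?_
      rw [abs_mul, abs_mul, abs_of_pos (inv_pos.2 hs0), abs_neg, abs_of_pos (by norm_num : (0:ℝ) < 4)]
      have h3 : |4 * deriv (deriv θ) (Real.log s) + A * deriv θ (Real.log s) +
          B * θ (Real.log s)| ≤ 4 * M + |A| * M + |B| * M := by
        refine (abs_add_three _ _ _).trans ?_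
        rw [abs_mul, abs_mul, abs_mul, abs_of_pos (by norm_num : (0 : ℝ) < 4)]
        gcongr
      calc _ ≤ 4 * (M / N) + N⁻¹ * (4 * M + |A| * M + |B| * M) := by gcongr
        _ = K / N := by rw [hK]; ring

/-- The bottom of the essential spectrum. -/
theorem quarter_mem_continuousSpectrum (hd : 2 ≤ d) (hα : α ≤ 0) :
    1 / 4 * ((d : ℝ) - 2 + 2 * α) ^ 2 ∈ continuousSpectrum d α := by
  set κ : ℝ := (1 - d / 2 - α) / 2 with hκ
  have hlam : 1 / 4 * ((d : ℝ) - 2 + 2 * α) ^ 2 = 4 * κ ^ 2 := by rw [hκ]; ring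
  obtain ⟨K, hK⟩ := exists_approximate_profile (d := d) (κ := κ) hα (by rw [hκ]; ring)
  choose p hp hp0 hlow hres using fun n : ℕ => hK ((n : ℝ) + 1) (by linarith [n.cast_nonneg (α := ℝ)])
  obtain ⟨c, hc, hint⟩ := exists_integral_radial_weight (d := d) (by omega)
  have hint' : ∀ g : ℝ → ℝ, IsTest (Ioi 0) g →
      ∫ x : EuclideanSpace ℝ (Fin d), g (‖x‖ ^ 2) ∂(weightMeasure d (α - 1)) =
        c * ∫ s, radialWeight ((d : ℝ) / 2 - 1) (α - 1) s * g s := fun g hg => by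
    rw [integral_weightMeasure]
    simpa using hint 0 (α - 1) g hg
  have hr : ∀ n, IsTest (Ioi 0) fun s => radialOperator d α (p n) s - 4 * κ ^ 2 * p n s := fun n =>
    (isTest_radialOperator (hp n)).sub ((hp n).const_mul _)
  have h2 : (0 : ℝ) < 2 ^ (α - 1) := by positivity
  have hDn : ∀ n : ℕ, c * (2 ^ (α - 1) * (((n : ℝ) + 1) / 2)) ≤
      ∫ x : EuclideanSpace ℝ (Fin d), p n (‖x‖ ^ 2) ^ 2 ∂(weightMeasure d (α - 1)) := fun n => by
    rw [hint' _ (hp n).sq]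
    exact mul_le_mul_of_nonneg_left (hlow n) hc.le
  have hRn : ∀ n : ℕ, ∫ x : EuclideanSpace ℝ (Fin d),
      (radialOperator d α (p n) (‖x‖ ^ 2) - 4 * κ ^ 2 * p n (‖x‖ ^ 2)) ^ 2
        ∂(weightMeasure d (α - 1)) ≤ c * (K / ((n : ℝ) + 1)) := fun n => by
    rw [hint' _ (hr n).sq]
    exact mul_le_mul_of_nonneg_left (hres n) hc.le
  rw [hlam]
  refine mem_continuousSpectrum_of_support (fun n => isInGraph_radial_of_isTest hd hα (hp n))
    (fun n => lt_of_lt_of_le (by positivity) (hDn n)) ?_ fun n x hx => hp0 n _ ?_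
  -- Squared norms grow at least like n and squared residuals are of order 1/n, so the quotient is
  -- of order 1/n².
  · have hlim : Tendsto (fun n : ℕ => (2 ^ (α - 1) * (1 / 2))⁻¹ * K * (1 / ((n : ℝ) + 1) *
        (1 / ((n : ℝ) + 1)))) atTop (𝓝 0) := by
      have h := tendsto_one_div_add_atTop_nhds_zero_nat (𝕜 := ℝ)
      have h' := (h.mul h).const_mul ((2 ^ (α - 1) * (1 / 2))⁻¹ * K)
      rwa [mul_zero, mul_zero] at h'
    refine squeeze_zero (fun n => mul_nonneg (inv_nonneg.2 (integral_nonneg fun _ => sq_nonneg _))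
      (integral_nonneg fun _ => sq_nonneg _)) (fun n => ?_) hlim
    have hn : (0 : ℝ) < n + 1 := by positivity
    calc _ ≤ (c * (2 ^ (α - 1) * (((n : ℝ) + 1) / 2)))⁻¹ * (c * (K / ((n : ℝ) + 1))) :=
          mul_le_mul (inv_anti₀ (by positivity) (hDn n)) (hRn n)
            (integral_nonneg fun _ => sq_nonneg _) (by positivity)
      _ = _ := by field_simp
  -- The profile vanishes for |x|² < exp(n+1), and this covers |x| < n because n² < exp(n+1).
  · have h1 := Real.quadratic_le_exp_of_nonneg (n.cast_nonneg (α := ℝ))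
    have h3 := Real.add_one_le_exp (1 : ℝ)
    have h4 : ‖x‖ ^ 2 < (n : ℝ) ^ 2 := pow_lt_pow_left₀ hx (norm_nonneg _) two_ne_zero
    rw [Real.exp_add]
    nlinarith [Real.exp_pos (n : ℝ), n.cast_nonneg (α := ℝ)]

end Bottom

end HardyPoincare

end

/-! ### Assembly of the theorem -/

theorem mainTheorem3 (d : ℕ) (hd : 2 ≤ d) (α : ℝ) (hα : α < -((d : ℝ) + 2) / 2) :
    (3 ≤ d →
      (α ∈ Ico (-((d : ℝ) + 6) / 2) (-((d : ℝ) + 2) / 2) →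
        IsSharpConstant d α (1 / 4 * ((d : ℝ) - 2 + 2 * α) ^ 2)) ∧
      (α ∈ Icc (-((d : ℝ) + 2)) (-((d : ℝ) + 6) / 2) →
        IsSharpConstant d α (-8 * α - 4 * ((d : ℝ) + 2))) ∧
      (α ∈ Iic (-((d : ℝ) + 2)) →
        IsSharpConstant d α (-4 * α))) ∧
    (d = 2 →
      (α ∈ Ico (-4 : ℝ) (-2) → IsSharpConstant d α (α ^ 2)) ∧
      (α ∈ Iio (-4 : ℝ) → IsSharpConstant d α (-4 * α))) ∧
    -- the spectral origin of the constants
    (α ∈ Ico (-((d : ℝ) + 6) / 2) (-((d : ℝ) + 2) / 2) →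
      IsGLB (continuousSpectrum d α) (1 / 4 * ((d : ℝ) - 2 + 2 * α) ^ 2)) ∧
    (α ∈ Ico (-((d : ℝ) + 2)) (-((d : ℝ) + 6) / 2) →
      ∃ f : EuclideanSpace ℝ (Fin d) → ℝ,
        IsAdmissible α f ∧ IsEigenfunction α (-8 * α - 4 * ((d : ℝ) + 2)) f) ∧
    (α ∈ Iic (-((d : ℝ) + 2)) →
      ∃ f : EuclideanSpace ℝ (Fin d) → ℝ,
        IsAdmissible α f ∧ IsEigenfunction α (-4 * α) f) := by
  have hα0 : α ≤ 0 := by linarith [(Nat.cast_nonneg d : (0 : ℝ) ≤ d)]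
  have hquarter : α ∈ Ico (-((d : ℝ) + 6) / 2) (-((d : ℝ) + 2) / 2) →
      IsSharpConstant d α (1 / 4 * ((d : ℝ) - 2 + 2 * α) ^ 2) := fun h =>
    ⟨hardyPoincareInequality_quarter hd h, fun c hc =>
      le_of_mem_continuousSpectrum hd hα hc (quarter_mem_continuousSpectrum hd hα0)⟩
  have hquadrupole : α ∈ Iic (-((d : ℝ) + 2)) → IsSharpConstant d α (-4 * α) := fun h => by
    obtain ⟨f, ha, hf⟩ := exists_quadrupole_eigenfunction hd hα
    exact ⟨hardyPoincareInequality_quadrupole hd h, fun c hc =>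
      le_of_isEigenfunction_of_isAdmissible hc ha hf⟩
  refine ⟨fun _ => ⟨hquarter, fun h => ?_, hquadrupole⟩, fun h2 => ?_, fun h => ?_, fun h =>
    exists_radial_eigenfunction hd h.2, fun _ => exists_quadrupole_eigenfunction hd hα⟩
  · rcases h.2.lt_or_eq with hlt | heq
    · obtain ⟨f, ha, hf⟩ := exists_radial_eigenfunction hd hlt
      exact ⟨hardyPoincareInequality_radial hd h, fun c hc =>
        le_of_isEigenfunction_of_isAdmissible hc ha hf⟩
    -- At α = -(d+6)/2 the radial polynomial is no longer known to be square integrable, but there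
    -- the two constants agree, and sharpness comes from the essential spectrum.
    · convert hquarter ⟨heq.ge, hα⟩ using 1
      rw [heq]
      ring
  -- For d = 2 both -(d+6)/2 and -(d+2) equal -4, so the middle range shrinks to a point.
  · subst h2
    have e : ((2 : ℕ) : ℝ) = 2 := Nat.cast_ofNat
    rw [e] at hquarter hquadrupole
    refine ⟨fun h => ?_, fun h => hquadrupole (mem_Iic.2 (by linarith [mem_Iio.1 h]))⟩
    convert hquarter ⟨by linarith [h.1], by linarith [h.2]⟩ using 1
    ring
  · have hmem := quarter_mem_continuousSpectrum hd hα0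
    -- The infimum is attained: the Weyl sequence puts the constant in the spectrum, and the
    -- inequality itself bounds the spectrum from below.
    exact IsLeast.isGLB ⟨hmem, fun c hc =>
      le_of_mem_continuousSpectrum hd hα (hardyPoincareInequality_quarter hd h) hc⟩
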